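/- Let $d\ge 1$ and let $e=(\mathbf e_1,\dots,\mathbf e_{q_1})$ and $f=(\mathbf f_1,\dots,\mathbf f_{q_2})$ be two finite disjoint sequences of nonzero vectors in $\mathbb N^d$ (that is, $\mathbf e_i\ne\mathbf f_j$ for all $i,j$) with $\sum_i\mathbf e_i=\sum_j\mathbf f_j$. For $\mathbf n\in\mathbb N^d$ put $$\mathcal Q_{e,f}(\mathbf n)=\frac{\prod_{i=1}^{q_1}(\mathbf e_i\cdot\mathbf n)!}{\prod_{j=1}^{q_2}(\mathbf f_j\cdot\mathbf n)!},$$ and for $\mathbf x\in\mathbb R^d$ put $\Delta_{e,f}(\mathbf x)=\sum_{i}\lfloor\mathbf e_i\cdot\mathbf x\rfloor-\sum_{j}\lfloor\mathbf f_j\cdot\mathbf x\rfloor$. Let $\mathcal D_{e,f}$ be the set of all $\mathbf x\in[0,1)^d$ such that $\mathbf c\cdot\mathbf x\ge 1$ for some term $\mathbf c$ of $e$ or $f$, and let $\mathcal E_{e,f}$ be the set of all $\mathbf L\in\mathbb N^d\setminus\{\mathbf 0\}$ such that $\mathbf L\le\mathbf c$ coordinatewise for some term $\mathbf c$ of $e$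 or $f$. With $H_m=\sum_{i=1}^m 1/i$, $\mathbf v^{(k)}$ the $k$-th coordinate of $\mathbf v$, and $\mathbf z=(z_1,\dots,z_d)$, define the formal power series over $\mathbb Q$ $$F(\mathbf z)=\sum_{\mathbf n\in\mathbb N^d}\mathcal Q_{e,f}(\mathbf n)\mathbf z^{\mathbf n},\qquad G_{\mathbf L}(\mathbf z)=\sum_{\mathbf n\in\mathbb N^d}\mathcal Q_{e,f}(\mathbf n)H_{\mathbf L\cdot\mathbf n}\,\mathbf z^{\mathbf n},$$ $$G_k(\mathbf z)=\sum_{\mathbf n\in\mathbb N^d}\mathcal Q_{e,f}(\mathbf n)\Big(\sum_i\mathbf e_i^{(k)}H_{\mathbf e_i\cdot\mathbf n}-\sum_j\mathbf f_j^{(k)}H_{\mathbf f_j\cdot\mathbf n}\Big)\mathbf z^{\mathbf n},$$ $$q_{\mathbf L}(\mathbf z)=\exp\big(G_{\mathbf L}(\mathbf z)/F(\mathbf z)\big),\qquad q_k(\mathbf z)=z_k\exp\big(G_k(\mathbf z)/F(\mathbf z)\big).$$ Then $\mathcal Q_{e,f}(\mathbf n)$ is an integer for every $\mathbf n\in\mathbb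 N^d$ if and only if $\Delta_{e,f}\ge 0$ on $[0,1]^d$. If these equivalent conditions hold, then: (i) If $\Delta_{e,f}(\mathbf x)\ge 1$ for all $\mathbf x\in\mathcal D_{e,f}$, then $q_{\mathbf L}(\mathbf z)\in\mathbb Z[[\mathbf z]]$ for all $\mathbf L\in\mathcal E_{e,f}$. (ii) If $\Delta_{e,f}(\mathbf x)=0$ for some $\mathbf x\in\mathcal D_{e,f}$, then there is a $k\in\{1,\dots,d\}$ such that, for every $\mathbf L\in\mathcal E_{e,f}$ with $\mathbf L^{(k)}\ge 1$, there are only finitely many primes $p$ with $q_{\mathbf L}(\mathbf z)\in\mathbb Z_p[[\mathbf z]]$, and, moreover, there are only finitely many primes $p$ with $q_k(\mathbf z)\in z_k\mathbb Z_p[[\mathbf z]]$. -/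

import Mathlib

open scoped Nat

noncomputable section

namespace MirrorMap

/-- `𝒬_{e,f}(n) = ∏ (eᵢ · n)! / ∏ (fⱼ · n)!`, a rational number, for two finite sequences
`e`, `f` of vectors of `ℕ^d`. -/
def factRatio {d q₁ q₂ : ℕ} (e : Fin q₁ → Fin d → ℕ) (f : Fin q₂ → Fin d → ℕ)
    (n : Fin d → ℕ) : ℚ :=
  (∏ i, ((e i ⬝ᵥ n)! : ℚ)) / ∏ j, ((f j ⬝ᵥ n)! : ℚ)

/-- `𝒬_{e,f}` is a family of integers. -/
def IsIntegralFamily {d q₁ q₂ : ℕ} (e : Fin q₁ → Fin d → ℕ) (f : Fin q₂ → Fin d → ℕ) : Prop :=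
  ∀ n : Fin d → ℕ, ∃ a : ℤ, factRatio e f n = a

/-- The scalar product `c · x` of `c ∈ ℕ^d` and `x ∈ ℝ^d`. -/
def dotReal {d : ℕ} (c : Fin d → ℕ) (x : Fin d → ℝ) : ℝ :=
  ∑ k, (c k : ℝ) * x k

/-- Landau's function `Δ_{e,f}(x) = ∑ ⌊eᵢ · x⌋ - ∑ ⌊fⱼ · x⌋`. -/
def landau {d q₁ q₂ : ℕ} (e : Fin q₁ → Fin d → ℕ) (f : Fin q₂ → Fin d → ℕ)
    (x : Fin d → ℝ) : ℤ :=
  ∑ i, ⌊dotReal (e i) x⌋ - ∑ j, ⌊dotReal (f j) x⌋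

/-- `𝒟_{e,f}`: the points `x` of `[0,1[^d` such that `c · x ≥ 1` for some term `c` of `e` or
of `f`. -/
def domainD {d q₁ q₂ : ℕ} (e : Fin q₁ → Fin d → ℕ) (f : Fin q₂ → Fin d → ℕ) :
    Set (Fin d → ℝ) :=
  {x | (∀ k, 0 ≤ x k ∧ x k < 1) ∧
    ((∃ i, 1 ≤ dotReal (e i) x) ∨ ∃ j, 1 ≤ dotReal (f j) x)}

/-- `ℰ_{e,f}`: the nonzero `L ∈ ℕ^d` that lie coordinatewise below some term of `e` or of `f`. -/
def setE {d q₁ q₂ : ℕ} (e : Fin q₁ → Fin d → ℕ) (f : Fin q₂ → Fin d → ℕ) :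
    Set (Fin d → ℕ) :=
  {L | L ≠ 0 ∧ ((∃ i, L ≤ e i) ∨ ∃ j, L ≤ f j)}

/-- The formal power series `F_{e,f}(z) = ∑ₙ 𝒬_{e,f}(n) z^n`. -/
def seriesF {d q₁ q₂ : ℕ} (e : Fin q₁ → Fin d → ℕ) (f : Fin q₂ → Fin d → ℕ) :
    MvPowerSeries (Fin d) ℚ :=
  fun n => factRatio e f n

/-- The formal power series
`G_{e,f,k}(z) = ∑ₙ 𝒬_{e,f}(n) (∑ᵢ eᵢ^{(k)} H_{eᵢ · n} - ∑ⱼ fⱼ^{(k)} H_{fⱼ · n}) z^n`. -/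
def seriesG {d q₁ q₂ : ℕ} (e : Fin q₁ → Fin d → ℕ) (f : Fin q₂ → Fin d → ℕ) (k : Fin d) :
    MvPowerSeries (Fin d) ℚ :=
  fun n => factRatio e f n *
    (∑ i, (e i k : ℚ) * harmonic (e i ⬝ᵥ ⇑n) - ∑ j, (f j k : ℚ) * harmonic (f j ⬝ᵥ ⇑n))

/-- The formal power series `G_{L,e,f}(z) = ∑ₙ 𝒬_{e,f}(n) H_{L · n} z^n`. -/
def seriesGL {d q₁ q₂ : ℕ} (L : Fin d → ℕ) (e : Fin q₁ → Fin d → ℕ) (f : Fin q₂ → Fin d → ℕ) :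
    MvPowerSeries (Fin d) ℚ :=
  fun n => factRatio e f n * harmonic (L ⬝ᵥ ⇑n)

/-- `exp(g)`, obtained by substituting `g` in the exponential series. It is used below only for
series `g` with zero constant coefficient. -/
def expSeries {d : ℕ} (g : MvPowerSeries (Fin d) ℚ) : MvPowerSeries (Fin d) ℚ :=
  (PowerSeries.exp ℚ).subst g

/-- The canonical coordinate `q_{e,f,k}(z) = z_k exp(G_{e,f,k}(z) / F_{e,f}(z))`. -/
def canonicalCoord {d q₁ q₂ : ℕ} (e : Fin q₁ → Fin d → ℕ) (f : Fin q₂ → Fin d → ℕ)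
    (k : Fin d) : MvPowerSeries (Fin d) ℚ :=
  MvPowerSeries.X k * expSeries (seriesG e f k * (seriesF e f)⁻¹)

/-- The mirror-type map `q_{L,e,f}(z) = exp(G_{L,e,f}(z) / F_{e,f}(z))`. -/
def mirrorType {d q₁ q₂ : ℕ} (L : Fin d → ℕ) (e : Fin q₁ → Fin d → ℕ)
    (f : Fin q₂ → Fin d → ℕ) : MvPowerSeries (Fin d) ℚ :=
  expSeries (seriesGL L e f * (seriesF e f)⁻¹)

/-- `g ∈ ℤ[[z]]`. -/
def HasIntCoeffs {d : ℕ} (g : MvPowerSeries (Fin d) ℚ) : Prop :=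
  ∃ h : MvPowerSeries (Fin d) ℤ, g = MvPowerSeries.map (Int.castRingHom ℚ) h

/-- `g ∈ ℤ_p[[z]]`. -/
def HasPadicIntCoeffs (p : ℕ) [Fact p.Prime] {d : ℕ} (g : MvPowerSeries (Fin d) ℚ) : Prop :=
  ∃ h : MvPowerSeries (Fin d) ℤ_[p],
    MvPowerSeries.map (Rat.castHom ℚ_[p]) g = MvPowerSeries.map PadicInt.Coe.ringHom h

/-- `g ∈ z_k ℤ_p[[z]]`. -/
def MemXMulPadicInt (p : ℕ) [Fact p.Prime] {d : ℕ} (k : Fin d)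
    (g : MvPowerSeries (Fin d) ℚ) : Prop :=
  ∃ h : MvPowerSeries (Fin d) ℤ_[p],
    MvPowerSeries.map (Rat.castHom ℚ_[p]) g =
      MvPowerSeries.X k * MvPowerSeries.map PadicInt.Coe.ringHom h

end MirrorMap

end

/-!
Write `𝒬` for the factorial quotient, `Δ` for Landau's function and `cᵢ` for the terms of `e` and
`f` together. By Legendre's formula, `v_p(𝒬(n)) = ∑_{l ≥ 1} Δ(n / p^l)`, and `Δ` only depends on
fractional parts because the two sequences have equal sums. This gives Landau's criterion
(`isIntegralFamily_iff`): if `Δ` is negative at some real point `x`, then for large `p` the point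
`a / p` with `a = ⌈p x⌉` has the same value of `Δ`, and `v_p(𝒬(a)) = Δ(x)`.

By the Dieudonné–Dwork lemma (`integral_fexp_div_iff`), `exp(G / F)` is `p`-integral if and only if
`F(z) G(z^p) - p F(z^p) G(z)` is divisible by `p`, that is, if and only if `p` divides the
coefficients `dworkCoeff` of this series at `a + pK`, where `0 ≤ a < p` coordinatewise
(`integral_fexp_iff_dworkCoeff`).

**Integrality.** Suppose `Δ ≥ 1` on `𝒟`. Say that the `l`-th digit of `n` is active if the vector of
fractional parts of `n / p^l` lies in `𝒟`; then `𝒬(n)` is divisible by `p` to the number of active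
digits (`norm_facQuot_le_activeWeight`). The key point (`isActive_of_pow_dvd`) is that if
`L ≤ cᵢ`, `1 ≤ r ≤ ⌊L · v / p⌋` and `p^s` divides `L · j + r`, then the `s + 1` lowest digits of
`v + pj` are active. So whatever denominators arise in differences of harmonic numbers, or in
comparing `𝒬(v + p(u + p^s n)) / 𝒬(v + pu)` with `𝒬(u + p^s n) / 𝒬(u)`, are compensated, with a
factor `p` to spare. Hence `p H_{L · (a + pj)}` may be replaced by `H_{L · j}` in `dworkCoeff`,
which leaves `∑ⱼ H_{L · j} tⱼ` with the antisymmetric terms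
`tⱼ = 𝒬(a + p(K - j)) 𝒬(j) - 𝒬(K - j) 𝒬(a + pj)`. Dwork's formal congruences (`norm_dworkSum_le`),
with the number of active digits as weight and with the truncation `Ψ_s = {u : cᵢ · u < p^s for
all i}`, say that sums of `tⱼ` over blocks of length `p^s` are divisible by `p^(s+1)` times the
weight; summing by parts over digits (`norm_sum_harm_mul_dworkTerm_sub_le`) gives the claim.

**Failure.** Suppose `Δ(x) = 0` for some `x ∈ 𝒟`. Moving `x` slightly along the moment curve changes
no floor and makes the values `eᵢ · x` different from the `fⱼ · x` (`exists_generic_zero`). Along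
the segment from `0` to `x` the function `Δ` is nonnegative, and it is positive at its first
possible jump, where no cancellation occurs. The jumps are at the points `r / (cᵢ · x)`, so summing
`1 / γ` over the jumps `γ`, with signs, gives `∑ᵢ ± (cᵢ · x) H_{⌊cᵢ · x⌋} > 0`, and therefore
`∑ᵢ ± cᵢ^{(k)} H_{⌊cᵢ · x⌋} ≠ 0` for some coordinate `k` (`exists_sum_harmonic_ne_zero`). Fix it,
let `p` be large and `a = ⌈p x⌉`; then `𝒬(a)` is a unit at `p`. For `q_k`, the coefficient at `a` is
up to sign congruent to `𝒬(a)` times the above sum. For `q_L` with `⌊L · x⌋ ≥ 1`, the coefficient at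
`a` is likewise congruent to a unit times `H_{⌊L · x⌋}`. If `⌊L · x⌋ = 0`, then modulo `p` the
quotient `𝒬(a + pn) / (𝒬(a) 𝒬(n))` is a rational number `growth n` independent of `p`; by the choice
of `k` it is not identically `1` on the `k`-th axis (`exists_growth_ne_one`), since its logarithmic
derivative at the origin is that sum. With `T` minimal such that `growth` is not `1` at `T` on this
axis, all but one term of the coefficient at `a` plus `pT` times the `k`-th unit vector cancel, and
a nonzero rational number remains (`obstruction_ne_zero`).
-/


namespace MirrorMap

open MvPowerSeries Filter Topology

/-! ### The formal exponential -/

section FormalExp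

variable {τ A : Type*} [CommRing A] [Algebra ℚ A]

/-- The formal exponential `exp(h)` over an arbitrary `ℚ`-algebra, by substitution. -/
noncomputable def fexp (h : MvPowerSeries τ A) : MvPowerSeries τ A :=
  (PowerSeries.exp A).subst h

theorem fexp_add {a b : MvPowerSeries τ A} (ha : constantCoeff a = 0)
    (hb : constantCoeff b = 0) : fexp (a + b) = fexp a * fexp b := by
  have key : (PowerSeries.exp A).subst (X 0 + X 1 : MvPowerSeries (Fin 2) A) =
      (PowerSeries.exp A).subst (X 0 : MvPowerSeries (Fin 2) A) *
        (PowerSeries.exp A).subst (X 1 : MvPowerSeries (Fin 2) A) := by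
    ext n
    rw [PowerSeries.coeff_subst_X_zero_add_X_one, PowerSeries.coeff_subst_X_zero_subst_mul_X_one]
    simp only [PowerSeries.coeff_exp]
    rw [← map_natCast (algebraMap ℚ A), ← map_mul, ← map_mul, Nat.cast_add_choose]
    congr 1
    have h0 : ((n 0 + n 1)! : ℚ) ≠ 0 := by exact_mod_cast Nat.factorial_ne_zero _
    have h1 : ((n 0)! : ℚ) ≠ 0 := by exact_mod_cast Nat.factorial_ne_zero _
    have h2 : ((n 1)! : ℚ) ≠ 0 := by exact_mod_cast Nat.factorial_ne_zero _
    field_simp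
  have hs : HasSubst ![a, b] := by
    refine hasSubst_of_constantCoeff_zero fun i => ?_
    fin_cases i <;> simpa
  have hX : ∀ i : Fin 2, PowerSeries.HasSubst (X i : MvPowerSeries (Fin 2) A) := fun i =>
    PowerSeries.HasSubst.X i
  have hXX : PowerSeries.HasSubst (X 0 + X 1 : MvPowerSeries (Fin 2) A) := (hX 0).add (hX 1)
  have comp : ∀ c : MvPowerSeries (Fin 2) A, PowerSeries.HasSubst c →
      MvPowerSeries.subst ![a, b] ((PowerSeries.exp A).subst c) =
        fexp (MvPowerSeries.subst ![a, b] c) := fun c hc => by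
    unfold fexp PowerSeries.subst
    rw [subst_comp_subst_apply hc.const hs]
  have := congrArg (MvPowerSeries.subst ![a, b]) key
  rw [subst_mul hs, comp _ hXX, comp _ (hX 0), comp _ (hX 1), subst_add hs, subst_X hs,
    subst_X hs] at this
  simpa using this

theorem fexp_zero : fexp (0 : MvPowerSeries τ A) = 1 := by
  unfold fexp
  rw [PowerSeries.subst_zero_eq_C_constantCoeff]
  simp

theorem fexp_nsmul {h : MvPowerSeries τ A} (hh : constantCoeff h = 0) (n : ℕ) :
    fexp (n • h) = fexp h ^ n := by
  induction n with
  | zero => simp [fexp_zero]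
  | succ n ih => rw [succ_nsmul, fexp_add (by simp [hh]) hh, ih, pow_succ]

theorem expand_fexp {h : MvPowerSeries τ A} (hh : constantCoeff h = 0) {p : ℕ} (hp : p ≠ 0) :
    expand p hp (fexp h) = fexp (expand p hp h) := by
  unfold fexp PowerSeries.subst
  rw [expand_subst]
  exact (PowerSeries.HasSubst.of_constantCoeff_zero hh).const

theorem map_fexp {B : Type*} [CommRing B] [Algebra ℚ B] (F : A →+* B) {h : MvPowerSeries τ A}
    (hh : constantCoeff h = 0) : MvPowerSeries.map F (fexp h) = fexp (MvPowerSeries.map F h) := by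
  unfold fexp
  rw [PowerSeries.map_subst (PowerSeries.HasSubst.of_constantCoeff_zero hh), PowerSeries.map_exp]

theorem constantCoeff_fexp {h : MvPowerSeries τ A} (hh : constantCoeff h = 0) :
    constantCoeff (fexp h) = 1 := by
  unfold fexp
  have e1 : PowerSeries.exp A = 1 + (PowerSeries.exp A - 1) := by ring
  have hs := PowerSeries.HasSubst.of_constantCoeff_zero hh
  rw [e1, ← PowerSeries.coe_substAlgHom hs, map_add, map_one, map_add,
    PowerSeries.coe_substAlgHom hs, PowerSeries.constantCoeff_subst_eq_zero hh _ (by simp)]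
  simp

/-- If all coefficients of `δ` strictly below `n` vanish, then only the constant coefficient of
`B` enters the `n`-th coefficient of `δ * B`. -/
theorem coeff_mul_of_forall_lt {A : Type*} [CommRing A] {δ : MvPowerSeries τ A} {n : τ →₀ ℕ}
    (hδ : ∀ m < n, coeff m δ = 0)
    (B : MvPowerSeries τ A) : coeff n (δ * B) = coeff n δ * constantCoeff B := by
  classical
  rw [coeff_mul, Finset.sum_eq_single (n, 0)]
  · simp
  · rintro ⟨x, y⟩ hxy hne
    rw [Finset.HasAntidiagonal.mem_antidiagonal] at hxy
    simp only at hxy ⊢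
    have hlt : x < n := by
      refine lt_of_le_of_ne (hxy ▸ le_self_add) fun h => hne ?_
      subst h
      simpa using hxy
    rw [hδ x hlt, zero_mul]
  · simp

/-- Changing `h` by a series `δ` that vanishes below `n` changes the `n`-th coefficient of
`exp(h)` by that of `δ`. -/
theorem coeff_fexp_add_of_forall_lt {h δ : MvPowerSeries τ A} {n : τ →₀ ℕ}
    (hh : constantCoeff h = 0) (hδ0 : constantCoeff δ = 0) (hδ : ∀ m < n, coeff m δ = 0) :
    coeff n (fexp (h + δ)) = coeff n (fexp h) + coeff n δ := by
  obtain ⟨ψ, hψ⟩ : (PowerSeries.X : PowerSeries A) ∣ PowerSeries.exp A - 1 :=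
    PowerSeries.X_dvd_iff.2 (by simp)
  have hψ0 : PowerSeries.constantCoeff ψ = 1 := by
    have := congrArg (PowerSeries.coeff 1) hψ
    rw [show (1 : ℕ) = 0 + 1 from rfl, PowerSeries.coeff_succ_X_mul] at this
    simpa [PowerSeries.coeff_exp, PowerSeries.coeff_one] using this.symm
  have hs := PowerSeries.HasSubst.of_constantCoeff_zero hδ0
  have e1 : fexp δ = 1 + δ * ψ.subst δ := by
    unfold fexp
    rw [show PowerSeries.exp A = 1 + PowerSeries.X * ψ by rw [← hψ]; ring,
      ← PowerSeries.coe_substAlgHom hs, map_add, map_one, map_mul,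
      PowerSeries.coe_substAlgHom hs, PowerSeries.subst_X hs]
  have hc : constantCoeff (ψ.subst δ) = 1 := by
    rw [show ψ = 1 + (ψ - 1) by ring, ← PowerSeries.coe_substAlgHom hs, map_add, map_one, map_add,
      PowerSeries.coe_substAlgHom hs,
      PowerSeries.constantCoeff_subst_eq_zero hδ0 _ (by simp [hψ0])]
    simp
  rw [fexp_add hh hδ0, e1, mul_add, mul_one, map_add, mul_left_comm,
    coeff_mul_of_forall_lt hδ]
  simp [hc, constantCoeff_fexp hh]

end FormalExp

/-! ### The Dieudonné–Dwork lemma -/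

section DieudonneDwork

variable {τ : Type*} {p : ℕ} [Fact p.Prime]

/-- A series over `ℚ_p` with all coefficients in `ℤ_p`. -/
def Integral (g : MvPowerSeries τ ℚ_[p]) : Prop := ∀ n, ‖coeff n g‖ ≤ 1

/-- A series over `ℚ_p` with all coefficients in `pℤ_p`. -/
def IntegralDivP (g : MvPowerSeries τ ℚ_[p]) : Prop := ∀ n, ‖coeff n g‖ ≤ (p : ℝ)⁻¹

theorem integral_iff_exists {g : MvPowerSeries τ ℚ_[p]} :
    Integral g ↔ ∃ h : MvPowerSeries τ ℤ_[p], g = MvPowerSeries.map PadicInt.Coe.ringHom h := by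
  constructor
  · intro hg
    let h : MvPowerSeries τ ℤ_[p] := fun n => ⟨coeff n g, hg n⟩
    refine ⟨h, ?_⟩
    ext n
    rw [coeff_map]
    rfl
  · rintro ⟨h, rfl⟩ n
    rw [coeff_map]
    exact (coeff n h).2

theorem integral_map (h : MvPowerSeries τ ℤ_[p]) :
    Integral (MvPowerSeries.map PadicInt.Coe.ringHom h) := integral_iff_exists.2 ⟨h, rfl⟩

theorem Integral.mul {g h : MvPowerSeries τ ℚ_[p]} (hg : Integral g) (hh : Integral h) :
    Integral (g * h) := by
  obtain ⟨g, rfl⟩ := integral_iff_exists.1 hg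
  obtain ⟨h, rfl⟩ := integral_iff_exists.1 hh
  rw [← map_mul]
  exact integral_map _

theorem Integral.expand {g : MvPowerSeries τ ℚ_[p]} (hg : Integral g) (hp : p ≠ 0) :
    Integral (expand p hp g) := by
  obtain ⟨g, rfl⟩ := integral_iff_exists.1 hg
  rw [← map_expand]
  exact integral_map _

theorem norm_p_mul_le_iff (x : ℚ_[p]) : ‖(p : ℚ_[p]) * x‖ ≤ (p : ℝ)⁻¹ ↔ ‖x‖ ≤ 1 := by
  have hp : (0 : ℝ) < (p : ℝ)⁻¹ := by
    have := (Fact.out : p.Prime).pos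
    positivity
  rw [norm_mul, Padic.norm_p]
  constructor
  · intro h
    by_contra hx
    push Not at hx
    nlinarith
  · intro h
    nlinarith

theorem integralDivP_iff {g : MvPowerSeries τ ℚ_[p]} :
    IntegralDivP g ↔ ∃ r, Integral r ∧ g = (p : ℚ_[p]) • r := by
  have hp0 : (p : ℚ_[p]) ≠ 0 := by exact_mod_cast (Fact.out : p.Prime).ne_zero
  constructor
  · intro hg
    refine ⟨(p : ℚ_[p])⁻¹ • g, fun n => ?_, by rw [smul_smul, mul_inv_cancel₀ hp0, one_smul]⟩
    rw [← norm_p_mul_le_iff, coeff_smul, mul_inv_cancel_left₀ hp0]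
    exact hg n
  · rintro ⟨r, hr, rfl⟩ n
    rw [coeff_smul, norm_p_mul_le_iff]
    exact hr n

theorem IntegralDivP.mul {g h : MvPowerSeries τ ℚ_[p]} (hg : IntegralDivP g) (hh : Integral h) :
    IntegralDivP (g * h) := by
  obtain ⟨r, hr, rfl⟩ := integralDivP_iff.1 hg
  rw [smul_mul_assoc]
  exact integralDivP_iff.2 ⟨_, hr.mul hh, rfl⟩

/-- An integral series with constant coefficient `1` has an integral inverse. -/
theorem Integral.inv {g : MvPowerSeries τ ℚ_[p]} (hg : Integral g) (h1 : constantCoeff g = 1) :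
    Integral g⁻¹ := by
  obtain ⟨h, rfl⟩ := integral_iff_exists.1 hg
  have hc : constantCoeff h = 1 := by
    rw [constantCoeff_map] at h1
    exact Subtype.ext h1
  have hu : IsUnit h := by
    rw [MvPowerSeries.isUnit_iff_constantCoeff, hc]
    exact isUnit_one
  obtain ⟨k, hk⟩ := hu.exists_right_inv
  have : (MvPowerSeries.map PadicInt.Coe.ringHom h)⁻¹ =
      MvPowerSeries.map PadicInt.Coe.ringHom k := by
    rw [MvPowerSeries.inv_eq_iff_mul_eq_one (by rw [h1]; exact one_ne_zero), mul_comm, ← map_mul,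
      hk, map_one]
  rw [this]
  exact integral_map _

/-- `g(z^p) ≡ g(z)^p` modulo `p` for a series over `ℤ_p`. -/
theorem integralDivP_expand_sub_pow {g : MvPowerSeries τ ℚ_[p]} (hg : Integral g) (hp : p ≠ 0) :
    IntegralDivP (expand p hp g - g ^ p) := by
  obtain ⟨h, rfl⟩ := integral_iff_exists.1 hg
  rw [← map_expand, ← map_pow, ← map_sub]
  intro n
  rw [coeff_map]
  have key : MvPowerSeries.map (PadicInt.toZMod (p := p)) (expand p hp h - h ^ p) = 0 := by
    rw [map_sub, map_pow, map_expand, ← map_frobenius_expand p hp, ZMod.frobenius_zmod,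
      MvPowerSeries.map_id]
    simp
  have h0 := congrArg (coeff n) key
  rw [coeff_map] at h0
  have : coeff n (expand p hp h - h ^ p) ∈ Ideal.span {(p : ℤ_[p])} := by
    rw [← PadicInt.maximalIdeal_eq_span_p, ← PadicInt.ker_toZMod]
    simpa [RingHom.mem_ker] using h0
  rw [Ideal.mem_span_singleton] at this
  obtain ⟨y, hy⟩ := this
  rw [hy]
  change ‖((p * y : ℤ_[p]) : ℚ_[p])‖ ≤ _
  push_cast
  rw [norm_p_mul_le_iff]
  exact y.2

/-- `p^n / n!` is divisible by `p` for `n ≥ 1`, also when `p = 2`. -/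
theorem norm_pow_div_factorial_le (n : ℕ) : ‖(p : ℚ_[p]) ^ n / ((n + 1)! : ℚ_[p])‖ ≤ 1 := by
  have hp := (Fact.out : p.Prime)
  have hdvd : ¬ p ^ (n + 1) ∣ (n + 1)! := by
    intro h
    have h1 := sub_one_mul_padicValNat_factorial_lt_of_ne_zero p (Nat.succ_ne_zero n)
    have h2 := (padicValNat_dvd_iff_le (Nat.factorial_ne_zero (n + 1))).1 h
    have h3 : 1 ≤ p - 1 := by have := hp.two_le; omega
    nlinarith
  have hnorm : (p : ℝ) ^ (-((n : ℤ) + 1)) < ‖((n + 1)! : ℚ_[p])‖ := by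
    by_contra hc
    push Not at hc
    apply hdvd
    have := (Padic.norm_int_le_pow_iff_dvd (p := p) ((n + 1)! : ℤ) (n + 1)).1
      (by push_cast; exact_mod_cast hc)
    exact_mod_cast this
  rw [norm_div, norm_pow, Padic.norm_p]
  have hf0 : ((n + 1)! : ℚ_[p]) ≠ 0 := by exact_mod_cast Nat.factorial_ne_zero _
  rw [div_le_one (norm_pos_iff.2 hf0), inv_pow, ← zpow_natCast, ← zpow_neg]
  have h4 := (Padic.norm_le_pow_iff_norm_lt_pow_add_one (p := p) ((n + 1)! : ℚ_[p])
    (-((n : ℤ) + 1))).not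
  push Not at h4
  have := h4.1 hnorm
  simpa using this

/-- `exp(p r) ∈ 1 + pℤ_p[[z]]` for an integral `r` without constant term. -/
theorem integralDivP_fexp_sub_one {w : MvPowerSeries τ ℚ_[p]} (hw : IntegralDivP w)
    (h0 : constantCoeff w = 0) : IntegralDivP (fexp w - 1) := by
  have hp0 : (p : ℚ_[p]) ≠ 0 := by exact_mod_cast (Fact.out : p.Prime).ne_zero
  obtain ⟨r, hr, rfl⟩ := integralDivP_iff.1 hw
  have hr0 : constantCoeff r = 0 := by
    have : (p : ℚ_[p]) * constantCoeff r = 0 := by simpa using h0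
    exact (mul_eq_zero.1 this).resolve_left hp0
  have hs := PowerSeries.HasSubst.of_constantCoeff_zero hr0
  obtain ⟨u, hu⟩ : ∃ u : ℕ → ℤ_[p], ∀ n, PadicInt.Coe.ringHom (u n) =
      (p : ℚ_[p]) ^ n / ((n + 1)! : ℚ_[p]) :=
    ⟨fun n => ⟨_, norm_pow_div_factorial_le (p := p) n⟩, fun n => rfl⟩
  let θ : PowerSeries ℤ_[p] := PowerSeries.mk u
  have hθ : PowerSeries.rescale (p : ℚ_[p]) (PowerSeries.exp ℚ_[p]) = 1 +
      (p : ℚ_[p]) • (PowerSeries.X * PowerSeries.map PadicInt.Coe.ringHom θ) := by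
    ext n
    rcases n with _ | n
    · simp
    · simp only [PowerSeries.coeff_rescale, PowerSeries.coeff_exp, map_add, PowerSeries.coeff_one,
        PowerSeries.coeff_smul, PowerSeries.coeff_succ_X_mul, PowerSeries.coeff_map, θ,
        PowerSeries.coeff_mk, hu]
      simp [pow_succ]
      ring
  have hE : fexp ((p : ℚ_[p]) • r) = 1 +
      (p : ℚ_[p]) • (r * (PowerSeries.map PadicInt.Coe.ringHom θ).subst r) := by
    have : fexp ((p : ℚ_[p]) • r) =
        (PowerSeries.rescale (p : ℚ_[p]) (PowerSeries.exp ℚ_[p])).subst r := by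
      rw [PowerSeries.rescale_eq_subst, PowerSeries.subst_comp_subst_apply
        (PowerSeries.HasSubst.smul_X' _) hs, PowerSeries.subst_smul hs, PowerSeries.subst_X hs]
      rfl
    rw [this, hθ, ← PowerSeries.coe_substAlgHom hs, map_add, map_one, map_smul, map_mul,
      PowerSeries.coe_substAlgHom hs, PowerSeries.subst_X hs]
  rw [hE, add_sub_cancel_left]
  refine integralDivP_iff.2 ⟨_, hr.mul ?_, rfl⟩
  obtain ⟨r', rfl⟩ := integral_iff_exists.1 hr
  have hr0' : constantCoeff r' = 0 := by
    rw [constantCoeff_map] at hr0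
    exact Subtype.ext hr0
  rw [← PowerSeries.map_subst (PowerSeries.HasSubst.of_constantCoeff_zero hr0')]
  exact integral_map _

theorem norm_sub_le_max_norm (x y : ℚ_[p]) : ‖x - y‖ ≤ max ‖x‖ ‖y‖ := by
  simpa [sub_eq_add_neg] using Padic.nonarchimedean x (-y)

theorem IntegralDivP.sub {g h : MvPowerSeries τ ℚ_[p]} (hg : IntegralDivP g)
    (hh : IntegralDivP h) : IntegralDivP (g - h) := fun n => by
  rw [map_sub]
  exact (norm_sub_le_max_norm _ _).trans (max_le (hg n) (hh n))

theorem integral_one : Integral (1 : MvPowerSeries τ ℚ_[p]) :=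
  integral_iff_exists.2 ⟨1, (map_one _).symm⟩

theorem Integral.pow {g : MvPowerSeries τ ℚ_[p]} (hg : Integral g) (n : ℕ) :
    Integral (g ^ n) := by
  induction n with
  | zero => rw [pow_zero]; exact integral_one
  | succ n ih => rw [pow_succ]; exact ih.mul hg

open Classical in
/-- The part of `g` supported on exponents strictly below `n`. -/
noncomputable def truncBelow (n : τ →₀ ℕ) (g : MvPowerSeries τ ℚ_[p]) : MvPowerSeries τ ℚ_[p] :=
  fun m => if m < n then coeff m g else 0

open Classical in
theorem coeff_truncBelow (n m : τ →₀ ℕ) (g : MvPowerSeries τ ℚ_[p]) :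
    coeff m (truncBelow n g) = if m < n then coeff m g else 0 := rfl

theorem coeff_sub_truncBelow {n m : τ →₀ ℕ} (h : m < n) (g : MvPowerSeries τ ℚ_[p]) :
    coeff m (g - truncBelow n g) = 0 := by
  rw [map_sub, coeff_truncBelow, if_pos h, sub_self]

theorem coeff_self_sub_truncBelow (n : τ →₀ ℕ) (g : MvPowerSeries τ ℚ_[p]) :
    coeff n (g - truncBelow n g) = coeff n g := by
  rw [map_sub, coeff_truncBelow, if_neg (lt_irrefl n), sub_zero]

theorem constantCoeff_truncBelow {n : τ →₀ ℕ} (hn : n ≠ 0) (g : MvPowerSeries τ ℚ_[p]) :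
    constantCoeff (truncBelow n g) = constantCoeff g := by
  rw [← coeff_zero_eq_constantCoeff_apply, coeff_truncBelow, if_pos (pos_iff_ne_zero.2 hn),
    coeff_zero_eq_constantCoeff_apply]

theorem fexp_frobenius_quotient {h : MvPowerSeries τ ℚ_[p]} (h0 : constantCoeff h = 0)
    (hp : p ≠ 0) : expand p hp (fexp h) = fexp h ^ p * fexp (expand p hp h - (p : ℚ_[p]) • h) := by
  have e : expand p hp h = p • h + (expand p hp h - (p : ℚ_[p]) • h) := by
    rw [← Nat.cast_smul_eq_nsmul ℚ_[p]]
    ring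
  rw [expand_fexp h0]
  conv_lhs => rw [e]
  rw [fexp_add (by simp [h0]) (by simp [h0]), fexp_nsmul h0]

/-- **Dieudonné–Dwork lemma**, first half. -/
theorem integral_fexp {h : MvPowerSeries τ ℚ_[p]} (h0 : constantCoeff h = 0) (hp : p ≠ 0)
    (H : IntegralDivP (expand p hp h - (p : ℚ_[p]) • h)) : Integral (fexp h) := by
  have hp1 : 1 < p := (Fact.out : p.Prime).one_lt
  set q := fexp h with hq
  set R := fexp (expand p hp h - (p : ℚ_[p]) • h) with hR
  have hw0 : constantCoeff (expand p hp h - (p : ℚ_[p]) • h) = 0 := by simp [h0]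
  have hR1 : IntegralDivP (R - 1) := integralDivP_fexp_sub_one H hw0
  have hRc : constantCoeff R = 1 := constantCoeff_fexp hw0
  have hqc : constantCoeff q = 1 := constantCoeff_fexp h0
  have hfe : expand p hp q = q ^ p * R := fexp_frobenius_quotient h0 hp
  intro n
  induction n using WellFoundedLT.induction with
  | _ n ih =>
  by_cases hn : n = 0
  · subst hn
    rw [coeff_zero_eq_constantCoeff_apply, hqc, norm_one]
  set Q := truncBelow n q with hQ
  have hQi : Integral Q := by
    intro m
    rw [hQ, coeff_truncBelow]
    split_ifs with hm
    · exact ih m hm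
    · simp
  have hQc : constantCoeff Q = 1 := (constantCoeff_truncBelow hn q).trans hqc
  have hexp : coeff n (expand p hp q) = coeff n (expand p hp Q) := by
    by_cases hd : ∃ i, ¬ p ∣ n i
    · obtain ⟨i, hi⟩ := hd
      rw [coeff_expand_of_not_dvd _ _ _ hi, coeff_expand_of_not_dvd _ _ _ hi]
    · push Not at hd
      choose m hm using hd
      obtain ⟨k, hk⟩ : ∃ k : τ →₀ ℕ, n = p • k := by
        refine ⟨n.mapRange (fun x => x / p) (by simp), ?_⟩
        ext i
        simp [Nat.mul_div_cancel' (Dvd.intro _ (hm i).symm)]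
      have hkn : k < n := by
        refine lt_of_le_of_ne (hk ▸ le_self_nsmul zero_le hp) fun h => hn ?_
        ext i
        have := DFunLike.congr_fun hk i
        rw [h] at this
        simp only [Finsupp.smul_apply, smul_eq_mul] at this
        simp only [Finsupp.coe_zero, Pi.zero_apply]
        nlinarith
      rw [hk, coeff_expand_smul, coeff_expand_smul, hQ, coeff_truncBelow, if_pos hkn]
  have hgeom : q ^ p = Q ^ p + (q - Q) * ∑ i ∈ Finset.range p, q ^ i * Q ^ (p - 1 - i) := by
    rw [mul_comm, (Commute.all q Q).geom_sum₂_mul]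
    ring
  have hcoef : coeff n (q ^ p * R) = coeff n (Q ^ p * R) + coeff n q * p := by
    rw [hgeom, add_mul, mul_assoc, map_add,
      coeff_mul_of_forall_lt (fun m hm => coeff_sub_truncBelow hm q), coeff_self_sub_truncBelow]
    simp [hQc, hqc, hRc]
  rw [← norm_p_mul_le_iff]
  have e : (p : ℚ_[p]) * coeff n q =
      coeff n (expand p hp Q - Q ^ p - (R - 1) * Q ^ p) := by
    have h1 := congrArg (coeff n) hfe
    rw [hexp, hcoef] at h1
    rw [show expand p hp Q - Q ^ p - (R - 1) * Q ^ p = expand p hp Q - Q ^ p * R by ring, map_sub,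
      h1]
    ring
  rw [e]
  exact ((integralDivP_expand_sub_pow hQi hp).sub (hR1.mul (hQi.pow p))) n

/-- **Dieudonné–Dwork lemma**, second half. -/
theorem integralDivP_of_integral_fexp {h : MvPowerSeries τ ℚ_[p]} (h0 : constantCoeff h = 0)
    (hp : p ≠ 0) (H : Integral (fexp h)) :
    IntegralDivP (expand p hp h - (p : ℚ_[p]) • h) := by
  set w := expand p hp h - (p : ℚ_[p]) • h with hw
  have hw0 : constantCoeff w = 0 := by simp [hw, h0]
  have hqc : constantCoeff (fexp h) = 1 := constantCoeff_fexp h0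
  have hfe : expand p hp (fexp h) = fexp h ^ p * fexp w := fexp_frobenius_quotient h0 hp
  have hpc : constantCoeff (fexp h ^ p) = 1 := by simp [hqc]
  have hE : IntegralDivP (fexp w - 1) := by
    have e : fexp w - 1 = (expand p hp (fexp h) - fexp h ^ p) * (fexp h ^ p)⁻¹ := by
      have hm := MvPowerSeries.mul_inv_cancel (fexp h ^ p) (by rw [hpc]; exact one_ne_zero)
      rw [hfe]
      linear_combination (1 - fexp w) * hm
    rw [e]
    exact (integralDivP_expand_sub_pow H hp).mul ((H.pow p).inv hpc)
  intro n
  induction n using WellFoundedLT.induction with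
  | _ n ih =>
  by_cases hn : n = 0
  · subst hn
    rw [coeff_zero_eq_constantCoeff_apply, hw0, norm_zero]
    positivity
  have hd : IntegralDivP (truncBelow n w) := by
    intro m
    rw [coeff_truncBelow]
    split_ifs with hm
    · exact ih m hm
    · rw [norm_zero]; positivity
  have hd0 : constantCoeff (truncBelow n w) = 0 := (constantCoeff_truncBelow hn w).trans hw0
  have key := coeff_fexp_add_of_forall_lt (h := truncBelow n w) (δ := w - truncBelow n w) hd0
    (by rw [map_sub, hd0, hw0, sub_zero]) (fun m hm => coeff_sub_truncBelow hm w)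
  rw [add_sub_cancel, coeff_self_sub_truncBelow] at key
  have e : coeff n w = coeff n ((fexp w - 1) - (fexp (truncBelow n w) - 1)) := by
    rw [sub_sub_sub_cancel_right, map_sub (coeff n) (fexp w), key]
    ring
  rw [e]
  exact (hE.sub (integralDivP_fexp_sub_one hd hd0)) n

/-- The Dieudonné–Dwork criterion for `exp(G/F)`, with denominators cleared. -/
theorem integral_fexp_div_iff {F G : MvPowerSeries τ ℚ_[p]} (hF : Integral F)
    (hF1 : constantCoeff F = 1) (hG0 : constantCoeff G = 0) (hp : p ≠ 0) :
    Integral (fexp (G * F⁻¹)) ↔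
      IntegralDivP (expand p hp G * F - (p : ℚ_[p]) • (expand p hp F * G)) := by
  have h0 : constantCoeff (G * F⁻¹) = 0 := by simp [hG0]
  have hm := MvPowerSeries.mul_inv_cancel F (by rw [hF1]; exact one_ne_zero)
  have hm' : expand p hp F * expand p hp F⁻¹ = 1 := by rw [← map_mul, hm, map_one]
  have hFi := hF.inv hF1
  have e1 : expand p hp (G * F⁻¹) - (p : ℚ_[p]) • (G * F⁻¹) =
      (expand p hp G * F - (p : ℚ_[p]) • (expand p hp F * G)) * (F⁻¹ * expand p hp F⁻¹) := by
    simp only [map_mul, smul_eq_C_mul]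
    linear_combination (-(expand p hp G * expand p hp F⁻¹)) * hm + (C (p : ℚ_[p]) * G * F⁻¹) * hm'
  have e2 : expand p hp G * F - (p : ℚ_[p]) • (expand p hp F * G) =
      (expand p hp (G * F⁻¹) - (p : ℚ_[p]) • (G * F⁻¹)) * (F * expand p hp F) := by
    rw [e1]
    linear_combination (-(expand p hp G * F - (p : ℚ_[p]) • (expand p hp F * G))) *
      (hm * (expand p hp F * expand p hp F⁻¹) + hm')
  constructor
  · intro H
    rw [e2]
    exact (integralDivP_of_integral_fexp h0 hp H).mul (hF.mul (hF.expand hp))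
  · intro H
    refine integral_fexp h0 hp ?_
    rw [e1]
    exact H.mul (hFi.mul (hFi.expand hp))

/-- The coefficients of `A(z^p) B(z)`. -/
theorem coeff_expand_mul [DecidableEq τ] {A B : MvPowerSeries τ ℚ_[p]} (hp : p ≠ 0) {a K : τ →₀ ℕ}
    (ha : ∀ i, a i < p) : coeff (a + p • K) (expand p hp A * B) =
      ∑ x ∈ Finset.HasAntidiagonal.antidiagonal K, coeff x.1 A * coeff (a + p • x.2) B := by
  rw [coeff_mul]
  symm
  refine Finset.sum_of_injOn (fun x => (p • x.1, a + p • x.2)) ?_ ?_ ?_ ?_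
  · rintro ⟨x, y⟩ - ⟨x', y'⟩ - h
    simp only [Prod.mk.injEq, add_right_inj] at h
    have hinj : Function.Injective fun z : τ →₀ ℕ => p • z := fun z z' hz => by
      ext i
      have := DFunLike.congr_fun hz i
      simpa [hp] using this
    exact Prod.ext (hinj h.1) (hinj h.2)
  · rintro ⟨x, y⟩ h
    simp only [Finset.mem_coe, Finset.HasAntidiagonal.mem_antidiagonal] at h ⊢
    rw [← h, smul_add]
    abel
  · rintro ⟨x, y⟩ hxy hnot
    simp only [Finset.HasAntidiagonal.mem_antidiagonal] at hxy
    by_cases hd : ∃ i, ¬ p ∣ x i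
    · obtain ⟨i, hi⟩ := hd
      simp only
      rw [coeff_expand_of_not_dvd _ _ _ hi, zero_mul]
    · push Not at hd
      exfalso
      apply hnot
      have hcoord : ∀ i, x i + y i = a i + p * K i := fun i => by
        simpa using DFunLike.congr_fun hxy i
      have hxi : ∀ i, p * (x i / p) = x i := fun i => Nat.mul_div_cancel' (hd i)
      have hle : ∀ i, x i / p ≤ K i := fun i => by
        have h1 := hcoord i
        have h2 := ha i
        have h3 := hxi i
        by_contra hc
        push Not at hc
        have : p * (K i + 1) ≤ p * (x i / p) := Nat.mul_le_mul_left p hc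
        nlinarith
      let x' : τ →₀ ℕ := x.mapRange (fun z => z / p) (by simp)
      have hx' : x = p • x' := by
        ext i
        simp [x', hxi]
      refine ⟨(x', K - x'), ?_, ?_⟩
      · rw [Finset.mem_coe, Finset.HasAntidiagonal.mem_antidiagonal]
        have : x' ≤ K := fun i => by simpa [x'] using hle i
        exact add_tsub_cancel_of_le this
      · simp only [Prod.mk.injEq]
        refine ⟨hx'.symm, ?_⟩
        ext i
        have h1 := hcoord i
        have h3 := hxi i
        have h4 := hle i
        simp only [Finsupp.coe_add, Finsupp.coe_smul, Finsupp.coe_tsub, Pi.add_apply, Pi.smul_apply,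
          Pi.sub_apply, smul_eq_mul, x', Finsupp.mapRange_apply, Nat.mul_sub]
        have : p * (x i / p) ≤ p * K i := Nat.mul_le_mul_left p h4
        omega
  · rintro ⟨x, y⟩ -
    simp only
    rw [coeff_expand_smul]

end DieudonneDwork

/-! ### Vectors with a bounded number of digits -/

section Box

variable {d : ℕ}

/-- The vectors of `ℕ^d` all of whose coordinates have at most `s` digits in base `p`. -/
def box (d p s : ℕ) : Finset (Fin d → ℕ) := Fintype.piFinset fun _ => Finset.range (p ^ s)

theorem mem_box {p s : ℕ} {j : Fin d → ℕ} : j ∈ box d p s ↔ ∀ k, j k < p ^ s := by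
  simp [box]

theorem mem_box_one {p : ℕ} {j : Fin d → ℕ} : j ∈ box d p 1 ↔ ∀ k, j k < p := by
  simp [box]

theorem box_zero (p : ℕ) : box d p 0 = {0} := by
  ext j
  simp [box, funext_iff]

theorem add_mem_box {p s t : ℕ} {x y : Fin d → ℕ} (hx : x ∈ box d p s) (hy : y ∈ box d p t) :
    x + p ^ s • y ∈ box d p (s + t) := by
  rw [mem_box] at *
  intro k
  have h1 := hx k
  have h2 : p ^ s * (y k + 1) ≤ p ^ s * p ^ t := Nat.mul_le_mul_left _ (hy k)
  simp only [Pi.add_apply, Pi.smul_apply, smul_eq_mul]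
  rw [pow_add]
  nlinarith

/-- Splitting off the `s` lowest digits. -/
theorem sum_box_add {M : Type*} [AddCommMonoid M] {p : ℕ} (hp : 0 < p) (s t : ℕ)
    (f : (Fin d → ℕ) → M) :
    ∑ j ∈ box d p (s + t), f j = ∑ y ∈ box d p t, ∑ x ∈ box d p s, f (x + p ^ s • y) := by
  rw [← Finset.sum_product']
  have hps : 0 < p ^ s := pow_pos hp s
  refine Finset.sum_nbij' (fun j => (fun k => j k / p ^ s, fun k => j k % p ^ s))
    (fun z => z.2 + p ^ s • z.1) ?_ ?_ ?_ ?_ ?_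
  · intro j hj
    rw [mem_box] at hj
    rw [Finset.mem_product, mem_box, mem_box]
    refine ⟨fun k => ?_, fun k => Nat.mod_lt _ hps⟩
    have := hj k
    rw [pow_add] at this
    exact Nat.div_lt_of_lt_mul this
  · rintro ⟨y, x⟩ h
    rw [Finset.mem_product] at h
    exact add_mem_box h.2 h.1
  · intro j _
    ext k
    simp [Nat.mod_add_div]
  · rintro ⟨y, x⟩ h
    rw [Finset.mem_product, mem_box, mem_box] at h
    ext k
    · have := h.2 k
      simp [Nat.add_mul_div_left _ _ hps, Nat.div_eq_of_lt this]
    · have := h.2 k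
      simp [Nat.mod_eq_of_lt this]
  · intro j _
    congr 1
    ext k
    simp [Nat.mod_add_div]

theorem sum_box_succ {M : Type*} [AddCommMonoid M] {p : ℕ} (hp : 0 < p) (t : ℕ)
    (f : (Fin d → ℕ) → M) :
    ∑ j ∈ box d p (t + 1), f j = ∑ y ∈ box d p t, ∑ x ∈ box d p 1, f (x + p • y) := by
  rw [add_comm, sum_box_add hp]
  simp

end Box

/-! ### Dwork's formal congruences -/

section FormalCongruences

variable {d p : ℕ} [Fact p.Prime]

open Classical in
/-- The antisymmetric terms `A(a + p(K - j)) A(j) - A(K - j) A(a + pj)`, set to `0` unless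
`j ≤ K`. -/
noncomputable def dworkTerm (A : (Fin d → ℕ) → ℚ_[p]) (a K j : Fin d → ℕ) : ℚ_[p] :=
  if j ≤ K then A (a + p • (K - j)) * A j - A (K - j) * A (a + p • j) else 0

/-- The sum of the terms `dworkTerm` over the block of all `j` whose digits above the `s`-th are
those of `m`. -/
noncomputable def dworkSum (A : (Fin d → ℕ) → ℚ_[p]) (a K : Fin d → ℕ) (s : ℕ)
    (m : Fin d → ℕ) : ℚ_[p] :=
  ∑ j ∈ box d p s, dworkTerm A a K (j + p ^ s • m)

/-- The hypotheses of the formal congruences. `γ` bounds `A`; `Ψ s` singles out the `s`-digit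
vectors `u` for which the quotients `A(u + p^s n) / A(u)` are controlled. Where the condition `Ψ` is
lost on passing to one digit more, the weight itself gains a factor `p^(s + 1)`. -/
structure DworkHyp (A : (Fin d → ℕ) → ℚ_[p]) (γ : (Fin d → ℕ) → ℝ)
    (Ψ : ℕ → (Fin d → ℕ) → Prop) : Prop where
  one : A 0 = 1
  ne_zero : ∀ n, A n ≠ 0
  γ_pos : ∀ n, 0 < γ n
  γ_zero : γ 0 = 1
  γ_le_one : ∀ n, γ n ≤ 1
  norm_le : ∀ n, ‖A n‖ ≤ γ n
  base : Ψ 0 0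
  tail : ∀ s, ∀ v ∈ box d p 1, ∀ u ∈ box d p s, Ψ (s + 1) (v + p • u) → Ψ s u
  ratio_le : ∀ s, ∀ u ∈ box d p s, Ψ s u → ∀ n, ‖A (u + p ^ s • n) / A u‖ ≤ γ n
  ratio_sub_le : ∀ s, ∀ v ∈ box d p 1, ∀ u ∈ box d p s, Ψ (s + 1) (v + p • u) → ∀ n,
    ‖A (v + p • u + p ^ (s + 1) • n) / A (v + p • u) - A (u + p ^ s • n) / A u‖ ≤
      (p : ℝ)⁻¹ ^ (s + 1) * γ n / γ (v + p • u)
  γ_le : ∀ s, ∀ v ∈ box d p 1, ∀ u ∈ box d p s, Ψ s u → ¬ Ψ (s + 1) (v + p • u) → ∀ n,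
    γ (v + p • u + p ^ (s + 1) • n) ≤ (p : ℝ)⁻¹ ^ (s + 1) * γ n

variable {A : (Fin d → ℕ) → ℚ_[p]} {γ : (Fin d → ℕ) → ℝ} {Ψ : ℕ → (Fin d → ℕ) → Prop}

theorem norm_add_le_of_le {x y : ℚ_[p]} {C : ℝ} (hx : ‖x‖ ≤ C) (hy : ‖y‖ ≤ C) : ‖x + y‖ ≤ C :=
  (Padic.nonarchimedean x y).trans (max_le hx hy)

theorem norm_sub_le_of_le {x y : ℚ_[p]} {C : ℝ} (hx : ‖x‖ ≤ C) (hy : ‖y‖ ≤ C) : ‖x - y‖ ≤ C :=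
  (norm_sub_le_max_norm x y).trans (max_le hx hy)

theorem norm_sub_trans {x y z : ℚ_[p]} {C : ℝ} (hx : ‖x - y‖ ≤ C) (hy : ‖y - z‖ ≤ C) :
    ‖x - z‖ ≤ C := by
  rw [← sub_add_sub_cancel x y z]
  exact norm_add_le_of_le hx hy

theorem norm_sum_le_of_le {ι : Type*} {s : Finset ι} {f : ι → ℚ_[p]} {C : ℝ} (hC : 0 ≤ C)
    (h : ∀ i ∈ s, ‖f i‖ ≤ C) : ‖∑ i ∈ s, f i‖ ≤ C :=
  IsUltrametricDist.norm_sum_le_of_forall_le_of_nonneg hC h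

theorem p_inv_pos : (0 : ℝ) < (p : ℝ)⁻¹ := by
  have := (Fact.out : p.Prime).pos
  positivity

theorem p_inv_le_one : (p : ℝ)⁻¹ ≤ 1 :=
  inv_le_one_of_one_le₀ (by exact_mod_cast (Fact.out : p.Prime).one_le)

open Classical in
theorem dworkTerm_add (a K j m : Fin d → ℕ) : dworkTerm A a (K + m) (j + m) =
    if j ≤ K then A (a + p • (K - j)) * A (j + m) - A (K - j) * A (a + p • (j + m)) else 0 := by
  unfold dworkTerm
  by_cases h : j ≤ K
  · have e : K + m - (j + m) = K - j := by
      ext k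
      exact Nat.add_sub_add_right _ _ _
    rw [if_pos h, if_pos (add_le_add_left h m), e]
  · rw [if_neg h, if_neg fun h' => h (le_of_add_le_add_right h')]

theorem dworkSum_zero (a K m : Fin d → ℕ) : dworkSum A a K 0 m = dworkTerm A a K m := by
  simp [dworkSum, box_zero]

theorem dworkSum_add (a K : Fin d → ℕ) (s t : ℕ) (m : Fin d → ℕ) :
    dworkSum A a K (s + t) m = ∑ y ∈ box d p t, dworkSum A a K s (y + p ^ t • m) := by
  unfold dworkSum
  rw [sum_box_add (Fact.out : p.Prime).pos]
  refine Finset.sum_congr rfl fun y _ => Finset.sum_congr rfl fun x _ => ?_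
  rw [smul_add, smul_smul, ← pow_add, add_assoc]

theorem dworkSum_succ (a K : Fin d → ℕ) (s : ℕ) (m : Fin d → ℕ) :
    dworkSum A a K (s + 1) m = ∑ y ∈ box d p 1, dworkSum A a K s (y + p • m) := by
  rw [dworkSum_add, pow_one]

/-- The terms are antisymmetric under `j ↦ K - j`, so they add up to `0`. -/
theorem sum_Iic_dworkTerm (a K : Fin d → ℕ) : ∑ j ∈ Finset.Iic K, dworkTerm A a K j = 0 := by
  have h1 : ∑ j ∈ Finset.Iic K, dworkTerm A a K j = ∑ j ∈ Finset.Iic K,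
      A (a + p • (K - j)) * A j - ∑ j ∈ Finset.Iic K, A (K - j) * A (a + p • j) := by
    rw [← Finset.sum_sub_distrib]
    refine Finset.sum_congr rfl fun j hj => ?_
    rw [dworkTerm, if_pos (Finset.mem_Iic.1 hj)]
  rw [h1, sub_eq_zero]
  refine Finset.sum_nbij' (fun j => K - j) (fun j => K - j) ?_ ?_ ?_ ?_ ?_
  · intro j _
    exact Finset.mem_Iic.2 tsub_le_self
  · intro j _
    exact Finset.mem_Iic.2 tsub_le_self
  · intro j hj
    exact tsub_tsub_cancel_of_le (Finset.mem_Iic.1 hj)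
  · intro j hj
    exact tsub_tsub_cancel_of_le (Finset.mem_Iic.1 hj)
  · intro j hj
    rw [tsub_tsub_cancel_of_le (Finset.mem_Iic.1 hj), mul_comm]

theorem sum_box_dworkTerm (a K : Fin d → ℕ) {r : ℕ} (hK : K ∈ box d p r) :
    ∑ j ∈ box d p r, dworkTerm A a K j = 0 := by
  rw [← sum_Iic_dworkTerm (A := A) a K]
  symm
  refine Finset.sum_subset ?_ ?_
  · intro j hj
    rw [mem_box] at *
    exact fun k => (Finset.mem_Iic.1 hj k).trans_lt (hK k)
  · intro j _ hj
    rw [dworkTerm, if_neg fun h => hj (Finset.mem_Iic.2 h)]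

open Classical in
/-- Passing from the condition `Ψ t` on the leading digits to `Ψ (t + 1)` on one digit more. -/
theorem norm_sum_filter_sub_le (H : DworkHyp A γ Ψ) (t : ℕ) (g : (Fin d → ℕ) → ℚ_[p]) {C : ℝ}
    (hC : 0 ≤ C)
    (hg : ∀ v ∈ box d p 1, ∀ u ∈ box d p t, Ψ t u → ¬ Ψ (t + 1) (v + p • u) →
      ‖g (v + p • u)‖ ≤ C) :
    ‖∑ u ∈ box d p t with Ψ t u, ∑ v ∈ box d p 1, g (v + p • u) -
      ∑ w ∈ box d p (t + 1) with Ψ (t + 1) w, g w‖ ≤ C := by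
  rw [Finset.sum_filter, Finset.sum_filter, sum_box_succ (Fact.out : p.Prime).pos,
    ← Finset.sum_sub_distrib]
  refine norm_sum_le_of_le hC fun u hu => ?_
  split_ifs with hΨ
  · rw [← Finset.sum_sub_distrib]
    refine norm_sum_le_of_le hC fun v hv => ?_
    split_ifs with hΨ'
    · simpa
    · rw [sub_zero]
      exact hg v hv u hu hΨ hΨ'
  · rw [zero_sub, norm_neg]
    refine norm_sum_le_of_le hC fun v hv => ?_
    rw [if_neg fun h => hΨ (H.tail t v hv u hu h)]
    simpa

open Classical in
/-- Block sums split into block sums of the finer level `s - t`; the leading digits outside `Ψ t`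
may be dropped, because the weight `γ` makes up for the shorter blocks. -/
theorem norm_dworkSum_sub_sum_le (H : DworkHyp A γ Ψ) (a : Fin d → ℕ) {s : ℕ}
    (IH : ∀ t < s, ∀ K m, ‖dworkSum A a K t m‖ ≤ (p : ℝ)⁻¹ ^ (t + 1) * γ m)
    (K m : Fin d → ℕ) {t : ℕ} (ht : t ≤ s) :
    ‖dworkSum A a K s m -
      ∑ j ∈ box d p t with Ψ t j, dworkSum A a K (s - t) (j + p ^ t • m)‖ ≤
      (p : ℝ)⁻¹ ^ (s + 1) * γ m := by
  have hε := p_inv_pos (p := p)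
  have hC : 0 ≤ (p : ℝ)⁻¹ ^ (s + 1) * γ m := mul_nonneg (pow_nonneg hε.le _) (H.γ_pos m).le
  induction t with
  | zero => simpa [box_zero, H.base, Finset.filter_singleton] using hC
  | succ t ih =>
    refine norm_sub_trans (ih (by omega)) ?_
    have e : ∀ u : Fin d → ℕ, dworkSum A a K (s - t) (u + p ^ t • m) =
        ∑ v ∈ box d p 1, dworkSum A a K (s - (t + 1)) (v + p • u + p ^ (t + 1) • m) := by
      intro u
      rw [show s - t = s - (t + 1) + 1 by omega, dworkSum_succ]
      refine Finset.sum_congr rfl fun v _ => ?_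
      rw [smul_add, smul_smul, ← pow_succ', add_assoc]
    simp only [e]
    refine norm_sum_filter_sub_le H t
      (fun w => dworkSum A a K (s - (t + 1)) (w + p ^ (t + 1) • m)) hC fun v hv u hu h1 h2 => ?_
    refine (IH _ (by omega) _ _).trans ?_
    calc _ ≤ (p : ℝ)⁻¹ ^ (s - (t + 1) + 1) * ((p : ℝ)⁻¹ ^ (t + 1) * γ m) :=
          mul_le_mul_of_nonneg_left (H.γ_le t v hv u hu h1 h2 m) (pow_nonneg hε.le _)
      _ = _ := by
          rw [← mul_assoc, ← pow_add]
          congr 2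
          omega

open Classical in
/-- Grouping the terms by their leading digits: in `∑ A(j + p^s m) / A(j) tⱼ` the quotient may be
replaced by the one attached to the `s - t` leading digits of `j`. -/
theorem norm_sum_ratio_sub_le (H : DworkHyp A γ Ψ) (a : Fin d → ℕ) {s : ℕ}
    (IH : ∀ t < s, ∀ K m, ‖dworkSum A a K t m‖ ≤ (p : ℝ)⁻¹ ^ (t + 1) * γ m)
    (K m : Fin d → ℕ) {t : ℕ} (ht : t ≤ s) :
    ‖∑ j ∈ box d p s with Ψ s j, A (j + p ^ s • m) / A j * dworkSum A a K 0 j -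
      ∑ j ∈ box d p (s - t) with Ψ (s - t) j,
        A (j + p ^ (s - t) • m) / A j * dworkSum A a K t j‖ ≤ (p : ℝ)⁻¹ ^ (s + 1) * γ m := by
  have hε := p_inv_pos (p := p)
  have hp0 := (Fact.out : p.Prime).pos
  have hC : 0 ≤ (p : ℝ)⁻¹ ^ (s + 1) * γ m := mul_nonneg (pow_nonneg hε.le _) (H.γ_pos m).le
  induction t with
  | zero => simpa using hC
  | succ t ih =>
    refine norm_sub_trans (ih (by omega)) ?_
    obtain ⟨r, hr⟩ : ∃ r, s = t + r + 1 := ⟨s - t - 1, by omega⟩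
    rw [show s - t = r + 1 by omega, show s - (t + 1) = r by omega]
    -- the quotient attached to the leading digits only
    let h : (Fin d → ℕ) → ℚ_[p] := fun w =>
      A ((fun k => w k / p) + p ^ r • m) / A (fun k => w k / p) * dworkSum A a K t w
    have hdiv : ∀ v ∈ box d p 1, ∀ u : Fin d → ℕ, (fun k => (v + p • u) k / p) = u := by
      intro v hv u
      rw [mem_box_one] at hv
      ext k
      simp [Nat.add_mul_div_left _ _ hp0, Nat.div_eq_of_lt (hv k)]
    have e : ∀ u : Fin d → ℕ, A (u + p ^ r • m) / A u * dworkSum A a K (t + 1) u =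
        ∑ v ∈ box d p 1, h (v + p • u) := by
      intro u
      rw [dworkSum_succ, Finset.mul_sum]
      refine Finset.sum_congr rfl fun v hv => ?_
      simp only [h, hdiv v hv u]
    simp only [e]
    rw [norm_sub_rev]
    refine norm_sub_trans (norm_sum_filter_sub_le H r h hC fun v hv u hu h1 h2 => ?_) ?_
    · simp only [h, hdiv v hv u]
      rw [norm_mul]
      have h3 := H.γ_le r v hv u hu h1 h2 0
      rw [smul_zero, add_zero, H.γ_zero, mul_one] at h3
      calc _ ≤ γ m * ((p : ℝ)⁻¹ ^ (t + 1) * γ (v + p • u)) :=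
            mul_le_mul (H.ratio_le r u hu h1 m) (IH t (by omega) _ _) (norm_nonneg _)
              (H.γ_pos m).le
        _ ≤ γ m * ((p : ℝ)⁻¹ ^ (t + 1) * (p : ℝ)⁻¹ ^ (r + 1)) :=
            mul_le_mul_of_nonneg_left (mul_le_mul_of_nonneg_left h3 (pow_nonneg hε.le _))
              (H.γ_pos m).le
        _ = _ := by
            rw [← pow_add, mul_comm]
            congr 2
            omega
    · rw [← Finset.sum_sub_distrib]
      refine norm_sum_le_of_le hC fun w hw => ?_
      rw [Finset.mem_filter] at hw
      obtain ⟨hw, hΨ⟩ := hw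
      obtain ⟨v, hv, u, hu, rfl⟩ : ∃ v ∈ box d p 1, ∃ u ∈ box d p r, w = v + p • u := by
        rw [mem_box] at hw
        refine ⟨fun k => w k % p, mem_box_one.2 fun k => Nat.mod_lt _ hp0, fun k => w k / p,
          mem_box.2 fun k => ?_, ?_⟩
        · have := hw k
          rw [pow_succ'] at this
          exact Nat.div_lt_of_lt_mul this
        · ext k
          simp [Nat.mod_add_div]
      simp only [h, hdiv v hv u]
      rw [← sub_mul, norm_mul, norm_sub_rev]
      calc _ ≤ (p : ℝ)⁻¹ ^ (r + 1) * γ m / γ (v + p • u) *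
            ((p : ℝ)⁻¹ ^ (t + 1) * γ (v + p • u)) :=
            mul_le_mul (H.ratio_sub_le r v hv u hu hΨ m) (IH t (by omega) _ _) (norm_nonneg _)
              (div_nonneg (mul_nonneg (pow_nonneg hε.le _) (H.γ_pos m).le) (H.γ_pos _).le)
        _ = ((p : ℝ)⁻¹ ^ (r + 1) * (p : ℝ)⁻¹ ^ (t + 1)) * γ m := by
            have := (H.γ_pos (v + p • u)).ne'
            field_simp
        _ = _ := by
            rw [← pow_add]
            congr 2
            omega

open Classical in
/-- Adding `p^s m` to both `K` and `j` multiplies the term at `j` by `A(j + p^s m) / A(j)`, up to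
an admissible error. -/
theorem norm_sum_dworkTerm_sub_le (H : DworkHyp A γ Ψ) {a : Fin d → ℕ} (ha : a ∈ box d p 1)
    (s : ℕ) (K m : Fin d → ℕ) :
    ‖∑ j ∈ box d p s with Ψ s j, dworkSum A a (K + p ^ s • m) 0 (j + p ^ s • m) -
      ∑ j ∈ box d p s with Ψ s j, A (j + p ^ s • m) / A j * dworkSum A a K 0 j‖ ≤
      (p : ℝ)⁻¹ ^ (s + 1) * γ m := by
  have hε := p_inv_pos (p := p)
  have hC : 0 ≤ (p : ℝ)⁻¹ ^ (s + 1) * γ m := mul_nonneg (pow_nonneg hε.le _) (H.γ_pos m).le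
  rw [← Finset.sum_sub_distrib]
  refine norm_sum_le_of_le hC fun j hj => ?_
  rw [Finset.mem_filter] at hj
  obtain ⟨hj, hΨ⟩ := hj
  rw [dworkSum_zero, dworkSum_zero, dworkTerm_add, dworkTerm]
  split_ifs with hle
  swap
  · simpa using hC
  have hAj := H.ne_zero j
  have e : A (a + p • (K - j)) * A (j + p ^ s • m) - A (K - j) * A (a + p • (j + p ^ s • m)) -
      A (j + p ^ s • m) / A j * (A (a + p • (K - j)) * A j - A (K - j) * A (a + p • j)) =
      A (K - j) * (A (j + p ^ s • m) / A j * A (a + p • j) -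
        A (a + p • j + p ^ (s + 1) • m)) := by
    rw [smul_add, smul_smul, ← pow_succ', ← add_assoc]
    field_simp
    ring
  rw [e, norm_mul]
  have h1 : ‖A (K - j)‖ ≤ 1 := (H.norm_le _).trans (H.γ_le_one _)
  refine (mul_le_of_le_one_left (norm_nonneg _) h1).trans ?_
  by_cases hΨ' : Ψ (s + 1) (a + p • j)
  · have hne := H.ne_zero (a + p • j)
    have e2 : A (j + p ^ s • m) / A j * A (a + p • j) - A (a + p • j + p ^ (s + 1) • m) =
        -((A (a + p • j + p ^ (s + 1) • m) / A (a + p • j) - A (j + p ^ s • m) / A j) *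
          A (a + p • j)) := by
      field_simp
      ring
    rw [e2, norm_neg, norm_mul]
    calc _ ≤ (p : ℝ)⁻¹ ^ (s + 1) * γ m / γ (a + p • j) * γ (a + p • j) :=
          mul_le_mul (H.ratio_sub_le s a ha j hj hΨ' m) (H.norm_le _) (norm_nonneg _)
            (div_nonneg hC (H.γ_pos _).le)
      _ = _ := div_mul_cancel₀ _ (H.γ_pos _).ne'
  · refine norm_sub_le_of_le ?_ ((H.norm_le _).trans (H.γ_le s a ha j hj hΨ hΨ' m))
    have h3 := H.γ_le s a ha j hj hΨ hΨ' 0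
    rw [smul_zero, add_zero, H.γ_zero, mul_one] at h3
    rw [norm_mul, mul_comm]
    exact mul_le_mul ((H.norm_le _).trans h3) (H.ratio_le s j hj hΨ m) (norm_nonneg _)
      (pow_nonneg hε.le _)

/-- A block sum of index `m` reduces to the one of index `0`, for a smaller `K`: it differs from
`A(m)` times the latter by a multiple of `p^(s + 1) γ(m)`. -/
theorem norm_dworkSum_add_sub_le (H : DworkHyp A γ Ψ) {a : Fin d → ℕ} (ha : a ∈ box d p 1)
    {s : ℕ} (IH : ∀ t < s, ∀ K m, ‖dworkSum A a K t m‖ ≤ (p : ℝ)⁻¹ ^ (t + 1) * γ m)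
    (K m : Fin d → ℕ) :
    ‖dworkSum A a (K + p ^ s • m) s m - A m * dworkSum A a K s 0‖ ≤
      (p : ℝ)⁻¹ ^ (s + 1) * γ m := by
  classical
  have h1 := norm_dworkSum_sub_sum_le H a IH (K + p ^ s • m) m le_rfl
  have h2 := norm_sum_dworkTerm_sub_le H ha s K m
  have h3 := norm_sum_ratio_sub_le H a IH K m le_rfl
  simp only [Nat.sub_self] at h1 h3
  have h4 := norm_sub_trans (norm_sub_trans h1 h2) h3
  simpa [box_zero, H.base, Finset.filter_singleton, H.one] using h4

theorem dworkSum_eq_zero (a : Fin d → ℕ) {K m : Fin d → ℕ} {s : ℕ} (h : ¬ p ^ s • m ≤ K) :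
    dworkSum A a K s m = 0 := by
  refine Finset.sum_eq_zero fun j _ => ?_
  rw [dworkTerm, if_neg fun h' => h (le_trans le_add_self h')]

theorem exists_mem_box (K : Fin d → ℕ) (s : ℕ) : ∃ t, K ∈ box d p (s + t) := by
  refine ⟨∑ k, K k, mem_box.2 fun k => ?_⟩
  calc K k ≤ ∑ k, K k :=
        Finset.single_le_sum (f := K) (fun _ _ => Nat.zero_le _) (Finset.mem_univ k)
    _ ≤ s + ∑ k, K k := Nat.le_add_left _ _
    _ < p ^ (s + ∑ k, K k) := Nat.lt_pow_self (Fact.out : p.Prime).one_lt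

/-- **Dwork's formal congruences**: every block sum of length `p^s` is divisible by
`p^(s + 1) γ(m)`. -/
theorem norm_dworkSum_le (H : DworkHyp A γ Ψ) {a : Fin d → ℕ} (ha : a ∈ box d p 1)
    (s : ℕ) (K m : Fin d → ℕ) :
    ‖dworkSum A a K s m‖ ≤ (p : ℝ)⁻¹ ^ (s + 1) * γ m := by
  have hε := p_inv_pos (p := p)
  induction s using Nat.strong_induction_on generalizing K m with
  | _ s IH =>
  have hεs : 0 ≤ (p : ℝ)⁻¹ ^ (s + 1) := pow_nonneg hε.le _
  have hC : ∀ m, 0 ≤ (p : ℝ)⁻¹ ^ (s + 1) * γ m := fun m => mul_nonneg hεs (H.γ_pos m).le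
  -- a block reduces to the initial block, for a smaller `K`
  have red : ∀ K m, (∀ K₀, K = K₀ + p ^ s • m → ‖dworkSum A a K₀ s 0‖ ≤ (p : ℝ)⁻¹ ^ (s + 1)) →
      ‖dworkSum A a K s m‖ ≤ (p : ℝ)⁻¹ ^ (s + 1) * γ m := by
    intro K m h0
    by_cases hle : p ^ s • m ≤ K
    · have hK : K = (K - p ^ s • m) + p ^ s • m := (tsub_add_cancel_of_le hle).symm
      have h1 := norm_dworkSum_add_sub_le H ha IH (K - p ^ s • m) m
      rw [← hK] at h1
      have h2 := h0 _ hK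
      rw [← sub_add_cancel (dworkSum A a K s m) (A m * dworkSum A a (K - p ^ s • m) s 0)]
      refine norm_add_le_of_le h1 ?_
      rw [norm_mul, mul_comm]
      exact mul_le_mul h2 (H.norm_le m) (norm_nonneg _) hεs
    · rw [dworkSum_eq_zero a hle, norm_zero]
      exact hC m
  have init : ∀ K, ‖dworkSum A a K s 0‖ ≤ (p : ℝ)⁻¹ ^ (s + 1) := by
    intro K
    induction K using WellFoundedLT.induction with
    | _ K ihK =>
    obtain ⟨t, ht⟩ := exists_mem_box (p := p) K s
    have h0 := sum_box_dworkTerm (A := A) a K ht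
    rw [sum_box_add (Fact.out : p.Prime).pos] at h0
    change ∑ y ∈ box d p t, dworkSum A a K s y = 0 at h0
    have h0mem : (0 : Fin d → ℕ) ∈ box d p t :=
      mem_box.2 fun k => pow_pos (Fact.out : p.Prime).pos t
    rw [← Finset.add_sum_erase _ _ h0mem] at h0
    rw [eq_neg_of_add_eq_zero_left h0, norm_neg]
    refine norm_sum_le_of_le hεs fun m hm => ?_
    refine (red K m fun K₀ hK₀ => ihK K₀ ?_).trans (mul_le_of_le_one_right hεs (H.γ_le_one m))
    rw [hK₀]
    refine lt_add_of_pos_right _ ?_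
    have hm0 : m ≠ 0 := Finset.ne_of_mem_erase hm
    exact pos_iff_ne_zero.2 (smul_ne_zero (pow_pos (Fact.out : p.Prime).pos s).ne' hm0)
  exact red K m fun K₀ _ => init K₀

end FormalCongruences

/-! ### Factorials and their parts prime to `p` -/

section Factorial

/-- The product of the integers `1, …, N` prime to `p`. -/
def primeToPart (p N : ℕ) : ℕ := ∏ x ∈ Finset.range N, if p ∣ x + 1 then 1 else x + 1

theorem factorial_eq_primeToPart {p : ℕ} (N : ℕ) :
    N ! = p ^ (N / p) * (N / p)! * primeToPart p N := by
  induction N with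
  | zero => simp [primeToPart]
  | succ N ih =>
    rw [primeToPart, Finset.prod_range_succ, ← primeToPart, Nat.factorial_succ, ih, Nat.succ_div]
    split_ifs with h
    · have h1 : p * (N / p + 1) = N + 1 := by
        rw [← Nat.mul_div_cancel' h, Nat.succ_div, if_pos h]
      rw [pow_succ, Nat.factorial_succ, ← h1]
      ring
    · rw [add_zero]
      ring

theorem primeToPart_add_modEq {p k : ℕ} (hk : p ∣ k) (N : ℕ) :
    primeToPart p (N + k) ≡ primeToPart p N * primeToPart p k [MOD k] := by
  induction N with
  | zero => simp [primeToPart, Nat.ModEq.refl]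
  | succ N ih =>
    rw [show N + 1 + k = N + k + 1 by ring]
    conv_lhs => rw [primeToPart, Finset.prod_range_succ, ← primeToPart]
    conv_rhs => rw [primeToPart, Finset.prod_range_succ, ← primeToPart]
    rw [mul_right_comm]
    refine Nat.ModEq.mul ih ?_
    have : p ∣ N + k + 1 ↔ p ∣ N + 1 := by
      rw [show N + k + 1 = N + 1 + k by ring]
      exact (Nat.dvd_add_left hk)
    by_cases h : p ∣ N + 1
    · rw [if_pos (this.2 h), if_pos h]
    · rw [if_neg (fun h' => h (this.1 h')), if_neg h, show N + k + 1 = N + 1 + k by ring]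
      simp [Nat.ModEq]

/-- Every interval of length `k` contributes the same product modulo `k`. -/
theorem primeToPart_add_mul_modEq {p k : ℕ} (hk : p ∣ k) (N M : ℕ) :
    primeToPart p (N + k * M) ≡ primeToPart p N * primeToPart p k ^ M [MOD k] := by
  induction M with
  | zero => simp [Nat.ModEq.refl]
  | succ M ih =>
    rw [mul_add, mul_one, ← add_assoc, pow_succ, ← mul_assoc]
    exact (primeToPart_add_modEq hk _).trans (ih.mul_right _)

variable {p : ℕ} [hp : Fact p.Prime]

theorem norm_natCast_eq_one {x : ℕ} (h : ¬ p ∣ x) : ‖(x : ℚ_[p])‖ = 1 := by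
  rw [Padic.norm_natCast_eq_one_iff]
  exact (Nat.Prime.coprime_iff_not_dvd hp.out).2 h

theorem norm_primeToPart (N : ℕ) : ‖(primeToPart p N : ℚ_[p])‖ = 1 := by
  rw [primeToPart]
  push_cast
  rw [norm_prod]
  refine Finset.prod_eq_one fun x _ => ?_
  split_ifs with h
  · simp
  · exact_mod_cast norm_natCast_eq_one h

theorem norm_natCast_eq_pow {x : ℕ} (hx : x ≠ 0) :
    ‖(x : ℚ_[p])‖ = (p : ℝ)⁻¹ ^ padicValNat p x := by
  rw [Padic.norm_eq_zpow_neg_valuation (by exact_mod_cast hx), Padic.valuation_natCast, zpow_neg,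
    zpow_natCast, inv_pow]

theorem norm_factorial {N b : ℕ} (h : N < p ^ b) :
    ‖(N ! : ℚ_[p])‖ = (p : ℝ)⁻¹ ^ ∑ l ∈ Finset.Icc 1 b, N / p ^ l := by
  rw [norm_natCast_eq_pow (Nat.factorial_ne_zero N)]
  have hb : Nat.log p N < b + 1 := by
    rcases Nat.eq_zero_or_pos N with rfl | hN
    · simp
    · exact (Nat.log_lt_of_lt_pow hN.ne' h).trans (Nat.lt_succ_self b)
  rw [padicValNat_factorial hb]
  rfl

/-! ### Multiplicative closeness to `1` -/

theorem norm_eq_one_of_near {x : ℚ_[p]} {δ : ℝ} (hδ : δ < 1) (h : ‖x - 1‖ ≤ δ) : ‖x‖ = 1 := by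
  have h1 : ‖x - 1‖ < ‖(1 : ℚ_[p])‖ := by rw [norm_one]; exact h.trans_lt hδ
  have := IsUltrametricDist.norm_add_eq_max_of_norm_ne_norm (x := x - 1) (y := (1 : ℚ_[p])) h1.ne
  rw [sub_add_cancel, max_eq_right h1.le, norm_one] at this
  exact this

theorem near_mul {x y : ℚ_[p]} {δ : ℝ} (hδ : δ < 1) (hx : ‖x - 1‖ ≤ δ) (hy : ‖y - 1‖ ≤ δ) :
    ‖x * y - 1‖ ≤ δ := by
  rw [show x * y - 1 = x * (y - 1) + (x - 1) by ring]
  refine norm_add_le_of_le ?_ hx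
  rwa [norm_mul, norm_eq_one_of_near hδ hx, one_mul]

theorem near_inv {x : ℚ_[p]} {δ : ℝ} (hδ : δ < 1) (hx : ‖x - 1‖ ≤ δ) : ‖x⁻¹ - 1‖ ≤ δ := by
  have h1 := norm_eq_one_of_near hδ hx
  have h0 : x ≠ 0 := by
    intro h
    simp [h] at h1
  rw [show x⁻¹ - 1 = -(x⁻¹ * (x - 1)) by field_simp; ring, norm_neg, norm_mul, norm_inv, h1,
    inv_one, one_mul]
  exact hx

theorem near_pow {x : ℚ_[p]} {δ : ℝ} (h0 : 0 ≤ δ) (hδ : δ < 1) (hx : ‖x - 1‖ ≤ δ) (n : ℕ) :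
    ‖x ^ n - 1‖ ≤ δ := by
  induction n with
  | zero => simpa
  | succ n ih => rw [pow_succ]; exact near_mul hδ ih hx

theorem near_zpow {x : ℚ_[p]} {δ : ℝ} (h0 : 0 ≤ δ) (hδ : δ < 1) (hx : ‖x - 1‖ ≤ δ) (n : ℤ) :
    ‖x ^ n - 1‖ ≤ δ := by
  cases n with
  | ofNat n => simpa using near_pow h0 hδ hx n
  | negSucc n => rw [zpow_negSucc]; exact near_inv hδ (near_pow h0 hδ hx _)

theorem near_prod {ι : Type*} {s : Finset ι} {x : ι → ℚ_[p]} {δ : ℝ} (h0 : 0 ≤ δ) (hδ : δ < 1)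
    (hx : ∀ i ∈ s, ‖x i - 1‖ ≤ δ) : ‖∏ i ∈ s, x i - 1‖ ≤ δ := by
  classical
  induction s using Finset.induction_on with
  | empty => simpa
  | insert a s ha ih =>
    rw [Finset.prod_insert ha]
    exact near_mul hδ (hx a (Finset.mem_insert_self _ _))
      (ih fun i hi => hx i (Finset.mem_insert_of_mem hi))

/-- `primeToPart` is multiplicative up to a unit congruent to `1` modulo `p^(s + 1)`. -/
theorem primeToPart_near {s : ℕ} (N M : ℕ) :
    ‖(primeToPart p (N + p ^ (s + 1) * M) : ℚ_[p]) /
      (primeToPart p N * primeToPart p (p ^ (s + 1)) ^ M) - 1‖ ≤ (p : ℝ)⁻¹ ^ (s + 1) := by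
  have h := primeToPart_add_mul_modEq (p := p) (dvd_pow_self p (Nat.succ_ne_zero s)) N M
  have hn : ∀ N, (primeToPart p N : ℚ_[p]) ≠ 0 := fun N h0 => by
    have := norm_primeToPart (p := p) N
    rw [h0, norm_zero] at this
    exact zero_ne_one this
  rw [div_sub_one (mul_ne_zero (hn _) (pow_ne_zero _ (hn _))), norm_div, norm_mul, norm_pow,
    norm_primeToPart, norm_primeToPart, one_pow, one_mul, div_one]
  have h2 := (Nat.modEq_iff_dvd.1 h.symm)
  have := (Padic.norm_int_le_pow_iff_dvd (p := p) _ (s + 1)).2 (by exact_mod_cast h2)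
  rw [zpow_neg, zpow_natCast, ← inv_pow] at this
  push_cast at this ⊢
  exact this

end Factorial

/-! ### Factorial quotients and Legendre's formula -/

section FactorialQuotient

theorem prod_zpow_const {K ι : Type*} [Field K] {x : K} (hx : x ≠ 0) (s : Finset ι) (f : ι → ℤ) :
    ∏ i ∈ s, x ^ f i = x ^ ∑ i ∈ s, f i := by
  classical
  induction s using Finset.induction_on with
  | empty => simp
  | insert a s ha ih => rw [Finset.prod_insert ha, Finset.sum_insert ha, ih, zpow_add₀ hx]

variable {d : ℕ} {ι : Type*} [Fintype ι]

/-- The product `∏ᵢ (cᵢ · n)!^(σᵢ)`: the factorial quotient attached to a family of vectors with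
integer multiplicities. -/
noncomputable def facQuot (K : Type*) [Field K] (c : ι → Fin d → ℕ) (σ : ι → ℤ) (n : Fin d → ℕ) :
    K :=
  ∏ i, ((c i ⬝ᵥ n)! : K) ^ σ i

/-- Landau's function at the rational point `n / q`. -/
def landauNat (c : ι → Fin d → ℕ) (σ : ι → ℤ) (n : Fin d → ℕ) (q : ℕ) : ℤ :=
  ∑ i, σ i * ((c i ⬝ᵥ n / q : ℕ) : ℤ)

theorem dotProduct_mono {x y n : Fin d → ℕ} (h : x ≤ y) : x ⬝ᵥ n ≤ y ⬝ᵥ n :=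
  Finset.sum_le_sum fun k _ => Nat.mul_le_mul_right _ (h k)

theorem dotProduct_mono_right {x n m : Fin d → ℕ} (h : n ≤ m) : x ⬝ᵥ n ≤ x ⬝ᵥ m :=
  Finset.sum_le_sum fun k _ => Nat.mul_le_mul_left _ (h k)

theorem dotProduct_add_smul (x u n : Fin d → ℕ) (q : ℕ) :
    x ⬝ᵥ (u + q • n) = x ⬝ᵥ u + q * (x ⬝ᵥ n) := by
  rw [dotProduct_add, dotProduct_smul, smul_eq_mul]

variable {c : ι → Fin d → ℕ} {σ : ι → ℤ}

theorem sum_mul_dotProduct (hσ : ∀ k, ∑ i, σ i * (c i k : ℤ) = 0) (n : Fin d → ℕ) :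
    ∑ i, σ i * ((c i ⬝ᵥ n : ℕ) : ℤ) = 0 := by
  simp only [dotProduct, Nat.cast_sum, Nat.cast_mul, Finset.mul_sum]
  rw [Finset.sum_comm]
  refine Finset.sum_eq_zero fun k _ => ?_
  have := congrArg (· * (n k : ℤ)) (hσ k)
  simpa [Finset.sum_mul, mul_assoc] using this

theorem landauNat_add_smul (hσ : ∀ k, ∑ i, σ i * (c i k : ℤ) = 0) (u n : Fin d → ℕ) {q r : ℕ}
    (hq : 0 < q) (hqr : q ∣ r) : landauNat c σ (u + r • n) q = landauNat c σ u q := by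
  obtain ⟨t, rfl⟩ := hqr
  have h := sum_mul_dotProduct hσ (t • n)
  unfold landauNat
  rw [mul_smul]
  simp only [dotProduct_add_smul, Nat.add_mul_div_left _ _ hq]
  push_cast
  simp only [mul_add, Finset.sum_add_distrib]
  rw [h, add_zero]

theorem mod_add_smul_div (n : Fin d → ℕ) (q : ℕ) :
    (fun k => n k % q) + q • (fun k => n k / q) = n := by
  ext k
  simp [Nat.mod_add_div]

theorem landauNat_mod (hσ : ∀ k, ∑ i, σ i * (c i k : ℤ) = 0) (n : Fin d → ℕ) {q : ℕ}
    (hq : 0 < q) : landauNat c σ (fun k => n k % q) q = landauNat c σ n q := by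
  conv_rhs => rw [← mod_add_smul_div n q]
  rw [landauNat_add_smul hσ _ _ hq dvd_rfl]

theorem facQuot_zero (K : Type*) [Field K] : facQuot K c σ 0 = 1 := by
  simp [facQuot]

theorem facQuot_ne_zero (K : Type*) [Field K] [CharZero K] (n : Fin d → ℕ) :
    facQuot K c σ n ≠ 0 :=
  Finset.prod_ne_zero_iff.2 fun _ _ => zpow_ne_zero _ (by exact_mod_cast Nat.factorial_ne_zero _)

theorem map_facQuot {K L : Type*} [Field K] [Field L] (F : K →+* L) (n : Fin d → ℕ) :
    F (facQuot K c σ n) = facQuot L c σ n := by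
  simp [facQuot]

variable {p : ℕ} [hp : Fact p.Prime]

/-- The `p`-adic valuation of a factorial quotient, by Legendre's formula. -/
theorem norm_facQuot {n : Fin d → ℕ} {b : ℕ} (h : ∀ i, c i ⬝ᵥ n < p ^ b) :
    ‖facQuot ℚ_[p] c σ n‖ = (p : ℝ)⁻¹ ^ ∑ l ∈ Finset.Icc 1 b, landauNat c σ n (p ^ l) := by
  have hp0 : (p : ℝ)⁻¹ ≠ 0 := p_inv_pos.ne'
  unfold facQuot landauNat
  rw [norm_prod, Finset.sum_comm, Finset.prod_congr rfl fun i _ => by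
    rw [norm_zpow, norm_factorial (h i), ← zpow_natCast, ← zpow_mul, mul_comm]]
  rw [prod_zpow_const hp0]
  congr 1
  refine Finset.sum_congr rfl fun i _ => ?_
  push_cast
  rw [Finset.mul_sum]

end FactorialQuotient

/-! ### The effect of one more digit on a factorial quotient -/

section Ratio

variable {d : ℕ} {ι : Type*} [Fintype ι] {c : ι → Fin d → ℕ} {σ : ι → ℤ}
variable {p : ℕ} [hp : Fact p.Prime]

theorem primeToPart_ne_zero (N : ℕ) : (primeToPart p N : ℚ_[p]) ≠ 0 := fun h0 => by
  have := norm_primeToPart (p := p) N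
  rw [h0, norm_zero] at this
  exact zero_ne_one this

theorem factorial_add_mul (a N : ℕ) : ((a + p * N)! : ℚ_[p]) =
    N ! * ((p : ℚ_[p]) ^ (N + a / p) * (N + 1).ascFactorial (a / p) *
      primeToPart p (a + p * N)) := by
  have h1 : (a + p * N) / p = N + a / p := by
    rw [Nat.add_mul_div_left _ _ hp.out.pos, add_comm]
  rw [factorial_eq_primeToPart (p := p) (a + p * N), h1, ← Nat.factorial_mul_ascFactorial]
  push_cast
  ring

/-- The factor by which `facQuot` changes when the digit vector `v` is appended to `m`. -/
theorem facQuot_add_smul (v m : Fin d → ℕ) : facQuot ℚ_[p] c σ (v + p • m) =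
    facQuot ℚ_[p] c σ m * ∏ i, ((p : ℚ_[p]) ^ (c i ⬝ᵥ m + c i ⬝ᵥ v / p) *
      (c i ⬝ᵥ m + 1).ascFactorial (c i ⬝ᵥ v / p) *
      primeToPart p (c i ⬝ᵥ v + p * (c i ⬝ᵥ m))) ^ σ i := by
  unfold facQuot
  rw [← Finset.prod_mul_distrib]
  refine Finset.prod_congr rfl fun i _ => ?_
  rw [dotProduct_add_smul, factorial_add_mul, mul_zpow]

/-- Comparison of the effect of the digit vector `v` on `u` and on `u + p^s n`: up to a unit close
to `1`, only finitely many explicit factors matter. -/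
theorem exists_facQuot_ratio (hσ : ∀ k, ∑ i, σ i * (c i k : ℤ) = 0) (v u n : Fin d → ℕ) (s : ℕ) :
    ∃ η : ℚ_[p], ‖η - 1‖ ≤ (p : ℝ)⁻¹ ^ (s + 1) ∧
      facQuot ℚ_[p] c σ (v + p • u + p ^ (s + 1) • n) / facQuot ℚ_[p] c σ (v + p • u) =
      facQuot ℚ_[p] c σ (u + p ^ s • n) / facQuot ℚ_[p] c σ u *
        (η * ∏ i, (((c i ⬝ᵥ u + p ^ s * (c i ⬝ᵥ n) + 1).ascFactorial (c i ⬝ᵥ v / p) : ℚ_[p]) /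
          (c i ⬝ᵥ u + 1).ascFactorial (c i ⬝ᵥ v / p)) ^ σ i) := by
  have hε := p_inv_pos (p := p)
  have hε1 : (p : ℝ)⁻¹ < 1 := inv_lt_one_of_one_lt₀ (by exact_mod_cast hp.out.one_lt)
  have hp0 : (p : ℚ_[p]) ≠ 0 := by exact_mod_cast hp.out.ne_zero
  obtain ⟨W, hW⟩ : ∃ W : ℚ_[p], W = ((primeToPart p (p ^ (s + 1)) : ℕ) : ℚ_[p]) := ⟨_, rfl⟩
  have hW0 : W ≠ 0 := hW ▸ primeToPart_ne_zero _
  let N : ι → ℕ := fun i => c i ⬝ᵥ v + p * (c i ⬝ᵥ u)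
  let M : ι → ℕ := fun i => c i ⬝ᵥ n
  refine ⟨∏ i, ((primeToPart p (N i + p ^ (s + 1) * M i) : ℚ_[p]) /
    (primeToPart p (N i) * W ^ M i)) ^ σ i, ?_, ?_⟩
  · refine near_prod (pow_nonneg hε.le _) (pow_lt_one₀ hε.le hε1 (Nat.succ_ne_zero s)) fun i _ => ?_
    exact near_zpow (pow_nonneg hε.le _) (pow_lt_one₀ hε.le hε1 (Nat.succ_ne_zero s))
      (by rw [hW]; exact primeToPart_near _ _) _
  · have e1 : v + p • u + p ^ (s + 1) • n = v + p • (u + p ^ s • n) := by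
      rw [smul_add, smul_smul, ← pow_succ', add_assoc]
    have hpow : ∏ i, ((p : ℚ_[p]) ^ (p ^ s * M i) / W ^ (-(M i : ℤ))) ^ σ i = 1 := by
      have hz : ∀ i, ((p : ℚ_[p]) ^ (p ^ s * M i) / W ^ (-(M i : ℤ))) ^ σ i =
          (((p : ℚ_[p]) ^ (p ^ s)) * W) ^ (σ i * (M i : ℤ)) := fun i => by
        rw [zpow_neg, div_inv_eq_mul, pow_mul, zpow_natCast, ← mul_pow, mul_comm (σ i), zpow_mul,
          zpow_natCast]
      rw [Finset.prod_congr rfl fun i _ => hz i,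
        prod_zpow_const (mul_ne_zero (pow_ne_zero _ hp0) hW0), sum_mul_dotProduct hσ n, zpow_zero]
    have hQu := facQuot_ne_zero (c := c) (σ := σ) ℚ_[p] u
    have hasc : ∀ N t : ℕ, ((N + 1).ascFactorial t : ℚ_[p]) ≠ 0 := fun N t => by
      exact_mod_cast (Nat.ascFactorial_pos N t).ne'
    rw [e1, facQuot_add_smul, facQuot_add_smul, mul_div_mul_comm, ← Finset.prod_div_distrib]
    congr 1
    have key : ∀ i, ((p : ℚ_[p]) ^ (c i ⬝ᵥ (u + p ^ s • n) + c i ⬝ᵥ v / p) *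
        (c i ⬝ᵥ (u + p ^ s • n) + 1).ascFactorial (c i ⬝ᵥ v / p) *
        primeToPart p (c i ⬝ᵥ v + p * (c i ⬝ᵥ (u + p ^ s • n)))) ^ σ i /
        ((p : ℚ_[p]) ^ (c i ⬝ᵥ u + c i ⬝ᵥ v / p) *
        (c i ⬝ᵥ u + 1).ascFactorial (c i ⬝ᵥ v / p) *
        primeToPart p (c i ⬝ᵥ v + p * (c i ⬝ᵥ u))) ^ σ i =
        ((primeToPart p (N i + p ^ (s + 1) * M i) : ℚ_[p]) /
          (primeToPart p (N i) * W ^ M i)) ^ σ i *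
        (((c i ⬝ᵥ u + p ^ s * (c i ⬝ᵥ n) + 1).ascFactorial (c i ⬝ᵥ v / p) : ℚ_[p]) /
          (c i ⬝ᵥ u + 1).ascFactorial (c i ⬝ᵥ v / p)) ^ σ i *
        ((p : ℚ_[p]) ^ (p ^ s * M i) / W ^ (-(M i : ℤ))) ^ σ i := fun i => by
      rw [← div_zpow, ← mul_zpow, ← mul_zpow]
      congr 1
      have e2 : c i ⬝ᵥ v + p * (c i ⬝ᵥ u + p ^ s * (c i ⬝ᵥ n)) = N i + p ^ (s + 1) * M i := by
        simp only [N, M]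
        ring
      rw [dotProduct_add_smul, e2]
      have h1 := hasc (c i ⬝ᵥ u) (c i ⬝ᵥ v / p)
      have h2 := primeToPart_ne_zero (p := p) (N i)
      have h3 := pow_ne_zero (M i) hW0
      change _ / (_ * _ * (primeToPart p (N i) : ℚ_[p])) = _
      rw [zpow_neg, zpow_natCast, div_inv_eq_mul]
      simp only [M] at h3 ⊢
      generalize (primeToPart p (N i + p ^ (s + 1) * c i ⬝ᵥ n) : ℚ_[p]) = y1
      generalize (primeToPart p (N i) : ℚ_[p]) = y2 at *
      generalize ((c i ⬝ᵥ u + p ^ s * c i ⬝ᵥ n + 1).ascFactorial (c i ⬝ᵥ v / p) : ℚ_[p]) = y3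
      generalize ((c i ⬝ᵥ u + 1).ascFactorial (c i ⬝ᵥ v / p) : ℚ_[p]) = y4 at *
      generalize W ^ (c i ⬝ᵥ n) = y5 at *
      rw [pow_add, pow_add, pow_add]
      field_simp
    rw [Finset.prod_congr rfl fun i _ => key i, Finset.prod_mul_distrib, Finset.prod_mul_distrib,
      hpow, mul_one]

end Ratio

/-! ### Active digits -/

section ActiveDigits

variable {d : ℕ} {ι : Type*} {c : ι → Fin d → ℕ}

/-- The vector of fractional parts of `n / q` satisfies `cᵢ · x ≥ 1` for some `i`. -/
def IsActive (c : ι → Fin d → ℕ) (n : Fin d → ℕ) (q : ℕ) : Prop :=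
  ∃ i, q ≤ c i ⬝ᵥ (fun k => n k % q)

/-- The number of `l ≥ 1` for which the fractional part of `n / p^l` satisfies `cᵢ · x ≥ 1` for
some `i`. -/
noncomputable def activeCount (c : ι → Fin d → ℕ) (p : ℕ) (n : Fin d → ℕ) : ℕ :=
  Set.ncard {l | 1 ≤ l ∧ IsActive c n (p ^ l)}

/-- The weight `p^(-activeCount)` that bounds the `p`-adic absolute value of the factorial
quotient. -/
noncomputable def activeWeight (c : ι → Fin d → ℕ) (p : ℕ) (n : Fin d → ℕ) : ℝ :=
  (p : ℝ)⁻¹ ^ activeCount c p n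

theorem dotProduct_mod_le (x n : Fin d → ℕ) (q : ℕ) : x ⬝ᵥ (fun k => n k % q) ≤ x ⬝ᵥ n :=
  dotProduct_mono_right fun _ => Nat.mod_le _ _

theorem isActive_add_smul {u n : Fin d → ℕ} {q r : ℕ} (h : q ∣ r) :
    IsActive c (u + r • n) q ↔ IsActive c u q := by
  obtain ⟨t, rfl⟩ := h
  have : (fun k => (u + (q * t) • n) k % q) = fun k => u k % q := by
    ext k
    simp [mul_assoc, Nat.add_mul_mod_self_left]
  rw [IsActive, IsActive, this]

theorem mod_add_pow_smul {p s l : ℕ} {u n : Fin d → ℕ} (hu : u ∈ box d p s) :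
    (fun k => (u + p ^ s • n) k % p ^ (s + l)) = u + p ^ s • (fun k => n k % p ^ l) := by
  rw [mem_box] at hu
  ext k
  have h := hu k
  simp only [Pi.add_apply, Pi.smul_apply, smul_eq_mul]
  have hps : 0 < p ^ s := by omega
  rw [pow_add, Nat.mod_mul, Nat.add_mul_mod_self_left, Nat.mod_eq_of_lt h,
    Nat.add_mul_div_left _ _ hps, Nat.div_eq_of_lt h, zero_add]

theorem IsActive.shift {p s l : ℕ} {u n : Fin d → ℕ} (hu : u ∈ box d p s)
    (h : IsActive c n (p ^ l)) : IsActive c (u + p ^ s • n) (p ^ (s + l)) := by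
  obtain ⟨i, hi⟩ := h
  refine ⟨i, ?_⟩
  rw [mod_add_pow_smul hu, dotProduct_add_smul, pow_add]
  exact (Nat.mul_le_mul_left _ hi).trans (Nat.le_add_left _ _)

/-- If a multiple of `p^r` lies strictly between `L · j` and the integral part of
`L · (v + p j) / p`, then the `r + 1` lowest digits of `v + p j` are all active. -/
theorem isActive_of_pow_dvd {p : ℕ} {L : Fin d → ℕ} {i₀ : ι} (hL : L ≤ c i₀) {v j : Fin d → ℕ}
    (hv : v ∈ box d p 1) {i r : ℕ} (hi : 1 ≤ i) (hiv : i ≤ L ⬝ᵥ v / p)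
    (hdvd : p ^ r ∣ L ⬝ᵥ j + i) {l : ℕ} (hl1 : 1 ≤ l) (hl : l ≤ r + 1) :
    IsActive c (v + p • j) (p ^ l) := by
  obtain ⟨l, rfl⟩ : ∃ t, l = t + 1 := ⟨l - 1, by omega⟩
  refine ⟨i₀, ?_⟩
  have e : (fun k => (v + p • j) k % p ^ (l + 1)) = v + p • (fun k => j k % p ^ l) := by
    have := mod_add_pow_smul (l := l) (n := j) hv
    rwa [pow_one, add_comm 1 l] at this
  rw [e]
  refine le_trans ?_ (dotProduct_mono hL)
  rw [dotProduct_add_smul]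
  have h1 : p * i ≤ L ⬝ᵥ v := (Nat.mul_le_mul_left p hiv).trans (Nat.mul_div_le _ _)
  have h2 : p ^ l ∣ L ⬝ᵥ (fun k => j k % p ^ l) + i := by
    have h3 : L ⬝ᵥ j = L ⬝ᵥ (fun k => j k % p ^ l) + p ^ l * (L ⬝ᵥ (fun k => j k / p ^ l)) := by
      conv_lhs => rw [← mod_add_smul_div j (p ^ l)]
      rw [dotProduct_add_smul]
    have h4 : p ^ l ∣ L ⬝ᵥ j + i := (pow_dvd_pow p (by omega)).trans hdvd
    rw [h3, add_right_comm] at h4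
    exact (Nat.dvd_add_left (Dvd.intro _ rfl)).1 h4
  have h5 := Nat.le_of_dvd (by omega) h2
  calc p ^ (l + 1) = p * p ^ l := pow_succ' p l
    _ ≤ p * (L ⬝ᵥ (fun k => j k % p ^ l) + i) := Nat.mul_le_mul_left p h5
    _ ≤ _ := by rw [mul_add]; omega

variable {p : ℕ} [hp : Fact p.Prime]

theorem not_isActive_of_lt {n : Fin d → ℕ} {l s : ℕ} (h : ∀ i, c i ⬝ᵥ n < p ^ s) (hl : s ≤ l) :
    ¬ IsActive c n (p ^ l) := by
  rintro ⟨i, hi⟩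
  have h1 := (hi.trans (dotProduct_mod_le _ _ _)).trans_lt (h i)
  exact absurd h1 (not_lt.2 (Nat.pow_le_pow_right hp.out.pos hl))

theorem exists_dotProduct_lt [Fintype ι] (c : ι → Fin d → ℕ) (n : Fin d → ℕ) :
    ∃ b, ∀ i, c i ⬝ᵥ n < p ^ b :=
  ⟨∑ i, c i ⬝ᵥ n, fun i => (Finset.single_le_sum (f := fun i => c i ⬝ᵥ n)
    (fun _ _ => Nat.zero_le _) (Finset.mem_univ i)).trans_lt (Nat.lt_pow_self hp.out.one_lt)⟩

theorem active_subset_Icc {n : Fin d → ℕ} {b : ℕ} (h : ∀ i, c i ⬝ᵥ n < p ^ b) :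
    {l | 1 ≤ l ∧ IsActive c n (p ^ l)} ⊆ Set.Ico 1 b := fun _ hl =>
  ⟨hl.1, not_le.1 fun hb => not_isActive_of_lt h hb hl.2⟩

theorem active_finite [Fintype ι] (c : ι → Fin d → ℕ) (n : Fin d → ℕ) :
    {l | 1 ≤ l ∧ IsActive c n (p ^ l)}.Finite := by
  obtain ⟨b, hb⟩ := exists_dotProduct_lt (p := p) c n
  exact (Set.finite_Ico 1 b).subset (active_subset_Icc hb)

theorem le_activeCount [Fintype ι] {n : Fin d → ℕ} {r : ℕ}
    (h : ∀ l, 1 ≤ l → l ≤ r → IsActive c n (p ^ l)) : r ≤ activeCount c p n := by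
  have : (Set.Icc 1 r).ncard ≤ activeCount c p n :=
    Set.ncard_le_ncard (fun l hl => ⟨hl.1, h l hl.1 hl.2⟩) (active_finite c n)
  rwa [Set.ncard_eq_toFinset_card', Set.toFinset_Icc, Nat.card_Icc, Nat.add_sub_cancel] at this

theorem activeCount_lt {n : Fin d → ℕ} {b : ℕ} (hb : 0 < b) (h : ∀ i, c i ⬝ᵥ n < p ^ b) :
    activeCount c p n < b := by
  have : activeCount c p n ≤ (Set.Ico 1 b).ncard :=
    Set.ncard_le_ncard (active_subset_Icc h) (Set.finite_Ico 1 b)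
  rw [Set.ncard_eq_toFinset_card', Set.toFinset_Ico, Nat.card_Ico] at this
  omega

theorem activeWeight_pos (n : Fin d → ℕ) : 0 < activeWeight c p n := pow_pos p_inv_pos _

theorem activeWeight_le_pow {n : Fin d → ℕ} {r : ℕ} (h : r ≤ activeCount c p n) :
    activeWeight c p n ≤ (p : ℝ)⁻¹ ^ r :=
  pow_le_pow_of_le_one p_inv_pos.le p_inv_le_one h

/-- The denominators `L · j + i` are compensated by the active digits of `v + pj`, with a factor
`p` to spare. -/
theorem activeWeight_le_norm [Fintype ι] {L : Fin d → ℕ} {i₀ : ι} (hL : L ≤ c i₀)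
    {v j : Fin d → ℕ}
    (hv : v ∈ box d p 1) {i : ℕ} (hi : 1 ≤ i) (hiv : i ≤ L ⬝ᵥ v / p) :
    activeWeight c p (v + p • j) ≤ (p : ℝ)⁻¹ * ‖((L ⬝ᵥ j + i : ℕ) : ℚ_[p])‖ := by
  rw [norm_natCast_eq_pow (by omega), ← pow_succ']
  exact activeWeight_le_pow (le_activeCount fun l h1 h2 =>
    isActive_of_pow_dvd hL hv hi hiv pow_padicValNat_dvd h1 h2)

end ActiveDigits

/-! ### Factorial quotients satisfy the hypotheses of the formal congruences -/

section DworkHypothesis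

variable {d : ℕ} {ι : Type*} [Fintype ι] {c : ι → Fin d → ℕ} {σ : ι → ℤ}
variable {p : ℕ} [hp : Fact p.Prime]

theorem landauNat_eq_zero_of_lt {n : Fin d → ℕ} {q : ℕ} (h : ∀ i, c i ⬝ᵥ n < q) :
    landauNat c σ n q = 0 :=
  Finset.sum_eq_zero fun i _ => by rw [Nat.div_eq_of_lt (h i)]; simp

theorem landauNat_eq_zero_of_not_isActive (hσ : ∀ k, ∑ i, σ i * (c i k : ℤ) = 0)
    {n : Fin d → ℕ} {q : ℕ} (hq : 0 < q) (h : ¬ IsActive c n q) : landauNat c σ n q = 0 := by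
  rw [← landauNat_mod hσ n hq]
  exact landauNat_eq_zero_of_lt fun i => not_le.1 fun hi => h ⟨i, hi⟩

/-- `𝒬(n)` is divisible by `p` to the number of active digits of `n`. -/
theorem norm_facQuot_le_activeWeight (hσ : ∀ k, ∑ i, σ i * (c i k : ℤ) = 0)
    (hΔ : ∀ n q, 0 < q → IsActive c n q → 1 ≤ landauNat c σ n q) (n : Fin d → ℕ) :
    ‖facQuot ℚ_[p] c σ n‖ ≤ activeWeight c p n := by
  classical
  obtain ⟨b, hb⟩ := exists_dotProduct_lt (p := p) c n
  rw [norm_facQuot hb, activeWeight, ← zpow_natCast]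
  refine zpow_le_zpow_right_of_le_one₀ p_inv_pos p_inv_le_one ?_
  have h1 : activeCount c p n ≤ ((Finset.Icc 1 b).filter fun l => IsActive c n (p ^ l)).card := by
    rw [← Set.ncard_coe_finset]
    refine Set.ncard_le_ncard (fun l hl => ?_) (Finset.finite_toSet _)
    have := active_subset_Icc hb hl
    simp only [Finset.coe_filter, Finset.mem_Icc, Set.mem_ofPred_eq]
    exact ⟨⟨this.1, this.2.le⟩, hl.2⟩
  refine (Int.ofNat_le.2 h1).trans ?_
  rw [Finset.card_filter]
  push_cast
  refine Finset.sum_le_sum fun l _ => ?_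
  have hq : 0 < p ^ l := pow_pos hp.out.pos l
  split_ifs with h
  · exact hΔ n _ hq h
  · exact (landauNat_eq_zero_of_not_isActive hσ hq h).ge

/-- Prefixing fewer than `s` digits `u` without carries changes `facQuot` by a factor that does
not affect the absolute value. -/
theorem norm_facQuot_div (hσ : ∀ k, ∑ i, σ i * (c i k : ℤ) = 0) {s : ℕ} {u : Fin d → ℕ}
    (hu : ∀ i, c i ⬝ᵥ u < p ^ s) (n : Fin d → ℕ) :
    ‖facQuot ℚ_[p] c σ (u + p ^ s • n) / facQuot ℚ_[p] c σ u‖ = ‖facQuot ℚ_[p] c σ n‖ := by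
  obtain ⟨b, hb⟩ := exists_dotProduct_lt (p := p) c n
  have hps : 0 < p ^ s := pow_pos hp.out.pos s
  have hsb : ∀ i, c i ⬝ᵥ (u + p ^ s • n) < p ^ (s + b) := fun i => by
    rw [dotProduct_add_smul, pow_add]
    have h1 := hu i
    have h2 : p ^ s * (c i ⬝ᵥ n + 1) ≤ p ^ s * p ^ b := Nat.mul_le_mul_left _ (hb i)
    rw [mul_add, mul_one] at h2
    omega
  have hp0 : (p : ℝ)⁻¹ ≠ 0 := p_inv_pos.ne'
  rw [norm_div, norm_facQuot hsb, norm_facQuot hu, norm_facQuot hb, ← zpow_sub₀ hp0]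
  congr 1
  have hsplit : Finset.Icc 1 (s + b) = Finset.Icc 1 s ∪ (Finset.Icc 1 b).image (s + ·) := by
    ext l
    simp only [Finset.mem_union, Finset.mem_Icc, Finset.mem_image]
    constructor
    · intro h
      by_cases hl : l ≤ s
      · exact Or.inl ⟨h.1, hl⟩
      · exact Or.inr ⟨l - s, by omega, by omega⟩
    · rintro (h | ⟨a, h, rfl⟩) <;> omega
  rw [hsplit, Finset.sum_union, Finset.sum_image fun x _ y _ h => Nat.add_left_cancel h]
  · rw [Finset.sum_congr rfl fun l hl => landauNat_add_smul hσ u n (pow_pos hp.out.pos l)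
      (pow_dvd_pow p (Finset.mem_Icc.1 hl).2), add_sub_cancel_left]
    refine Finset.sum_congr rfl fun l _ => ?_
    unfold landauNat
    refine Finset.sum_congr rfl fun i _ => ?_
    rw [dotProduct_add_smul, pow_add, ← Nat.div_div_eq_div_mul, Nat.add_mul_div_left _ _ hps,
      Nat.div_eq_of_lt (hu i), zero_add]
  · rw [Finset.disjoint_left]
    intro l hl hl'
    simp only [Finset.mem_Icc, Finset.mem_image] at hl hl'
    obtain ⟨a, h, rfl⟩ := hl'
    omega

/-- If `u` satisfies the truncation condition but `v + pu` does not, then all digits of `v + pu`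
are active. -/
theorem activeCount_add_le {s : ℕ} {v u : Fin d → ℕ} (hv : v ∈ box d p 1) (hu : u ∈ box d p s)
    (hΨ : ∀ i, c i ⬝ᵥ u < p ^ s) (hΨ' : ¬ ∀ i, c i ⬝ᵥ (v + p • u) < p ^ (s + 1))
    (n : Fin d → ℕ) :
    s + 1 + activeCount c p n ≤ activeCount c p (v + p • u + p ^ (s + 1) • n) := by
  push Not at hΨ'
  obtain ⟨i, hi⟩ := hΨ'
  have hw : v + p • u ∈ box d p (s + 1) := by
    have := add_mem_box hv hu
    rwa [pow_one, add_comm 1 s] at this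
  -- every initial segment of the digits of `v + p u` is active
  have hact : ∀ l, 1 ≤ l → l ≤ s + 1 → IsActive c (v + p • u) (p ^ l) := by
    intro l hl1 hl
    refine ⟨i, not_lt.1 fun hlt => not_lt.2 hi ?_⟩
    obtain ⟨l, rfl⟩ : ∃ t, l = t + 1 := ⟨l - 1, by omega⟩
    have h1 : (fun k => (v + p • u) k / p ^ (l + 1)) = fun k => u k / p ^ l := by
      rw [mem_box_one] at hv
      ext k
      rw [pow_succ', ← Nat.div_div_eq_div_mul]
      simp [Nat.add_mul_div_left _ _ hp.out.pos, Nat.div_eq_of_lt (hv k)]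
    rw [← mod_add_smul_div (v + p • u) (p ^ (l + 1)), dotProduct_add_smul, h1]
    have h2 : p ^ l * (c i ⬝ᵥ fun k => u k / p ^ l) < p ^ l * p ^ (s - l) := by
      rw [← pow_add, show l + (s - l) = s by omega]
      refine lt_of_le_of_lt ?_ (hΨ i)
      rw [← smul_eq_mul, ← dotProduct_smul]
      exact dotProduct_mono_right fun k => by simpa using Nat.mul_div_le (u k) (p ^ l)
    have h3 := Nat.lt_of_mul_lt_mul_left h2
    have h4 : p ^ (l + 1) * (c i ⬝ᵥ (fun k => u k / p ^ l) + 1) ≤ p ^ (l + 1) * p ^ (s - l) :=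
      Nat.mul_le_mul_left _ h3
    rw [← pow_add, show l + 1 + (s - l) = s + 1 by omega, mul_add, mul_one] at h4
    omega
  have hsub : Set.Icc 1 (s + 1) ∪ (s + 1 + ·) '' {l | 1 ≤ l ∧ IsActive c n (p ^ l)} ⊆
      {l | 1 ≤ l ∧ IsActive c (v + p • u + p ^ (s + 1) • n) (p ^ l)} := by
    rintro l (hl | ⟨t, ht, rfl⟩)
    · exact ⟨hl.1, (isActive_add_smul (pow_dvd_pow p hl.2)).2 (hact l hl.1 hl.2)⟩
    · exact ⟨by simp only; omega, ht.2.shift hw⟩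
  have hcard := Set.ncard_le_ncard hsub (active_finite c _)
  rw [Set.ncard_union_eq _ (Set.finite_Icc 1 (s + 1)) ((active_finite c n).image _),
    Set.ncard_image_of_injective _ (add_right_injective (s + 1)), Set.ncard_eq_toFinset_card',
    Set.toFinset_Icc, Nat.card_Icc, Nat.add_sub_cancel] at hcard
  · exact hcard
  · rw [Set.disjoint_left]
    rintro l hl ⟨t, ht, rfl⟩
    have h1 := hl.2
    have h2 := ht.1
    simp only at h1
    omega

/-- The explicit factors of `exists_facQuot_ratio` are close to `1`, to an extent measured by the
active digits of `v + pu`. -/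
theorem near_prod_ascFactorial {s : ℕ} {v u : Fin d → ℕ} (hv : v ∈ box d p 1)
    (hΨ : ∀ i, c i ⬝ᵥ (v + p • u) < p ^ (s + 1)) (n : Fin d → ℕ) :
    ‖∏ i, (((c i ⬝ᵥ u + p ^ s * (c i ⬝ᵥ n) + 1).ascFactorial (c i ⬝ᵥ v / p) : ℚ_[p]) /
      (c i ⬝ᵥ u + 1).ascFactorial (c i ⬝ᵥ v / p)) ^ σ i - 1‖ ≤
      (p : ℝ)⁻¹ ^ (s + 1) / activeWeight c p (v + p • u) := by
  have hε := p_inv_pos (p := p)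
  have hε1 : (p : ℝ)⁻¹ < 1 := inv_lt_one_of_one_lt₀ (by exact_mod_cast hp.out.one_lt)
  have hw := activeWeight_pos (c := c) (p := p) (v + p • u)
  have hδ : (p : ℝ)⁻¹ ^ (s + 1) / activeWeight c p (v + p • u) < 1 := by
    rw [div_lt_one hw]
    exact pow_lt_pow_right_of_lt_one₀ hε hε1 (activeCount_lt (Nat.succ_pos s) hΨ)
  have hδ0 : 0 ≤ (p : ℝ)⁻¹ ^ (s + 1) / activeWeight c p (v + p • u) :=
    div_nonneg (pow_nonneg hε.le _) hw.le
  refine near_prod hδ0 hδ fun i _ => near_zpow hδ0 hδ ?_ _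
  rw [Nat.ascFactorial_eq_prod_range, Nat.ascFactorial_eq_prod_range]
  push_cast
  rw [← Finset.prod_div_distrib]
  refine near_prod hδ0 hδ fun t ht => ?_
  rw [Finset.mem_range] at ht
  have hkey := activeWeight_le_norm (c := c) (le_refl (c i)) (j := u) hv (i := t + 1) (by omega) ht
  have hne : ((c i ⬝ᵥ u + (t + 1) : ℕ) : ℚ_[p]) ≠ 0 := Nat.cast_ne_zero.2 (by omega)
  have e : ((c i ⬝ᵥ u : ℕ) + (p : ℚ_[p]) ^ s * (c i ⬝ᵥ n : ℕ) + 1 + t) /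
      ((c i ⬝ᵥ u : ℕ) + 1 + t) - 1 =
      (p : ℚ_[p]) ^ s * (c i ⬝ᵥ n : ℕ) / ((c i ⬝ᵥ u + (t + 1) : ℕ) : ℚ_[p]) := by
    push_cast at hne ⊢
    rw [show ((c i ⬝ᵥ u : ℕ) : ℚ_[p]) + 1 + t = (c i ⬝ᵥ u : ℕ) + (t + 1) by ring]
    field_simp
    ring
  rw [e, norm_div, norm_mul, norm_pow, Padic.norm_p, div_le_div_iff₀ (norm_pos_iff.2 hne) hw]
  have hn1 : ‖((c i ⬝ᵥ n : ℕ) : ℚ_[p])‖ ≤ 1 := by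
    exact_mod_cast Padic.norm_int_le_one ((c i ⬝ᵥ n : ℕ) : ℤ)
  calc _ ≤ (p : ℝ)⁻¹ ^ s * 1 * ((p : ℝ)⁻¹ * ‖((c i ⬝ᵥ u + (t + 1) : ℕ) : ℚ_[p])‖) :=
        mul_le_mul (mul_le_mul_of_nonneg_left hn1 (pow_nonneg hε.le _)) hkey hw.le
          (mul_nonneg (pow_nonneg hε.le _) zero_le_one)
    _ = _ := by rw [pow_succ]; ring

/-- If Landau's function is at least `1` at all active points, then factorial quotients satisfy
the hypotheses of the formal congruences. -/
theorem dworkHyp_facQuot (hσ : ∀ k, ∑ i, σ i * (c i k : ℤ) = 0)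
    (hΔ : ∀ n q, 0 < q → IsActive c n q → 1 ≤ landauNat c σ n q) :
    DworkHyp (facQuot ℚ_[p] c σ) (activeWeight c p) (fun s u => ∀ i, c i ⬝ᵥ u < p ^ s) where
  one := facQuot_zero _
  ne_zero n := facQuot_ne_zero _ n
  γ_pos n := activeWeight_pos n
  γ_zero := by
    have : activeCount c p 0 < 1 :=
      activeCount_lt one_pos fun i => by rw [dotProduct_zero]; exact pow_pos hp.out.pos 1
    rw [activeWeight, Nat.lt_one_iff.1 this, pow_zero]
  γ_le_one n := pow_le_one₀ p_inv_pos.le p_inv_le_one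
  norm_le n := norm_facQuot_le_activeWeight hσ hΔ n
  base i := by simp
  tail s v _ u _ h i := by
    have h1 := h i
    rw [dotProduct_add_smul, pow_succ'] at h1
    exact Nat.lt_of_mul_lt_mul_left ((Nat.le_add_left _ _).trans_lt h1)
  ratio_le s u _ hΨ n := by
    rw [norm_facQuot_div hσ hΨ]
    exact norm_facQuot_le_activeWeight hσ hΔ n
  ratio_sub_le s v hv u _ hΨ n := by
    have hε := p_inv_pos (p := p)
    have hε1 : (p : ℝ)⁻¹ < 1 := inv_lt_one_of_one_lt₀ (by exact_mod_cast hp.out.one_lt)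
    have hw := activeWeight_pos (c := c) (p := p) (v + p • u)
    have hΨu : ∀ i, c i ⬝ᵥ u < p ^ s := fun i => by
      have h1 := hΨ i
      rw [dotProduct_add_smul, pow_succ'] at h1
      exact Nat.lt_of_mul_lt_mul_left ((Nat.le_add_left _ _).trans_lt h1)
    obtain ⟨η, hη, e⟩ := exists_facQuot_ratio (p := p) hσ v u n s
    have hδ : (p : ℝ)⁻¹ ^ (s + 1) / activeWeight c p (v + p • u) < 1 := by
      rw [div_lt_one hw]
      exact pow_lt_pow_right_of_lt_one₀ hε hε1 (activeCount_lt (Nat.succ_pos s) hΨ)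
    have hη' : ‖η - 1‖ ≤ (p : ℝ)⁻¹ ^ (s + 1) / activeWeight c p (v + p • u) := by
      refine hη.trans (le_div_self (pow_nonneg hε.le _) hw ?_)
      exact pow_le_one₀ hε.le p_inv_le_one
    rw [e, ← mul_sub_one, norm_mul, norm_facQuot_div hσ hΨu]
    calc _ ≤ activeWeight c p n * ((p : ℝ)⁻¹ ^ (s + 1) / activeWeight c p (v + p • u)) :=
          mul_le_mul (norm_facQuot_le_activeWeight hσ hΔ n)
            (near_mul hδ hη' (near_prod_ascFactorial hv hΨ n)) (norm_nonneg _)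
            (activeWeight_pos n).le
      _ = _ := by ring
  γ_le s v hv u hu hΨ hΨ' n := by
    refine (activeWeight_le_pow (activeCount_add_le hv hu hΨ hΨ' n)).trans_eq ?_
    rw [pow_add]
    rfl

end DworkHypothesis

/-! ### The Dieudonné–Dwork criterion on coefficients -/

section Coefficients

variable {d p : ℕ} [hp : Fact p.Prime]

/-- The series `∑ₙ A(n) z^n`. -/
noncomputable def seriesOf {R : Type*} (A : (Fin d → ℕ) → R) : MvPowerSeries (Fin d) R :=
  fun n => A n

theorem coeff_seriesOf {R : Type*} [Semiring R] (A : (Fin d → ℕ) → R) (n : Fin d →₀ ℕ) :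
    coeff n (seriesOf A) = A n := rfl

/-- The coefficient at `a + pK` of `F(z) G(z^p) - p F(z^p) G(z)`, where `F = ∑ A(n) z^n` and
`G = ∑ A(n) B(n) z^n`. -/
noncomputable def dworkCoeff (A B : (Fin d → ℕ) → ℚ_[p]) (a K : Fin d → ℕ) : ℚ_[p] :=
  ∑ j ∈ Finset.Iic K, A (K - j) * A (a + p • j) * (B (K - j) - p * B (a + p • j))

theorem coeff_eq_dworkCoeff (A B : (Fin d → ℕ) → ℚ_[p]) {a K : Fin d →₀ ℕ}
    (ha : ∀ i, a i < p) :
    coeff (a + p • K) (expand p hp.out.ne_zero (seriesOf fun n => A n * B n) * seriesOf A -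
      (p : ℚ_[p]) • (expand p hp.out.ne_zero (seriesOf A) * seriesOf fun n => A n * B n)) =
      dworkCoeff A B a K := by
  rw [map_sub, coeff_smul, coeff_expand_mul _ ha, coeff_expand_mul _ ha, dworkCoeff,
    Finset.mul_sum, ← Finset.sum_sub_distrib]
  refine Finset.sum_nbij' (fun x => x.2) (fun j => (K - Finsupp.equivFunOnFinite.symm j,
    Finsupp.equivFunOnFinite.symm j)) ?_ ?_ ?_ ?_ ?_
  · intro x hx
    rw [Finset.HasAntidiagonal.mem_antidiagonal] at hx
    rw [Finset.mem_Iic, ← hx]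
    intro i
    simp
  · intro j hj
    rw [Finset.mem_Iic] at hj
    rw [Finset.HasAntidiagonal.mem_antidiagonal]
    ext i
    have : j i ≤ K i := hj i
    simp only [Finsupp.coe_add, Finsupp.coe_tsub, Pi.add_apply, Pi.sub_apply,
      Finsupp.equivFunOnFinite_symm_apply_apply]
    omega
  · intro x hx
    rw [Finset.HasAntidiagonal.mem_antidiagonal] at hx
    refine Prod.ext ?_ ?_
    · ext i
      have := DFunLike.congr_fun hx i
      simp only [Finsupp.coe_add, Pi.add_apply] at this
      simp only [Finsupp.coe_tsub, Pi.sub_apply, Finsupp.equivFunOnFinite_symm_apply_apply]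
      omega
    · ext i
      simp
  · intro j _
    ext i
    simp
  · intro x hx
    rw [Finset.HasAntidiagonal.mem_antidiagonal] at hx
    have e1 : (K : Fin d → ℕ) - x.2 = x.1 := by
      rw [← hx]
      ext i
      simp
    simp only [coeff_seriesOf, e1, Finsupp.coe_add, Finsupp.coe_smul]
    ring

/-- The Dieudonné–Dwork criterion in terms of coefficients. -/
theorem integral_fexp_iff_dworkCoeff {A B : (Fin d → ℕ) → ℚ_[p]} (hA : ∀ n, ‖A n‖ ≤ 1)
    (hA0 : A 0 = 1) (hB0 : B 0 = 0) :
    Integral (fexp (seriesOf (fun n => A n * B n) * (seriesOf A)⁻¹)) ↔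
      ∀ a ∈ box d p 1, ∀ K, ‖dworkCoeff A B a K‖ ≤ (p : ℝ)⁻¹ := by
  have hF : Integral (seriesOf A) := fun n => hA n
  have hF1 : constantCoeff (seriesOf A) = 1 := hA0
  have hG0 : constantCoeff (seriesOf fun n => A n * B n) = 0 := by
    change A 0 * B 0 = 0
    rw [hB0, mul_zero]
  rw [integral_fexp_div_iff hF hF1 hG0 hp.out.ne_zero]
  constructor
  · intro h a ha K
    have := h (Finsupp.equivFunOnFinite.symm a + p • Finsupp.equivFunOnFinite.symm K)
    rwa [coeff_eq_dworkCoeff A B fun i => mem_box_one.1 ha i] at this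
  · intro h n
    have e : n = (Finsupp.equivFunOnFinite.symm fun i => n i % p) +
        p • (Finsupp.equivFunOnFinite.symm fun i => n i / p) := by
      ext i
      simp [Nat.mod_add_div]
    rw [e, coeff_eq_dworkCoeff A B fun i => Nat.mod_lt _ hp.out.pos]
    exact h _ (mem_box_one.2 fun i => Nat.mod_lt _ hp.out.pos) _

end Coefficients

/-! ### Harmonic numbers modulo `p` -/

section Harmonic

variable {p : ℕ} [hp : Fact p.Prime]

/-- The harmonic number `H_N` in `ℚ_p`. -/
noncomputable def harm (p : ℕ) [Fact p.Prime] (N : ℕ) : ℚ_[p] := ((harmonic N : ℚ) : ℚ_[p])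

theorem harm_zero : harm p 0 = 0 := by simp [harm]

theorem harm_succ (N : ℕ) : harm p (N + 1) = harm p N + ((N + 1 : ℕ) : ℚ_[p])⁻¹ := by
  simp [harm, harmonic_succ]

theorem harm_add_sub (M N : ℕ) : harm p (M + N) - harm p M =
    ∑ i ∈ Finset.range N, ((M + (i + 1) : ℕ) : ℚ_[p])⁻¹ := by
  induction N with
  | zero => simp
  | succ N ih => rw [Finset.sum_range_succ, ← ih, ← add_assoc, harm_succ]; ring_nf

/-- `p H_N ≡ H_{⌊N/p⌋}` modulo `p`. -/
theorem norm_p_mul_harm_sub_le (N : ℕ) : ‖p * harm p N - harm p (N / p)‖ ≤ (p : ℝ)⁻¹ := by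
  have hp0 : (p : ℚ_[p]) ≠ 0 := by exact_mod_cast hp.out.ne_zero
  induction N with
  | zero => simp [harm_zero]
  | succ N ih =>
    rw [harm_succ, Nat.succ_div]
    split_ifs with h
    · have h1 : ((N + 1 : ℕ) : ℚ_[p]) = p * ((N / p + 1 : ℕ) : ℚ_[p]) := by
        rw [← Nat.cast_mul]
        congr 1
        rw [← Nat.mul_div_cancel' h, Nat.succ_div, if_pos h]
      rw [harm_succ, h1, mul_inv, mul_add, mul_inv_cancel_left₀ hp0, add_sub_add_right_eq_sub]
      exact ih
    · rw [add_zero, mul_add, add_sub_right_comm]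
      refine norm_add_le_of_le ih ?_
      rw [norm_mul, norm_inv, norm_natCast_eq_one h, inv_one, mul_one, Padic.norm_p]

end Harmonic

/-! ### Integrality when Landau's function is at least `1` on `𝒟` -/

section Sufficiency

variable {d : ℕ} {ι : Type*} [Fintype ι] {c : ι → Fin d → ℕ} {σ : ι → ℤ}
variable {p : ℕ} [hp : Fact p.Prime] {L : Fin d → ℕ} {i₀ : ι}

/-- After multiplication by `𝒬(a + pj)`, the numbers `p H_{L · (a + pj)}` and `H_{L · j}` are
congruent modulo `p`. -/
theorem norm_facQuot_mul_harm_sub_le (hσ : ∀ k, ∑ i, σ i * (c i k : ℤ) = 0)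
    (hΔ : ∀ n q, 0 < q → IsActive c n q → 1 ≤ landauNat c σ n q) (hL : L ≤ c i₀)
    {a : Fin d → ℕ} (ha : a ∈ box d p 1) (j : Fin d → ℕ) :
    ‖facQuot ℚ_[p] c σ (a + p • j) *
      (p * harm p (L ⬝ᵥ (a + p • j)) - harm p (L ⬝ᵥ j))‖ ≤ (p : ℝ)⁻¹ := by
  have hε := p_inv_pos (p := p)
  have hQ := norm_facQuot_le_activeWeight (p := p) hσ hΔ (a + p • j)
  have e : (L ⬝ᵥ (a + p • j)) / p = L ⬝ᵥ j + L ⬝ᵥ a / p := by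
    rw [dotProduct_add_smul, Nat.add_mul_div_left _ _ hp.out.pos, add_comm]
  have h1 := norm_p_mul_harm_sub_le (p := p) (L ⬝ᵥ (a + p • j))
  rw [e] at h1
  rw [← sub_add_sub_cancel _ (harm p (L ⬝ᵥ j + L ⬝ᵥ a / p)), mul_add]
  refine norm_add_le_of_le ?_ ?_
  · rw [norm_mul]
    have hQ1 : ‖facQuot ℚ_[p] c σ (a + p • j)‖ ≤ 1 :=
      hQ.trans (pow_le_one₀ p_inv_pos.le p_inv_le_one)
    calc _ ≤ 1 * (p : ℝ)⁻¹ := mul_le_mul hQ1 h1 (norm_nonneg _) zero_le_one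
      _ = _ := one_mul _
  · rw [harm_add_sub, Finset.mul_sum]
    refine norm_sum_le_of_le hε.le fun i hi => ?_
    rw [Finset.mem_range] at hi
    have hkey := activeWeight_le_norm hL ha (j := j) (i := i + 1) (by omega) hi
    have hne : ((L ⬝ᵥ j + (i + 1) : ℕ) : ℚ_[p]) ≠ 0 := Nat.cast_ne_zero.2 (by omega)
    rw [norm_mul, norm_inv, ← div_eq_mul_inv, div_le_iff₀ (norm_pos_iff.2 hne)]
    exact hQ.trans hkey

/-- The denominator of the change of `H_{L · j}` when the digit vector `y` of `j = p^t (y + pm)` is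
cleared is at most `p^t` times the power of `p` given by the active digits of `y + pm`. -/
theorem norm_harm_sub_mul_le (hL : L ≤ c i₀) {y : Fin d → ℕ} (hy : y ∈ box d p 1) (t : ℕ)
    (m : Fin d → ℕ) :
    ‖harm p (L ⬝ᵥ (p ^ t • (y + p • m))) - harm p (L ⬝ᵥ (p ^ (t + 1) • m))‖ *
      ((p : ℝ)⁻¹ ^ t * activeWeight c p (y + p • m)) ≤ 1 := by
  have hε := p_inv_pos (p := p)
  have hw := activeWeight_pos (c := c) (p := p) (y + p • m)
  have hpos : 0 < (p : ℝ)⁻¹ ^ t * activeWeight c p (y + p • m) := mul_pos (pow_pos hε t) hw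
  have e : L ⬝ᵥ (p ^ t • (y + p • m)) = p ^ (t + 1) * (L ⬝ᵥ m) + p ^ t * (L ⬝ᵥ y) := by
    rw [dotProduct_smul, dotProduct_add_smul, smul_eq_mul]
    ring
  rw [e, dotProduct_smul, smul_eq_mul, harm_add_sub, ← le_div_iff₀ hpos]
  refine norm_sum_le_of_le (div_nonneg zero_le_one hpos.le) fun i hi => ?_
  rw [Finset.mem_range] at hi
  have hne : ((p ^ (t + 1) * (L ⬝ᵥ m) + (i + 1) : ℕ) : ℚ_[p]) ≠ 0 := Nat.cast_ne_zero.2 (by omega)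
  rw [norm_inv, ← one_div]
  refine one_div_le_one_div_of_le hpos ?_
  by_cases hd : p ^ (t + 1) ∣ i + 1
  · obtain ⟨i', hi'⟩ := hd
    have hi'0 : 1 ≤ i' := by
      rcases Nat.eq_zero_or_pos i' with h | h
      · rw [h, mul_zero] at hi'
        omega
      · exact h
    have hle : i' ≤ L ⬝ᵥ y / p := by
      rw [Nat.le_div_iff_mul_le hp.out.pos]
      have : p ^ t * (i' * p) ≤ p ^ t * (L ⬝ᵥ y) := by
        calc p ^ t * (i' * p) = p ^ (t + 1) * i' := by ring
          _ ≤ _ := by omega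
      exact Nat.le_of_mul_le_mul_left this (pow_pos hp.out.pos t)
    have hkey := activeWeight_le_norm hL hy (j := m) hi'0 hle
    rw [hi', ← mul_add, Nat.cast_mul, norm_mul, Nat.cast_pow, norm_pow, Padic.norm_p, pow_succ,
      mul_assoc]
    exact mul_le_mul_of_nonneg_left hkey (pow_nonneg hε.le t)
  · rw [norm_natCast_eq_pow (by omega)]
    have hv : padicValNat p (p ^ (t + 1) * (L ⬝ᵥ m) + (i + 1)) ≤ t := by
      by_contra hc
      push Not at hc
      apply hd
      have := (padicValNat_dvd_iff_le (p := p) (n := t + 1)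
        (show p ^ (t + 1) * (L ⬝ᵥ m) + (i + 1) ≠ 0 by omega)).2 hc
      exact (Nat.dvd_add_right (Dvd.intro _ rfl)).1 this
    calc _ ≤ (p : ℝ)⁻¹ ^ t * 1 := mul_le_mul_of_nonneg_left
          (pow_le_one₀ p_inv_pos.le p_inv_le_one) (pow_nonneg hε.le t)
      _ = (p : ℝ)⁻¹ ^ t := mul_one _
      _ ≤ _ := pow_le_pow_of_le_one hε.le p_inv_le_one hv

/-- Telescoping: replacing `H_{L · j}` by its value at the leading digits of `j` costs only
multiples of `p`, by the formal congruences. -/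
theorem norm_sum_harm_mul_dworkTerm_sub_le (hσ : ∀ k, ∑ i, σ i * (c i k : ℤ) = 0)
    (hΔ : ∀ n q, 0 < q → IsActive c n q → 1 ≤ landauNat c σ n q) (hL : L ≤ c i₀)
    {a : Fin d → ℕ} (ha : a ∈ box d p 1) (K : Fin d → ℕ) (t : ℕ) (m : Fin d → ℕ) :
    ‖∑ x ∈ box d p t, harm p (L ⬝ᵥ (x + p ^ t • m)) *
        dworkTerm (facQuot ℚ_[p] c σ) a K (x + p ^ t • m) -
      harm p (L ⬝ᵥ (p ^ t • m)) * dworkSum (facQuot ℚ_[p] c σ) a K t m‖ ≤ (p : ℝ)⁻¹ := by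
  have hε := p_inv_pos (p := p)
  have H := dworkHyp_facQuot (p := p) hσ hΔ
  induction t generalizing m with
  | zero => simp [box_zero, dworkSum_zero, hε.le]
  | succ t ih =>
    have e : ∑ x ∈ box d p (t + 1), harm p (L ⬝ᵥ (x + p ^ (t + 1) • m)) *
        dworkTerm (facQuot ℚ_[p] c σ) a K (x + p ^ (t + 1) • m) =
        ∑ y ∈ box d p 1, ∑ x ∈ box d p t, harm p (L ⬝ᵥ (x + p ^ t • (y + p • m))) *
          dworkTerm (facQuot ℚ_[p] c σ) a K (x + p ^ t • (y + p • m)) := by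
      rw [sum_box_add hp.out.pos]
      refine Finset.sum_congr rfl fun y _ => Finset.sum_congr rfl fun x _ => ?_
      rw [smul_add, smul_smul, ← pow_succ, add_assoc]
    rw [e, dworkSum_succ, Finset.mul_sum, ← Finset.sum_sub_distrib]
    refine norm_sum_le_of_le hε.le fun y hy => norm_sub_trans (ih (y + p • m)) ?_
    rw [← sub_mul, norm_mul]
    calc _ ≤ ‖harm p (L ⬝ᵥ (p ^ t • (y + p • m))) - harm p (L ⬝ᵥ (p ^ (t + 1) • m))‖ *
          ((p : ℝ)⁻¹ ^ (t + 1) * activeWeight c p (y + p • m)) :=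
          mul_le_mul_of_nonneg_left (norm_dworkSum_le H ha t K _) (norm_nonneg _)
      _ = ‖harm p (L ⬝ᵥ (p ^ t • (y + p • m))) - harm p (L ⬝ᵥ (p ^ (t + 1) • m))‖ *
          ((p : ℝ)⁻¹ ^ t * activeWeight c p (y + p • m)) * (p : ℝ)⁻¹ := by rw [pow_succ]; ring
      _ ≤ 1 * (p : ℝ)⁻¹ :=
          mul_le_mul_of_nonneg_right (norm_harm_sub_mul_le hL hy t m) hε.le
      _ = _ := one_mul _

/-- The Dieudonné–Dwork congruences for `q_L`, when Landau's function is at least `1` at all active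
points. -/
theorem norm_dworkCoeff_le (hσ : ∀ k, ∑ i, σ i * (c i k : ℤ) = 0)
    (hΔ : ∀ n q, 0 < q → IsActive c n q → 1 ≤ landauNat c σ n q) (hL : L ≤ c i₀)
    {a : Fin d → ℕ} (ha : a ∈ box d p 1) (K : Fin d → ℕ) :
    ‖dworkCoeff (facQuot ℚ_[p] c σ) (fun n => harm p (L ⬝ᵥ n)) a K‖ ≤ (p : ℝ)⁻¹ := by
  have hε := p_inv_pos (p := p)
  set Q := facQuot ℚ_[p] c σ with hQ
  have hQ1 : ∀ n, ‖Q n‖ ≤ 1 := fun n =>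
    (norm_facQuot_le_activeWeight hσ hΔ n).trans (pow_le_one₀ hε.le p_inv_le_one)
  -- `p H_{L · (a + pj)}` may be replaced by `H_{L · j}`
  have e1 : dworkCoeff Q (fun n => harm p (L ⬝ᵥ n)) a K =
      ∑ j ∈ Finset.Iic K, Q (K - j) * Q (a + p • j) * (harm p (L ⬝ᵥ (K - j)) - harm p (L ⬝ᵥ j)) -
      ∑ j ∈ Finset.Iic K, Q (K - j) * (Q (a + p • j) *
        (p * harm p (L ⬝ᵥ (a + p • j)) - harm p (L ⬝ᵥ j))) := by
    rw [dworkCoeff, ← Finset.sum_sub_distrib]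
    refine Finset.sum_congr rfl fun j _ => ?_
    ring
  rw [e1]
  refine norm_sub_le_of_le ?_ (norm_sum_le_of_le hε.le fun j _ => ?_)
  swap
  · rw [norm_mul]
    calc _ ≤ 1 * (p : ℝ)⁻¹ := mul_le_mul (hQ1 _) (norm_facQuot_mul_harm_sub_le hσ hΔ hL ha j)
          (norm_nonneg _) zero_le_one
      _ = _ := one_mul _
  -- reindexing one half by `j ↦ K - j` brings in the antisymmetric terms
  obtain ⟨r, hr⟩ := exists_mem_box (p := p) K 0
  rw [zero_add] at hr
  have e2 : ∑ j ∈ Finset.Iic K, Q (K - j) * Q (a + p • j) *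
      (harm p (L ⬝ᵥ (K - j)) - harm p (L ⬝ᵥ j)) =
      ∑ j ∈ Finset.Iic K, harm p (L ⬝ᵥ j) * dworkTerm Q a K j := by
    have h1 : ∑ j ∈ Finset.Iic K, Q (K - j) * Q (a + p • j) * harm p (L ⬝ᵥ (K - j)) =
        ∑ j ∈ Finset.Iic K, Q j * Q (a + p • (K - j)) * harm p (L ⬝ᵥ j) := by
      refine Finset.sum_nbij' (fun j => K - j) (fun j => K - j)
        (fun j _ => Finset.mem_Iic.2 tsub_le_self) (fun j _ => Finset.mem_Iic.2 tsub_le_self)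
        (fun j hj => tsub_tsub_cancel_of_le (Finset.mem_Iic.1 hj))
        (fun j hj => tsub_tsub_cancel_of_le (Finset.mem_Iic.1 hj)) fun j hj => ?_
      rw [tsub_tsub_cancel_of_le (Finset.mem_Iic.1 hj)]
    simp only [mul_sub, Finset.sum_sub_distrib]
    rw [h1, ← Finset.sum_sub_distrib]
    refine Finset.sum_congr rfl fun j hj => ?_
    rw [dworkTerm, if_pos (Finset.mem_Iic.1 hj)]
    ring
  have e3 : ∑ j ∈ Finset.Iic K, harm p (L ⬝ᵥ j) * dworkTerm Q a K j =
      ∑ j ∈ box d p r, harm p (L ⬝ᵥ j) * dworkTerm Q a K j := by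
    refine Finset.sum_subset ?_ ?_
    · intro j hj
      rw [mem_box] at *
      exact fun k => (Finset.mem_Iic.1 hj k).trans_lt (hr k)
    · intro j _ hj
      rw [dworkTerm, if_neg fun h => hj (Finset.mem_Iic.2 h), mul_zero]
  have h := norm_sum_harm_mul_dworkTerm_sub_le hσ hΔ hL ha K r 0
  simp only [smul_zero, add_zero, dotProduct_zero, harm_zero, zero_mul, sub_zero] at h
  rw [e2, e3]
  exact h

end Sufficiency

/-! ### The two sequences as one signed family -/

section Terms

variable {d q₁ q₂ : ℕ} {e : Fin q₁ → Fin d → ℕ} {f : Fin q₂ → Fin d → ℕ}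

/-- The terms of `e` and `f` as a single family. -/
def terms (e : Fin q₁ → Fin d → ℕ) (f : Fin q₂ → Fin d → ℕ) : Fin q₁ ⊕ Fin q₂ → Fin d → ℕ :=
  Sum.elim e f

/-- The exponent `1` for the terms of `e` and `-1` for those of `f`. -/
def signs (q₁ q₂ : ℕ) : Fin q₁ ⊕ Fin q₂ → ℤ := Sum.elim (fun _ => 1) fun _ => -1

theorem sum_signs_mul (hsum : ∑ i, e i = ∑ j, f j) (k : Fin d) :
    ∑ i, signs q₁ q₂ i * (terms e f i k : ℤ) = 0 := by
  have h := congrFun hsum k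
  rw [Finset.sum_apply, Finset.sum_apply] at h
  have h' : ∑ i, (e i k : ℤ) = ∑ j, (f j k : ℤ) := by exact_mod_cast h
  simp [signs, terms, h']

theorem factRatio_eq (n : Fin d → ℕ) :
    factRatio e f n = facQuot ℚ (terms e f) (signs q₁ q₂) n := by
  simp [factRatio, facQuot, terms, signs, div_eq_mul_inv]

theorem landau_eq (x : Fin d → ℝ) :
    landau e f x = ∑ i, signs q₁ q₂ i * ⌊dotReal (terms e f i) x⌋ := by
  simp [landau, terms, signs, sub_eq_add_neg]

theorem dotReal_nonneg {x : Fin d → ℝ} (hx : ∀ k, 0 ≤ x k) (c : Fin d → ℕ) : 0 ≤ dotReal c x :=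
  Finset.sum_nonneg fun k _ => mul_nonneg (Nat.cast_nonneg _) (hx k)

theorem dotReal_div (c n : Fin d → ℕ) (q : ℕ) :
    dotReal c (fun k => (n k : ℝ) / q) = ((c ⬝ᵥ n : ℕ) : ℝ) / q := by
  simp [dotReal, dotProduct, Finset.sum_div, mul_div_assoc]

theorem landau_div (n : Fin d → ℕ) (q : ℕ) :
    landau e f (fun k => (n k : ℝ) / q) = landauNat (terms e f) (signs q₁ q₂) n q := by
  rw [landau_eq, landauNat]
  refine Finset.sum_congr rfl fun i _ => ?_
  rw [dotReal_div, ← Nat.floor_div_eq_div (K := ℝ), Int.natCast_floor_eq_floor (by positivity)]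

theorem landauNat_nonneg (hsum : ∑ i, e i = ∑ j, f j)
    (h : ∀ x : Fin d → ℝ, (∀ k, 0 ≤ x k ∧ x k ≤ 1) → 0 ≤ landau e f x) (n : Fin d → ℕ) {q : ℕ}
    (hq : 0 < q) : 0 ≤ landauNat (terms e f) (signs q₁ q₂) n q := by
  rw [← landauNat_mod (sum_signs_mul hsum) n hq, ← landau_div]
  refine h _ fun k => ⟨by positivity, ?_⟩
  rw [div_le_one (by exact_mod_cast hq)]
  exact_mod_cast (Nat.mod_lt _ hq).le

theorem one_le_landauNat (hsum : ∑ i, e i = ∑ j, f j)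
    (h : ∀ x ∈ domainD e f, 1 ≤ landau e f x) (n : Fin d → ℕ) (q : ℕ) (hq : 0 < q)
    (hact : IsActive (terms e f) n q) : 1 ≤ landauNat (terms e f) (signs q₁ q₂) n q := by
  rw [← landauNat_mod (sum_signs_mul hsum) n hq, ← landau_div]
  have hq' : (0 : ℝ) < q := by exact_mod_cast hq
  refine h _ ⟨fun k => ⟨by positivity, ?_⟩, ?_⟩
  · rw [div_lt_one hq']
    exact_mod_cast Nat.mod_lt _ hq
  · obtain ⟨i, hi⟩ := hact
    rcases i with i | j
    · refine Or.inl ⟨i, ?_⟩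
      rw [dotReal_div, one_le_div hq']
      exact_mod_cast hi
    · refine Or.inr ⟨j, ?_⟩
      rw [dotReal_div, one_le_div hq']
      exact_mod_cast hi

end Terms

/-! ### Rational numbers at all primes, and at large primes -/

section LocalGlobal

/-- A rational number that is a `p`-adic integer for every `p` is an integer. -/
theorem exists_int_of_forall_norm_le {x : ℚ}
    (h : ∀ (p : ℕ) [Fact p.Prime], ‖(x : ℚ_[p])‖ ≤ 1) : ∃ a : ℤ, x = a := by
  refine ⟨x.num, ?_⟩
  suffices hd : x.den = 1 by exact ((Rat.den_eq_one_iff x).1 hd).symm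
  by_contra hne
  obtain ⟨p, hp, hdvd⟩ := Nat.exists_prime_and_dvd hne
  have : Fact p.Prime := ⟨hp⟩
  have h1 := h p
  have hden : ‖(x.den : ℚ_[p])‖ < 1 := by
    have := Padic.norm_intCast_lt_one_iff (p := p) (k := (x.den : ℤ))
    push_cast at this
    exact this.2 (by exact_mod_cast hdvd)
  have hnum : ‖(x.num : ℚ_[p])‖ = 1 := by
    refine le_antisymm (Padic.norm_int_le_one _) (not_lt.1 fun hlt => ?_)
    rw [Padic.norm_intCast_lt_one_iff] at hlt
    have := x.reduced
    have h2 : p ∣ x.num.natAbs := Int.natCast_dvd.1 hlt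
    exact hp.one_lt.ne' (Nat.dvd_one.1 (this ▸ Nat.dvd_gcd h2 hdvd))
  have hden0 : (x.den : ℚ_[p]) ≠ 0 := by exact_mod_cast x.den_ne_zero
  rw [← Rat.num_div_den x] at h1
  push_cast at h1
  rw [norm_div, hnum, div_le_one (norm_pos_iff.2 hden0)] at h1
  exact absurd h1 (not_le.2 hden)

theorem eventually_norm_rat_eq_one {x : ℚ} (hx : x ≠ 0) :
    ∀ᶠ p : ℕ in atTop, ∀ [Fact p.Prime], ‖(x : ℚ_[p])‖ = 1 := by
  filter_upwards [eventually_gt_atTop (x.num.natAbs + x.den)] with p hp _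
  have h1 : ‖(x.num : ℚ_[p])‖ = 1 := by
    refine le_antisymm (Padic.norm_int_le_one _) (not_lt.1 fun hlt => ?_)
    rw [Padic.norm_intCast_lt_one_iff] at hlt
    have := Nat.le_of_dvd (Int.natAbs_pos.2 (Rat.num_ne_zero.2 hx)) (Int.natCast_dvd.1 hlt)
    omega
  have h2 : ‖(x.den : ℚ_[p])‖ = 1 := norm_natCast_eq_one fun h => by
    have := Nat.le_of_dvd x.pos h
    omega
  rw [← Rat.num_div_den x]
  push_cast
  rw [norm_div, h1, h2, div_one]

theorem eventually_norm_rat_le_one (x : ℚ) :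
    ∀ᶠ p : ℕ in atTop, ∀ [Fact p.Prime], ‖(x : ℚ_[p])‖ ≤ 1 := by
  by_cases hx : x = 0
  · exact Eventually.of_forall fun p _ => by simp [hx]
  · filter_upwards [eventually_norm_rat_eq_one hx] with p hp _
    exact hp.le

end LocalGlobal

/-! ### Rational approximation of a real point -/

section Approximation

variable {d : ℕ}

/-- The vector of the `⌈p xₖ⌉`; divided by `p` it approximates `x` from above. -/
noncomputable def ceilVec (x : Fin d → ℝ) (p : ℕ) : Fin d → ℕ := fun k => ⌈p * x k⌉₊

/-- For large `p`, the vector `⌈p x⌉ / p` has the same integral parts `⌊c · x⌋` as `x`. -/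
theorem eventually_dotProduct_ceilVec_div {x : Fin d → ℝ} (hx : ∀ k, 0 ≤ x k) (c : Fin d → ℕ) :
    ∀ᶠ p : ℕ in atTop, c ⬝ᵥ ceilVec x p / p = ⌊dotReal c x⌋₊ := by
  set y := dotReal c x with hy
  have hδ : 0 < (⌊y⌋₊ : ℝ) + 1 - y := sub_pos.2 (Nat.lt_floor_add_one y)
  have hlim := (tendsto_natCast_atTop_atTop (R := ℝ)).eventually_gt_atTop
    ((∑ k, (c k : ℝ)) / ((⌊y⌋₊ : ℝ) + 1 - y))
  filter_upwards [hlim, eventually_gt_atTop 0] with p hp hp0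
  rw [div_lt_iff₀ hδ] at hp
  have hp0' : (0 : ℝ) < p := by exact_mod_cast hp0
  have hlow : (p : ℝ) * y ≤ ((c ⬝ᵥ ceilVec x p : ℕ) : ℝ) := by
    rw [hy, dotReal, Finset.mul_sum, dotProduct]
    push_cast
    refine Finset.sum_le_sum fun k _ => ?_
    rw [mul_left_comm]
    exact mul_le_mul_of_nonneg_left (Nat.le_ceil _) (Nat.cast_nonneg _)
  have hup : ((c ⬝ᵥ ceilVec x p : ℕ) : ℝ) ≤ p * y + ∑ k, (c k : ℝ) := by
    rw [hy, dotReal, Finset.mul_sum, dotProduct, ← Finset.sum_add_distrib]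
    push_cast
    refine Finset.sum_le_sum fun k _ => ?_
    have h1 : ((ceilVec x p k : ℕ) : ℝ) ≤ p * x k + 1 :=
      (Nat.ceil_lt_add_one (mul_nonneg hp0'.le (hx k))).le
    nlinarith [Nat.cast_nonneg (α := ℝ) (c k)]
  have hy0 : 0 ≤ y := dotReal_nonneg hx c
  refine Nat.div_eq_of_lt_le ?_ ?_
  · have : ((⌊y⌋₊ * p : ℕ) : ℝ) ≤ ((c ⬝ᵥ ceilVec x p : ℕ) : ℝ) := by
      push_cast
      refine le_trans ?_ hlow
      rw [mul_comm]
      exact mul_le_mul_of_nonneg_left (Nat.floor_le hy0) hp0'.le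
    exact_mod_cast this
  · have : ((c ⬝ᵥ ceilVec x p : ℕ) : ℝ) < (((⌊y⌋₊ + 1) * p : ℕ) : ℝ) := by
      push_cast
      nlinarith
    exact_mod_cast this

theorem eventually_ceilVec_mem_box {x : Fin d → ℝ} (hx : ∀ k, 0 ≤ x k ∧ x k < 1) :
    ∀ᶠ p : ℕ in atTop, ceilVec x p ∈ box d p 1 := by
  have h : ∀ k, ∀ᶠ p : ℕ in atTop, ceilVec x p k < p := by
    intro k
    have hδ : 0 < 1 - x k := sub_pos.2 (hx k).2
    have hlim := (tendsto_natCast_atTop_atTop (R := ℝ)).eventually_gt_atTop (1 / (1 - x k))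
    filter_upwards [hlim] with p hp
    rw [div_lt_iff₀ hδ] at hp
    have h1 : ((ceilVec x p k : ℕ) : ℝ) < p * x k + 1 :=
      Nat.ceil_lt_add_one (mul_nonneg (Nat.cast_nonneg p) (hx k).1)
    have : ((ceilVec x p k : ℕ) : ℝ) < p := by nlinarith
    exact_mod_cast this
  filter_upwards [eventually_all.2 h] with p hp
  exact mem_box_one.2 hp

theorem eventually_dotProduct_ceilVec_lt_sq {x : Fin d → ℝ} (hx : ∀ k, 0 ≤ x k)
    (c : Fin d → ℕ) : ∀ᶠ p : ℕ in atTop, c ⬝ᵥ ceilVec x p < p ^ 2 := by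
  filter_upwards [eventually_dotProduct_ceilVec_div hx c, eventually_gt_atTop ⌊dotReal c x⌋₊]
    with p h1 h2
  rw [← h1] at h2
  rw [pow_two]
  exact (Nat.div_lt_iff_lt_mul (by omega)).1 h2

variable {q₁ q₂ : ℕ} {e : Fin q₁ → Fin d → ℕ} {f : Fin q₂ → Fin d → ℕ}

theorem landau_eq_sum_floor {x : Fin d → ℝ} (hx : ∀ k, 0 ≤ x k) :
    landau e f x = ∑ i, signs q₁ q₂ i * (⌊dotReal (terms e f i) x⌋₊ : ℤ) := by
  rw [landau_eq]
  refine Finset.sum_congr rfl fun i _ => ?_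
  rw [Int.natCast_floor_eq_floor (dotReal_nonneg hx _)]

/-- For large `p`, only the first term of Legendre's formula contributes to `v_p(𝒬(⌈p x⌉))`. -/
theorem eventually_norm_facQuot_ceilVec {x : Fin d → ℝ} (hx : ∀ k, 0 ≤ x k) :
    ∀ᶠ p : ℕ in atTop, ∀ [Fact p.Prime],
      ‖facQuot ℚ_[p] (terms e f) (signs q₁ q₂) (ceilVec x p)‖ = (p : ℝ)⁻¹ ^ landau e f x := by
  filter_upwards [eventually_all.2 fun i => eventually_dotProduct_ceilVec_div hx (terms e f i),
    eventually_all.2 fun i => eventually_dotProduct_ceilVec_lt_sq hx (terms e f i)] with p h1 h2 _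
  rw [norm_facQuot h2, show Finset.Icc 1 2 = {1, 2} from rfl, Finset.sum_pair (by decide), pow_one,
    landauNat_eq_zero_of_lt h2, add_zero, landau_eq_sum_floor hx, landauNat]
  simp only [h1]

end Approximation

/-! ### Landau's criterion -/

section Landau

variable {d q₁ q₂ : ℕ} {e : Fin q₁ → Fin d → ℕ} {f : Fin q₂ → Fin d → ℕ}

theorem factRatio_cast (p : ℕ) [Fact p.Prime] (n : Fin d → ℕ) :
    ((factRatio e f n : ℚ) : ℚ_[p]) = facQuot ℚ_[p] (terms e f) (signs q₁ q₂) n := by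
  rw [factRatio_eq]
  exact map_facQuot (Rat.castHom ℚ_[p]) n

theorem IsIntegralFamily.norm_le (h : IsIntegralFamily e f) (p : ℕ) [Fact p.Prime]
    (n : Fin d → ℕ) : ‖facQuot ℚ_[p] (terms e f) (signs q₁ q₂) n‖ ≤ 1 := by
  obtain ⟨a, ha⟩ := h n
  rw [← factRatio_cast, ha]
  simpa using Padic.norm_int_le_one a

/-- **Landau's criterion** for the integrality of factorial quotients. -/
theorem isIntegralFamily_iff (hsum : ∑ i, e i = ∑ j, f j) : IsIntegralFamily e f ↔
    ∀ x : Fin d → ℝ, (∀ k, 0 ≤ x k ∧ x k ≤ 1) → 0 ≤ landau e f x := by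
  constructor
  · intro h x hx
    by_contra hneg
    push Not at hneg
    obtain ⟨N, hN⟩ := eventually_atTop.1
      (eventually_norm_facQuot_ceilVec (e := e) (f := f) fun k => (hx k).1)
    obtain ⟨p, hpN, hp⟩ := Nat.exists_infinite_primes N
    have : Fact p.Prime := ⟨hp⟩
    have h1 := h.norm_le p (ceilVec x p)
    rw [hN p hpN, inv_zpow, ← zpow_neg] at h1
    exact absurd h1 (not_le.2 (one_lt_zpow₀ (by exact_mod_cast hp.one_lt) (by omega)))
  · intro h n
    refine exists_int_of_forall_norm_le fun p _ => ?_
    rw [factRatio_cast]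
    obtain ⟨b, hb⟩ := exists_dotProduct_lt (p := p) (terms e f) n
    rw [norm_facQuot hb]
    obtain ⟨m, hm⟩ := Int.eq_ofNat_of_zero_le (Finset.sum_nonneg fun l (_ : l ∈ Finset.Icc 1 b) =>
      landauNat_nonneg hsum h n (pow_pos (Fact.out : p.Prime).pos l))
    rw [hm, zpow_natCast]
    exact pow_le_one₀ p_inv_pos.le p_inv_le_one

end Landau

/-! ### Mirror-type maps over `ℚ_p` -/

section Transfer

variable {d q₁ q₂ : ℕ} {e : Fin q₁ → Fin d → ℕ} {f : Fin q₂ → Fin d → ℕ}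
variable (p : ℕ) [hp : Fact p.Prime]

theorem map_fexp_div (B : (Fin d → ℕ) → ℚ) (hB : B 0 = 0) :
    MvPowerSeries.map (Rat.castHom ℚ_[p])
      (expSeries ((seriesOf fun n => factRatio e f n * B n) * (seriesF e f)⁻¹)) =
    fexp (seriesOf (fun n => facQuot ℚ_[p] (terms e f) (signs q₁ q₂) n * ((B n : ℚ) : ℚ_[p])) *
      (seriesOf (facQuot ℚ_[p] (terms e f) (signs q₁ q₂)))⁻¹) := by
  have hG : constantCoeff (seriesOf fun n => factRatio e f n * B n) = 0 := by
    change factRatio e f 0 * B 0 = 0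
    rw [hB, mul_zero]
  have hF : constantCoeff (seriesF e f) = 1 := by
    change factRatio e f 0 = 1
    rw [factRatio_eq, facQuot_zero]
  have hmF : MvPowerSeries.map (Rat.castHom ℚ_[p]) (seriesF e f) =
      seriesOf (facQuot ℚ_[p] (terms e f) (signs q₁ q₂)) := by
    ext n
    rw [coeff_map]
    exact factRatio_cast p n
  have hmG : MvPowerSeries.map (Rat.castHom ℚ_[p]) (seriesOf fun n => factRatio e f n * B n) =
      seriesOf fun n => facQuot ℚ_[p] (terms e f) (signs q₁ q₂) n * ((B n : ℚ) : ℚ_[p]) := by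
    ext n
    rw [coeff_map, coeff_seriesOf, coeff_seriesOf, map_mul]
    congr 1
    exact factRatio_cast p n
  have hinv : MvPowerSeries.map (Rat.castHom ℚ_[p]) (seriesF e f)⁻¹ =
      (seriesOf (facQuot ℚ_[p] (terms e f) (signs q₁ q₂)))⁻¹ := by
    symm
    rw [MvPowerSeries.inv_eq_iff_mul_eq_one, ← hmF, ← map_mul, mul_comm,
      MvPowerSeries.mul_inv_cancel _ (by rw [hF]; exact one_ne_zero), map_one]
    change facQuot ℚ_[p] (terms e f) (signs q₁ q₂) 0 ≠ 0
    exact facQuot_ne_zero _ _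
  change MvPowerSeries.map (Rat.castHom ℚ_[p]) (fexp _) = _
  rw [map_fexp _ (by rw [map_mul, hG, zero_mul]), map_mul, hmG, hinv]

/-- The Dieudonné–Dwork criterion for `exp(G / F)` with `G = ∑ 𝒬(n) B(n) z^n`. -/
theorem hasPadicIntCoeffs_iff (h : IsIntegralFamily e f) (B : (Fin d → ℕ) → ℚ) (hB : B 0 = 0) :
    HasPadicIntCoeffs p (expSeries ((seriesOf fun n => factRatio e f n * B n) *
      (seriesF e f)⁻¹)) ↔
      ∀ a ∈ box d p 1, ∀ K, ‖dworkCoeff (facQuot ℚ_[p] (terms e f) (signs q₁ q₂))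
        (fun n => ((B n : ℚ) : ℚ_[p])) a K‖ ≤ (p : ℝ)⁻¹ := by
  rw [← integral_fexp_iff_dworkCoeff (h.norm_le p) (facQuot_zero _) (by simp [hB]),
    integral_iff_exists, ← map_fexp_div p B hB]
  rfl

/-- A power series with rational coefficients is integral if it is so at every prime. -/
theorem hasIntCoeffs_of_forall {g : MvPowerSeries (Fin d) ℚ}
    (h : ∀ (p : ℕ) [Fact p.Prime], HasPadicIntCoeffs p g) : HasIntCoeffs g := by
  have : ∀ n, ∃ a : ℤ, coeff n g = a := fun n => exists_int_of_forall_norm_le fun p _ => by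
    have h1 := integral_iff_exists.2 (h p) n
    rwa [coeff_map] at h1
  choose a ha using this
  let b : MvPowerSeries (Fin d) ℤ := a
  refine ⟨b, ?_⟩
  ext n
  rw [coeff_map, ha]
  rfl

theorem exists_le_terms {L : Fin d → ℕ} (hL : L ∈ setE e f) : ∃ i, L ≤ terms e f i := by
  rcases hL.2 with ⟨i, hi⟩ | ⟨j, hj⟩
  · exact ⟨Sum.inl i, hi⟩
  · exact ⟨Sum.inr j, hj⟩

theorem hasIntCoeffs_mirrorType (hsum : ∑ i, e i = ∑ j, f j) (h : IsIntegralFamily e f)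
    (hD : ∀ x ∈ domainD e f, 1 ≤ landau e f x) {L : Fin d → ℕ} (hL : L ∈ setE e f) :
    HasIntCoeffs (mirrorType L e f) := by
  obtain ⟨i, hi⟩ := exists_le_terms hL
  refine hasIntCoeffs_of_forall fun p _ => ?_
  refine (hasPadicIntCoeffs_iff p h (fun n => harmonic (L ⬝ᵥ n)) (by simp)).2 fun a ha K => ?_
  exact norm_dworkCoeff_le (sum_signs_mul hsum) (one_le_landauNat hsum hD) hi ha K

end Transfer

/-! ### Harmonic sums and the jumps of a step function -/

section AbelSummation

/-- If weights `w` placed at positive points `γ < b` have nonnegative partial sums, then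
`∑ w / γ ≥ (∑ w) / b`, and the inequality is strict as soon as one partial sum is positive. -/
theorem sum_div_le_sum_div {κ : Type*} (J : Finset κ) (γ w : κ → ℝ) (b : ℝ)
    (hγ : ∀ j ∈ J, 0 < γ j ∧ γ j < b) (hw : ∀ t, 0 ≤ ∑ j ∈ J with γ j ≤ t, w j) :
    (∑ j ∈ J, w j) / b ≤ ∑ j ∈ J, w j / γ j ∧
      ((∃ t, 0 < ∑ j ∈ J with γ j ≤ t, w j) → (∑ j ∈ J, w j) / b < ∑ j ∈ J, w j / γ j) := by
  induction J using Finset.strongInduction generalizing b with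
  | H J ih =>
  rcases J.eq_empty_or_nonempty with rfl | hne
  · simp
  obtain ⟨j₁, hj₁, hmax⟩ := J.exists_max_image γ hne
  obtain ⟨hM0, hMb⟩ := hγ j₁ hj₁
  set M := γ j₁ with hM
  let J' := J.filter fun j => γ j < M
  have hJ' : J' ⊂ J := by
    refine Finset.filter_ssubset.2 ⟨j₁, hj₁, lt_irrefl _⟩
  have hsub : ∀ j ∈ J', j ∈ J ∧ γ j < M := fun j hj => Finset.mem_filter.1 hj
  have htot : ∀ t, M ≤ t → (∑ j ∈ J with γ j ≤ t, w j) = ∑ j ∈ J, w j := fun t ht => by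
    rw [Finset.filter_true_of_mem fun j hj => (hmax j hj).trans ht]
  have hw' : ∀ t, 0 ≤ ∑ j ∈ J' with γ j ≤ t, w j := by
    intro t
    rcases J'.eq_empty_or_nonempty with h0 | hne'
    · rw [h0]
      simp
    · obtain ⟨j₂, hj₂, hmax'⟩ := J'.exists_max_image γ hne'
      have : J'.filter (fun j => γ j ≤ t) = J.filter fun j => γ j ≤ min t (γ j₂) := by
        ext j
        simp only [Finset.mem_filter, J', le_min_iff]
        constructor
        · rintro ⟨⟨h1, h2⟩, h3⟩
          exact ⟨h1, h3, hmax' j (Finset.mem_filter.2 ⟨h1, h2⟩)⟩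
        · rintro ⟨h1, h2, h3⟩
          exact ⟨⟨h1, h3.trans_lt (hsub j₂ hj₂).2⟩, h2⟩
      rw [this]
      exact hw _
  obtain ⟨ih1, ih2⟩ := ih J' hJ' M (fun j hj => ⟨(hγ j (hsub j hj).1).1, (hsub j hj).2⟩) hw'
  have hsplit : ∑ j ∈ J, w j / γ j = ∑ j ∈ J', w j / γ j + (∑ j ∈ J, w j - ∑ j ∈ J', w j) / M := by
    rw [← Finset.sum_filter_add_sum_filter_not J (fun j => γ j < M) (fun j => w j / γ j),
      ← Finset.sum_filter_add_sum_filter_not J (fun j => γ j < M) w, add_sub_cancel_left,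
      Finset.sum_div]
    congr 1
    refine Finset.sum_congr rfl fun j hj => ?_
    rw [Finset.mem_filter, not_lt] at hj
    rw [le_antisymm (hmax j hj.1) hj.2]
  have hS : 0 ≤ ∑ j ∈ J, w j := by
    have := hw M
    rwa [htot M le_rfl] at this
  have hcmp : (∑ j ∈ J, w j) / b ≤ (∑ j ∈ J, w j) / M := div_le_div_of_nonneg_left hS hM0 hMb.le
  rw [hsplit, sub_div]
  refine ⟨by linarith, ?_⟩
  rintro ⟨t, ht⟩
  rcases lt_or_ge t M with htM | htM
  · have : J.filter (fun j => γ j ≤ t) = J'.filter fun j => γ j ≤ t := by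
      ext j
      simp only [Finset.mem_filter, J']
      exact ⟨fun h => ⟨⟨h.1, h.2.trans_lt htM⟩, h.2⟩, fun h => ⟨h.1.1, h.2⟩⟩
    rw [this] at ht
    have := ih2 ⟨t, ht⟩
    linarith
  · rw [htot t htM] at ht
    have := div_lt_div_of_pos_left ht hM0 hMb
    linarith

theorem filter_div_le_eq_range {y : ℝ} (t : ℝ) :
    ((Finset.range ⌊y⌋₊).filter fun r : ℕ => ((r : ℝ) + 1) / y ≤ t) =
      Finset.range ⌊max 0 (min t 1) * y⌋₊ := by
  ext r
  have hr : (0 : ℝ) < (r : ℝ) + 1 := by positivity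
  simp only [Finset.mem_filter, Finset.mem_range, ← Nat.succ_le_iff]
  rw [Nat.le_floor_iff' (Nat.succ_ne_zero r), Nat.le_floor_iff' (Nat.succ_ne_zero r)]
  push_cast
  constructor
  · rintro ⟨h1, h2⟩
    have hy : 0 < y := hr.trans_le h1
    rw [div_le_iff₀ hy] at h2
    refine le_trans ?_ (mul_le_mul_of_nonneg_right (le_max_right 0 (min t 1)) hy.le)
    rcases min_cases t 1 with h | h <;> rw [h.1] <;> linarith
  · intro h
    have hpos : 0 < max 0 (min t 1) * y := hr.trans_le h
    have hm0 : 0 ≤ max 0 (min t 1) := le_max_left _ _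
    have hy : 0 < y := pos_of_mul_pos_right hpos hm0
    have hm : 0 < max 0 (min t 1) := pos_of_mul_pos_left hpos hy.le
    have hmin : 0 < min t 1 := by
      rcases lt_max_iff.1 hm with h' | h'
      · exact absurd h' (lt_irrefl _)
      · exact h'
    rw [max_eq_right hmin.le] at h
    refine ⟨h.trans ?_, ?_⟩
    · nlinarith [min_le_right t 1]
    · rw [div_le_iff₀ hy]
      exact h.trans (mul_le_mul_of_nonneg_right (min_le_left _ _) hy.le)

/-- If `∑ σᵢ ⌊t yᵢ⌋` is nonnegative on `[0, 1]` and somewhere positive, then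
`∑ σᵢ yᵢ H_{⌊yᵢ⌋}` is positive: the points `r / yᵢ` are the jumps of this step function. -/
theorem sum_mul_harmonic_pos {ι : Type*} [Fintype ι] {σ : ι → ℤ} {y : ι → ℝ}
    (hφ : ∀ t : ℝ, 0 ≤ t → t ≤ 1 → 0 ≤ ∑ i, σ i * (⌊t * y i⌋₊ : ℤ))
    (hpos : ∃ t : ℝ, 0 ≤ t ∧ t ≤ 1 ∧ 0 < ∑ i, σ i * (⌊t * y i⌋₊ : ℤ)) :
    0 < ∑ i, (σ i : ℝ) * (y i * ((harmonic ⌊y i⌋₊ : ℚ) : ℝ)) := by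
  let J : Finset (Σ _ : ι, ℕ) := Finset.univ.sigma fun i => Finset.range ⌊y i⌋₊
  let γ : (Σ _ : ι, ℕ) → ℝ := fun z => ((z.2 : ℝ) + 1) / y z.1
  let w : (Σ _ : ι, ℕ) → ℝ := fun z => σ z.1
  have hpart : ∀ t, ∑ z ∈ J with γ z ≤ t, w z =
      ((∑ i, σ i * (⌊max 0 (min t 1) * y i⌋₊ : ℤ) : ℤ) : ℝ) := by
    intro t
    rw [Finset.sum_filter, Finset.sum_sigma]
    push_cast
    refine Finset.sum_congr rfl fun i _ => ?_
    rw [← Finset.sum_filter]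
    simp only [γ, w]
    rw [filter_div_le_eq_range, Finset.sum_const, Finset.card_range, nsmul_eq_mul, mul_comm]
  have hnn : ∀ t, 0 ≤ ∑ z ∈ J with γ z ≤ t, w z := fun t => by
    rw [hpart]
    exact_mod_cast hφ _ (le_max_left _ _) (max_le zero_le_one (min_le_right _ _))
  have hrange : ∀ z ∈ J, 0 < γ z ∧ γ z < 2 := by
    rintro ⟨i, r⟩ hz
    simp only [J, Finset.mem_sigma, Finset.mem_univ, true_and, Finset.mem_range,
      ← Nat.succ_le_iff] at hz
    rw [Nat.le_floor_iff' (Nat.succ_ne_zero r)] at hz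
    push_cast at hz
    have hy : 0 < y i := lt_of_lt_of_le (by positivity) hz
    refine ⟨div_pos (by positivity) hy, ?_⟩
    rw [div_lt_iff₀ hy]
    linarith
  have h := (sum_div_le_sum_div J γ w 2 hrange hnn).2 (by
    obtain ⟨t, h0, h1, ht⟩ := hpos
    refine ⟨t, ?_⟩
    rw [hpart, min_eq_left h1, max_eq_right h0]
    exact_mod_cast ht)
  have hall : 0 ≤ ∑ z ∈ J, w z := by
    have := hnn 2
    rwa [Finset.filter_true_of_mem fun z hz => (hrange z hz).2.le] at this
  have hsum : ∑ z ∈ J, w z / γ z = ∑ i, (σ i : ℝ) * (y i * ((harmonic ⌊y i⌋₊ : ℚ) : ℝ)) := by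
    rw [Finset.sum_sigma]
    refine Finset.sum_congr rfl fun i _ => ?_
    rw [harmonic]
    push_cast
    rw [Finset.mul_sum, Finset.mul_sum]
    refine Finset.sum_congr rfl fun r _ => ?_
    simp only [w, γ]
    rw [div_div_eq_mul_div, mul_div_assoc, div_eq_mul_inv (y i)]
  rw [← hsum]
  exact lt_of_le_of_lt (by positivity) h

end AbelSummation

/-! ### Generic zeros of Landau's function -/

section Genericity

variable {d q₁ q₂ : ℕ} {e : Fin q₁ → Fin d → ℕ} {f : Fin q₂ → Fin d → ℕ}

theorem dotReal_mono (c : Fin d → ℕ) {x x' : Fin d → ℝ} (h : ∀ k, x k ≤ x' k) :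
    dotReal c x ≤ dotReal c x' :=
  Finset.sum_le_sum fun k _ => mul_le_mul_of_nonneg_left (h k) (Nat.cast_nonneg _)

theorem dotReal_smul (c : Fin d → ℕ) (t : ℝ) (x : Fin d → ℝ) :
    dotReal c (fun k => t * x k) = t * dotReal c x := by
  rw [dotReal, dotReal, Finset.mul_sum]
  exact Finset.sum_congr rfl fun k _ => by ring

/-- The perturbation of `x` along the moment curve. -/
def perturb (x : Fin d → ℝ) (ε : ℝ) : Fin d → ℝ := fun k => x k + ε ^ ((k : ℕ) + 1)

theorem tendsto_perturb (x : Fin d → ℝ) (k : Fin d) :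
    Tendsto (fun ε => perturb x ε k) (𝓝[>] 0) (𝓝 (x k)) := by
  have : Continuous fun ε => perturb x ε k := by unfold perturb; fun_prop
  have h := this.tendsto 0
  simp only [perturb, ne_eq, Nat.add_eq_zero_iff, one_ne_zero, and_false, not_false_eq_true,
    zero_pow, add_zero] at h
  exact h.mono_left nhdsWithin_le_nhds

theorem eventually_floor_perturb (x : Fin d → ℝ) (c : Fin d → ℕ) :
    ∀ᶠ ε in 𝓝[>] (0 : ℝ), ⌊dotReal c (perturb x ε)⌋ = ⌊dotReal c x⌋ := by
  have hlim : Tendsto (fun ε => dotReal c (perturb x ε)) (𝓝[>] 0) (𝓝 (dotReal c x)) :=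
    tendsto_finsetSum _ fun k _ => (tendsto_perturb x k).const_mul _
  filter_upwards [hlim.eventually_lt_const (Int.lt_floor_add_one (dotReal c x)),
    self_mem_nhdsWithin] with ε h1 h2
  have h2' : (0 : ℝ) < ε := h2
  rw [Int.floor_eq_iff]
  refine ⟨(Int.floor_le _).trans (dotReal_mono c fun k => ?_), h1⟩
  exact le_add_of_nonneg_right (pow_nonneg h2'.le _)

theorem eventually_dotReal_perturb_ne (x : Fin d → ℝ) {c c' : Fin d → ℕ} (h : c ≠ c') :
    ∀ᶠ ε in 𝓝[>] (0 : ℝ), dotReal c (perturb x ε) ≠ dotReal c' (perturb x ε) := by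
  let P : Polynomial ℝ := Polynomial.C (dotReal c x - dotReal c' x) +
    ∑ k : Fin d, Polynomial.C ((c k : ℝ) - c' k) * Polynomial.X ^ ((k : ℕ) + 1)
  have hP : P ≠ 0 := by
    obtain ⟨k, hk⟩ := Function.ne_iff.1 h
    intro h0
    have h1 := congrArg (fun Q => Polynomial.coeff Q ((k : ℕ) + 1)) h0
    simp only [P, Polynomial.coeff_add, Polynomial.coeff_C_succ, Polynomial.finsetSum_coeff,
      Polynomial.coeff_C_mul, Polynomial.coeff_X_pow, Polynomial.coeff_zero, zero_add,
      add_left_inj] at h1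
    rw [Finset.sum_eq_single k] at h1
    · rw [if_pos rfl, mul_one, sub_eq_zero] at h1
      exact hk (by exact_mod_cast h1)
    · intro b _ hb
      rw [if_neg fun h' => hb (Fin.ext h'.symm), mul_zero]
    · simp
  have heval : ∀ ε, P.eval ε = dotReal c (perturb x ε) - dotReal c' (perturb x ε) := by
    intro ε
    simp only [P, Polynomial.eval_add, Polynomial.eval_C, Polynomial.eval_finsetSum,
      Polynomial.eval_mul, Polynomial.eval_pow, Polynomial.eval_X, dotReal, perturb]
    rw [← Finset.sum_sub_distrib, ← Finset.sum_add_distrib, ← Finset.sum_sub_distrib]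
    exact Finset.sum_congr rfl fun k _ => by ring
  have hfin : ({ε | P.IsRoot ε} \ {0}).Finite := (Polynomial.finite_setOfPred_isRoot hP).subset
    Set.sdiff_subset
  have hnhds := hfin.isClosed.isOpen_compl.mem_nhds (x := (0 : ℝ)) (by simp)
  filter_upwards [mem_nhdsWithin_of_mem_nhds hnhds, self_mem_nhdsWithin] with ε h1 h2 h3
  have h2' : (0 : ℝ) < ε := h2
  exact h1 ⟨by rw [Set.mem_ofPred_eq, Polynomial.IsRoot, heval, h3, sub_self], h2'.ne'⟩

/-- A zero of Landau's function in `𝒟` can be moved so that no term of `e` and term of `f` take the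
same value there. -/
theorem exists_generic_zero (hdisj : ∀ i j, e i ≠ f j) {x : Fin d → ℝ} (hx : x ∈ domainD e f)
    (h0 : landau e f x = 0) : ∃ x' ∈ domainD e f, landau e f x' = 0 ∧
      ∀ i j, dotReal (e i) x' ≠ dotReal (f j) x' := by
  have h1 : ∀ᶠ ε in 𝓝[>] (0 : ℝ), ∀ k, perturb x ε k < 1 :=
    eventually_all.2 fun k => (tendsto_perturb x k).eventually_lt_const (hx.1 k).2
  have h2 : ∀ᶠ ε in 𝓝[>] (0 : ℝ), ∀ i,
      ⌊dotReal (terms e f i) (perturb x ε)⌋ = ⌊dotReal (terms e f i) x⌋ :=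
    eventually_all.2 fun i => eventually_floor_perturb x _
  have h3 : ∀ᶠ ε in 𝓝[>] (0 : ℝ), ∀ i j,
      dotReal (e i) (perturb x ε) ≠ dotReal (f j) (perturb x ε) :=
    eventually_all.2 fun i => eventually_all.2 fun j => eventually_dotReal_perturb_ne x (hdisj i j)
  obtain ⟨ε, h1, h2, h3, hε⟩ := (h1.and (h2.and (h3.and self_mem_nhdsWithin))).exists
  have hε' : (0 : ℝ) < ε := hε
  have hle : ∀ k, x k ≤ perturb x ε k := fun k =>
    le_add_of_nonneg_right (pow_nonneg hε'.le _)
  refine ⟨perturb x ε, ⟨fun k => ⟨(hx.1 k).1.trans (hle k), h1 k⟩, ?_⟩, ?_, h3⟩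
  · exact hx.2.imp (fun ⟨i, hi⟩ => ⟨i, hi.trans (dotReal_mono _ hle)⟩)
      fun ⟨j, hj⟩ => ⟨j, hj.trans (dotReal_mono _ hle)⟩
  · rw [landau_eq] at h0 ⊢
    simp only [h2, h0]

/-- At a generic zero of Landau's function the coordinate sums `∑ ± c^{(k)} H_{⌊c · x⌋}` do not
all vanish. -/
theorem exists_sum_harmonic_ne_zero
    (hΔ : ∀ x : Fin d → ℝ, (∀ k, 0 ≤ x k ∧ x k ≤ 1) → 0 ≤ landau e f x) {x : Fin d → ℝ}
    (hx : x ∈ domainD e f) (hgen : ∀ i j, dotReal (e i) x ≠ dotReal (f j) x) :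
    ∃ k, ∑ i, (signs q₁ q₂ i : ℚ) * (terms e f i k * harmonic ⌊dotReal (terms e f i) x⌋₊) ≠ 0 := by
  set y : Fin q₁ ⊕ Fin q₂ → ℝ := fun i => dotReal (terms e f i) x with hy
  have hx0 : ∀ k, 0 ≤ x k := fun k => (hx.1 k).1
  have hy0 : ∀ i, 0 ≤ y i := fun i => dotReal_nonneg hx0 _
  have hφ : ∀ t : ℝ, 0 ≤ t → t ≤ 1 → 0 ≤ ∑ i, signs q₁ q₂ i * (⌊t * y i⌋₊ : ℤ) := by
    intro t h0 h1
    have h2 := hΔ (fun k => t * x k) fun k => ⟨mul_nonneg h0 (hx0 k),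
      mul_le_one₀ h1 (hx0 k) (hx.1 k).2.le⟩
    rw [landau_eq_sum_floor fun k => mul_nonneg h0 (hx0 k)] at h2
    simpa only [dotReal_smul] using h2
  have hone : ∃ i, 1 ≤ y i := by
    rcases hx.2 with ⟨i, hi⟩ | ⟨j, hj⟩
    · exact ⟨Sum.inl i, hi⟩
    · exact ⟨Sum.inr j, hj⟩
  obtain ⟨i₁, hi₁⟩ := hone
  obtain ⟨m, -, hm⟩ := Finset.univ.exists_max_image y ⟨i₁, Finset.mem_univ _⟩
  have hY1 : 1 ≤ y m := hi₁.trans (hm i₁ (Finset.mem_univ _))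
  have hY0 : 0 < y m := zero_lt_one.trans_le hY1
  -- the first jump of Landau's function along the ray through `x` is at `x / y m`
  have hjump : ∀ i, ⌊1 / y m * y i⌋₊ = if y i = y m then 1 else 0 := by
    intro i
    rw [one_div_mul_eq_div]
    split_ifs with h
    · rw [h, div_self hY0.ne', Nat.floor_one]
    · rw [Nat.floor_eq_zero, div_lt_one hY0]
      exact lt_of_le_of_ne (hm i (Finset.mem_univ _)) h
  have ht0 : 0 ≤ 1 / y m := by positivity
  have ht1 : 1 / y m ≤ 1 := (div_le_one hY0).2 hY1
  have hpos : 0 < ∑ i, signs q₁ q₂ i * (⌊1 / y m * y i⌋₊ : ℤ) := by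
    have hnn := hφ _ ht0 ht1
    simp only [hjump] at hnn ⊢
    rw [Fintype.sum_sum_type] at hnn ⊢
    simp only [signs, Sum.elim_inl, Sum.elim_inr] at hnn ⊢
    rcases m with i₀ | j₀
    · have hz : ∑ j : Fin q₂, (-1 : ℤ) *
          ((if y (Sum.inr j) = y (Sum.inl i₀) then 1 else 0 : ℕ) : ℤ) = 0 :=
        Finset.sum_eq_zero fun j _ => by
          rw [if_neg fun h => hgen i₀ j h.symm]
          simp
      rw [hz, add_zero]
      refine Finset.sum_pos' (fun i _ => by positivity) ⟨i₀, Finset.mem_univ _, by simp⟩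
    · exfalso
      have hz : ∑ i : Fin q₁, (1 : ℤ) *
          ((if y (Sum.inl i) = y (Sum.inr j₀) then 1 else 0 : ℕ) : ℤ) = 0 :=
        Finset.sum_eq_zero fun i _ => by
          have h : ¬ y (Sum.inl i) = y (Sum.inr j₀) := hgen i j₀
          rw [if_neg h]
          simp
      have hneg : ∑ j : Fin q₂, (-1 : ℤ) *
          ((if y (Sum.inr j) = y (Sum.inr j₀) then 1 else 0 : ℕ) : ℤ) < 0 :=
        Finset.sum_neg' (fun j _ => by split_ifs <;> simp) ⟨j₀, Finset.mem_univ _, by simp⟩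
      omega
  have hmain := sum_mul_harmonic_pos hφ ⟨_, ht0, ht1, hpos⟩
  by_contra! hall
  refine hmain.ne' ?_
  have hswap : ∑ i, (signs q₁ q₂ i : ℝ) * (y i * ((harmonic ⌊y i⌋₊ : ℚ) : ℝ)) =
      ∑ k, x k * ((∑ i, (signs q₁ q₂ i : ℚ) * (terms e f i k * harmonic ⌊y i⌋₊) : ℚ) : ℝ) := by
    push_cast
    simp only [Finset.mul_sum]
    rw [Finset.sum_comm]
    refine Finset.sum_congr rfl fun i _ => ?_
    have hyi : y i = ∑ k, (terms e f i k : ℝ) * x k := rfl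
    have hexp : ∀ h : ℝ, (signs q₁ q₂ i : ℝ) * (y i * h) =
        ∑ k, (signs q₁ q₂ i : ℝ) * ((terms e f i k : ℝ) * x k * h) := fun h => by
      rw [hyi, Finset.sum_mul, Finset.mul_sum]
    rw [hexp]
    exact Finset.sum_congr rfl fun k _ => by ring
  rw [hswap]
  refine Finset.sum_eq_zero fun k _ => ?_
  rw [hall k]
  simp

end Genericity

/-! ### The growth factor -/

section Growth

variable {d : ℕ} {ι : Type*} [Fintype ι] {c : ι → Fin d → ℕ} {σ : ι → ℤ} {t : ι → ℕ}

/-- The factor `∏ᵢ (∏_{r = 1}^{tᵢ} (cᵢ · n + r) / r)^(σᵢ)` that governs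
`𝒬(a + pn) / (𝒬(a) 𝒬(n))` modulo `p` when `⌊cᵢ · a / p⌋ = tᵢ`. -/
def growth (c : ι → Fin d → ℕ) (σ : ι → ℤ) (t : ι → ℕ) (n : Fin d → ℕ) : ℚ :=
  ∏ i, (((c i ⬝ᵥ n + 1).ascFactorial (t i) : ℚ) / ((1 : ℕ).ascFactorial (t i) : ℚ)) ^ σ i

theorem growth_zero : growth c σ t 0 = 1 :=
  Finset.prod_eq_one fun i _ => by
    rw [dotProduct_zero, zero_add, div_self, one_zpow]
    exact_mod_cast (Nat.ascFactorial_pos 0 (t i)).ne'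

variable {p : ℕ} [hp : Fact p.Prime]

/-- `𝒬(a + pn) / (𝒬(a) 𝒬(n))` is congruent to `growth n`. -/
theorem exists_facQuot_eq_growth (hσ : ∀ k, ∑ i, σ i * (c i k : ℤ) = 0) {a : Fin d → ℕ}
    (ha : ∀ i, c i ⬝ᵥ a / p = t i) (n : Fin d → ℕ) :
    ∃ η : ℚ_[p], ‖η - 1‖ ≤ (p : ℝ)⁻¹ ∧ facQuot ℚ_[p] c σ (a + p • n) =
      facQuot ℚ_[p] c σ a * (facQuot ℚ_[p] c σ n * (η * ((growth c σ t n : ℚ) : ℚ_[p]))) := by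
  obtain ⟨η, hη, h⟩ := exists_facQuot_ratio (p := p) hσ a 0 n 0
  rw [zero_add, pow_one] at hη
  refine ⟨η, hη, ?_⟩
  simp only [smul_zero, add_zero, zero_add, pow_one, pow_zero, one_smul, dotProduct_zero,
    one_mul, facQuot_zero, div_one, ha] at h
  rw [div_eq_iff (facQuot_ne_zero _ _), mul_comm] at h
  rw [h, growth]
  push_cast
  rfl

theorem coeff_one_prod_of_coeff_zero_eq_one {κ : Type*} (s : Finset κ) (P : κ → Polynomial ℚ)
    (h : ∀ i, (P i).coeff 0 = 1) :
    (∏ i ∈ s, P i).coeff 0 = 1 ∧ (∏ i ∈ s, P i).coeff 1 = ∑ i ∈ s, (P i).coeff 1 := by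
  classical
  induction s using Finset.induction_on with
  | empty => simp [Polynomial.coeff_one]
  | insert a s ha ih =>
    rw [Finset.prod_insert ha, Finset.sum_insert ha, Polynomial.mul_coeff_zero,
      Polynomial.mul_coeff_one, ih.1, ih.2, h a]
    exact ⟨one_mul 1, by ring⟩

variable {q₁ q₂ : ℕ} {e : Fin q₁ → Fin d → ℕ} {f : Fin q₂ → Fin d → ℕ}
  {t : Fin q₁ ⊕ Fin q₂ → ℕ}

/-- Along the `k`-th axis the growth factor is a rational function of `T` whose logarithmic
derivative at `0` is `∑ ± c^{(k)} H_t`; if this is nonzero, the growth factor is not constant. -/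
theorem exists_growth_ne_one {k : Fin d}
    (hne : ∑ i, (signs q₁ q₂ i : ℚ) * (terms e f i k * harmonic (t i)) ≠ 0) :
    ∃ T : ℕ, growth (terms e f) (signs q₁ q₂) t (Pi.single k T) ≠ 1 := by
  by_contra! hall
  apply hne
  let ℓ : Fin q₁ ⊕ Fin q₂ → ℕ → Polynomial ℚ := fun i r =>
    1 + Polynomial.C ((terms e f i k : ℚ) * ((r : ℚ) + 1)⁻¹) * Polynomial.X
  let P : Fin q₁ ⊕ Fin q₂ → Polynomial ℚ := fun i => ∏ r ∈ Finset.range (t i), ℓ i r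
  have hl0 : ∀ i r, (ℓ i r).coeff 0 = 1 := fun i r => by simp [ℓ]
  have hl1 : ∀ i r, (ℓ i r).coeff 1 = (terms e f i k : ℚ) * ((r : ℚ) + 1)⁻¹ := fun i r => by
    simp [ℓ, Polynomial.coeff_one]
  have hP0 : ∀ i, (P i).coeff 0 = 1 := fun i =>
    (coeff_one_prod_of_coeff_zero_eq_one _ _ (hl0 i)).1
  have hP1 : ∀ i, (P i).coeff 1 = terms e f i k * harmonic (t i) := fun i => by
    rw [(coeff_one_prod_of_coeff_zero_eq_one _ _ (hl0 i)).2,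
      Finset.sum_congr rfl fun r _ => hl1 i r, ← Finset.mul_sum, harmonic]
    push_cast
    rfl
  have heval : ∀ i (T : ℕ), (P i).eval (T : ℚ) =
      ((terms e f i ⬝ᵥ Pi.single k T + 1).ascFactorial (t i) : ℚ) /
        ((1 : ℕ).ascFactorial (t i) : ℚ) := by
    intro i T
    rw [Nat.ascFactorial_eq_prod_range, Nat.ascFactorial_eq_prod_range, Polynomial.eval_prod]
    push_cast
    rw [← Finset.prod_div_distrib]
    refine Finset.prod_congr rfl fun r _ => ?_
    have hr : (r : ℚ) + 1 ≠ 0 := by positivity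
    simp only [ℓ, Polynomial.eval_add, Polynomial.eval_one, Polynomial.eval_mul, Polynomial.eval_C,
      Polynomial.eval_X, dotProduct_single]
    push_cast
    rw [add_comm (1 : ℚ) r]
    field_simp
    ring
  have hpos : ∀ i (T : ℕ), (P i).eval (T : ℚ) ≠ 0 := fun i T => by
    rw [heval]
    exact div_ne_zero (by exact_mod_cast (Nat.ascFactorial_pos _ (t i)).ne')
      (by exact_mod_cast (Nat.ascFactorial_pos 0 (t i)).ne')
  have hND : ∏ i, P (Sum.inl i) = ∏ j, P (Sum.inr j) := by
    refine Polynomial.eq_of_infinite_eval_eq _ _ ?_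
    refine (Set.infinite_range_of_injective (Nat.cast_injective (R := ℚ))).mono ?_
    rintro _ ⟨T, rfl⟩
    have h := hall T
    rw [growth, Fintype.prod_sum_type] at h
    simp only [← heval, signs, Sum.elim_inl, Sum.elim_inr, zpow_one, zpow_neg,
      Finset.prod_inv_distrib] at h
    rw [Set.mem_ofPred_eq, Polynomial.eval_prod, Polynomial.eval_prod]
    rwa [mul_inv_eq_one₀ (Finset.prod_ne_zero_iff.2 fun j _ => hpos _ T)] at h
  have h1 := congrArg (fun Q => Polynomial.coeff Q 1) hND
  simp only [(coeff_one_prod_of_coeff_zero_eq_one _ _ fun i => hP0 (Sum.inl i)).2,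
    (coeff_one_prod_of_coeff_zero_eq_one _ _ fun i => hP0 (Sum.inr i)).2, hP1] at h1
  rw [Fintype.sum_sum_type]
  simp only [signs, Sum.elim_inl, Sum.elim_inr]
  push_cast
  simp only [one_mul, neg_mul, Finset.sum_neg_distrib]
  rw [h1, add_neg_cancel]

end Growth

/-! ### A coefficient that is not divisible by `p` -/

section Obstruction

variable {d : ℕ} {ι : Type*} [Fintype ι] {c : ι → Fin d → ℕ} {σ : ι → ℤ} {t : ι → ℕ}

theorem sum_Iic_single {M : Type*} [AddCommMonoid M] (k : Fin d) (T : ℕ)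
    (g : (Fin d → ℕ) → M) :
    ∑ j ∈ Finset.Iic (Pi.single k T), g j = ∑ i ∈ Finset.range (T + 1), g (Pi.single k i) := by
  have hj : ∀ j ∈ Finset.Iic (Pi.single k T : Fin d → ℕ), Pi.single k (j k) = j := by
    intro j hj
    ext l
    rcases eq_or_ne l k with rfl | hl
    · simp
    · have : j l ≤ (Pi.single k T : Fin d → ℕ) l := Finset.mem_Iic.1 hj l
      rw [Pi.single_eq_of_ne hl] at this
      rw [Pi.single_eq_of_ne hl]
      omega
  refine Finset.sum_nbij' (fun j => j k) (fun i => Pi.single k i) ?_ ?_ hj ?_ ?_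
  · intro j hj
    have : j k ≤ (Pi.single k T : Fin d → ℕ) k := Finset.mem_Iic.1 hj k
    rw [Pi.single_eq_same] at this
    exact Finset.mem_range.2 (by omega)
  · intro i hi
    rw [Finset.mem_range] at hi
    rw [Finset.mem_Iic]
    exact Pi.single_mono k (by omega)
  · intro i _
    simp
  · intro j hj'
    rw [hj j hj']

/-- A rational number that for all large `p` is congruent modulo `p`, up to the unit `𝒬(a)`, to the
coefficient at `a + pT 1_k` which the `p`-integrality of `q_L` forces to be divisible by `p`. -/
noncomputable def obstruction (c : ι → Fin d → ℕ) (σ : ι → ℤ) (t : ι → ℕ)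
    (L : Fin d → ℕ) (k : Fin d) (T : ℕ) : ℚ :=
  ∑ i ∈ Finset.range (T + 1), facQuot ℚ c σ (Pi.single k (T - i)) * facQuot ℚ c σ (Pi.single k i) *
    growth c σ t (Pi.single k i) *
    (harmonic (L ⬝ᵥ Pi.single k (T - i)) - harmonic (L ⬝ᵥ Pi.single k i))

theorem obstruction_ne_zero {L : Fin d → ℕ} {k : Fin d} (hL : 1 ≤ L k) {T : ℕ}
    (hT : growth c σ t (Pi.single k T) ≠ 1)
    (hmin : ∀ i < T, growth c σ t (Pi.single k i) = 1) : obstruction c σ t L k T ≠ 0 := by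
  have hT0 : T ≠ 0 := by
    rintro rfl
    rw [Pi.single_zero] at hT
    exact hT growth_zero
  let w : ℕ → ℚ := fun i => facQuot ℚ c σ (Pi.single k (T - i)) * facQuot ℚ c σ (Pi.single k i)
  let h : ℕ → ℚ := fun i => harmonic (L ⬝ᵥ Pi.single k i)
  -- without the growth factor the sum is antisymmetric
  have hanti : ∑ i ∈ Finset.range (T + 1), w i * (h (T - i) - h i) = 0 := by
    have hrefl := Finset.sum_range_reflect (fun i => w i * (h (T - i) - h i)) (T + 1)
    have hneg : ∑ i ∈ Finset.range (T + 1), w (T + 1 - 1 - i) *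
        (h (T - (T + 1 - 1 - i)) - h (T + 1 - 1 - i)) =
        -∑ i ∈ Finset.range (T + 1), w i * (h (T - i) - h i) := by
      rw [← Finset.sum_neg_distrib]
      refine Finset.sum_congr rfl fun i hi => ?_
      rw [Finset.mem_range] at hi
      rw [Nat.add_sub_cancel]
      simp only [w]
      rw [show T - (T - i) = i by omega]
      ring
    linarith
  have e : obstruction c σ t L k T = ∑ i ∈ Finset.range (T + 1),
      w i * (growth c σ t (Pi.single k i) - 1) * (h (T - i) - h i) := by
    rw [← sub_zero (obstruction c σ t L k T), ← hanti, obstruction, ← Finset.sum_sub_distrib]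
    refine Finset.sum_congr rfl fun i _ => ?_
    simp only [w, h]
    ring
  rw [e, Finset.sum_range_succ, Finset.sum_eq_zero, zero_add]
  · refine mul_ne_zero (mul_ne_zero (mul_ne_zero (facQuot_ne_zero _ _) (facQuot_ne_zero _ _))
      (sub_ne_zero.2 hT)) ?_
    simp only [h, Nat.sub_self, dotProduct_single, mul_zero, harmonic_zero, zero_sub, ne_eq,
      neg_eq_zero]
    exact (harmonic_pos (mul_ne_zero (show L k ≠ 0 by omega) hT0)).ne'
  · intro i hi
    rw [hmin i (Finset.mem_range.1 hi), sub_self, mul_zero, zero_mul]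

variable {p : ℕ} [hp : Fact p.Prime]

theorem norm_eq_one_of_norm_sub_le {x y : ℚ_[p]} (h : ‖x - y‖ ≤ (p : ℝ)⁻¹) (hy : ‖y‖ = 1) :
    ‖x‖ = 1 := by
  have hε1 : (p : ℝ)⁻¹ < 1 := inv_lt_one_of_one_lt₀ (by exact_mod_cast hp.out.one_lt)
  have h1 : ‖x - y‖ ≠ ‖y‖ := by rw [hy]; exact (h.trans_lt hε1).ne
  have := IsUltrametricDist.norm_add_eq_max_of_norm_ne_norm h1
  rw [sub_add_cancel, hy, max_eq_right (h.trans hε1.le)] at this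
  exact this

theorem dworkCoeff_zero {A B : (Fin d → ℕ) → ℚ_[p]} (hA : A 0 = 1) (hB : B 0 = 0)
    (a : Fin d → ℕ) : dworkCoeff A B a 0 = -(A a * (p * B a)) := by
  have : Finset.Iic (0 : Fin d → ℕ) = {0} := by
    ext j
    simp [funext_iff]
  rw [dworkCoeff, this, Finset.sum_singleton]
  simp [hA, hB]

/-- If `⌊L · a / p⌋ = 0` and `𝒬(a)` is a unit, then the coefficient at `a + pT 1_k` is congruent to
`𝒬(a)` times `obstruction`, hence a unit if the latter is. -/
theorem norm_dworkCoeff_single_eq_one (hσ : ∀ k, ∑ i, σ i * (c i k : ℤ) = 0) {a L : Fin d → ℕ}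
    (ha : ∀ i, c i ⬝ᵥ a / p = t i) (hLa : L ⬝ᵥ a / p = 0) (hQa : ‖facQuot ℚ_[p] c σ a‖ = 1)
    {k : Fin d} {T : ℕ} (hQ : ∀ n, ‖facQuot ℚ_[p] c σ n‖ ≤ 1)
    (hP : ∀ i ∈ Finset.range (T + 1), ‖((growth c σ t (Pi.single k i) : ℚ) : ℚ_[p])‖ ≤ 1)
    (hH : ∀ i ∈ Finset.range (T + 1), ‖harm p (L ⬝ᵥ Pi.single k i)‖ ≤ 1)
    (hR : ‖((obstruction c σ t L k T : ℚ) : ℚ_[p])‖ = 1) :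
    ‖dworkCoeff (facQuot ℚ_[p] c σ) (fun n => harm p (L ⬝ᵥ n)) a (Pi.single k T)‖ = 1 := by
  have hε := p_inv_pos (p := p)
  set Q := facQuot ℚ_[p] c σ with hQdef
  refine norm_eq_one_of_norm_sub_le (y := Q a * ((obstruction c σ t L k T : ℚ) : ℚ_[p])) ?_
    (by rw [norm_mul, hQa, hR, one_mul])
  have hcast : ((obstruction c σ t L k T : ℚ) : ℚ_[p]) = ∑ i ∈ Finset.range (T + 1),
      Q (Pi.single k (T - i)) * Q (Pi.single k i) *
        ((growth c σ t (Pi.single k i) : ℚ) : ℚ_[p]) *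
        (harm p (L ⬝ᵥ Pi.single k (T - i)) - harm p (L ⬝ᵥ Pi.single k i)) := by
    have hc : ∀ n, ((facQuot ℚ c σ n : ℚ) : ℚ_[p]) = Q n := fun n =>
      map_facQuot (Rat.castHom ℚ_[p]) n
    rw [obstruction]
    push_cast
    simp only [hc, harm]
  rw [hcast, dworkCoeff, sum_Iic_single, Finset.mul_sum, ← Finset.sum_sub_distrib]
  refine norm_sum_le_of_le hε.le fun i hi => ?_
  have hTi : (Pi.single k T : Fin d → ℕ) - Pi.single k i = Pi.single k (T - i) := by
    ext l
    rcases eq_or_ne l k with rfl | hl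
    · simp
    · simp [Pi.single_eq_of_ne hl]
  obtain ⟨η, hη, hstep⟩ := exists_facQuot_eq_growth (p := p) hσ ha (Pi.single k i)
  rw [← hQdef] at hstep
  have hharm : ‖p * harm p (L ⬝ᵥ (a + p • Pi.single k i)) - harm p (L ⬝ᵥ Pi.single k i)‖ ≤
      (p : ℝ)⁻¹ := by
    have h := norm_p_mul_harm_sub_le (p := p) (L ⬝ᵥ (a + p • Pi.single k i))
    rwa [dotProduct_add_smul, Nat.add_mul_div_left _ _ hp.out.pos, hLa, zero_add,
      ← dotProduct_add_smul] at h
  have hTi_mem : T - i ∈ Finset.range (T + 1) := Finset.mem_range.2 (by omega)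
  rw [hTi, hstep]
  set P := ((growth c σ t (Pi.single k i) : ℚ) : ℚ_[p]) with hPdef
  set h₁ := harm p (L ⬝ᵥ Pi.single k (T - i)) with hh₁
  set h₀ := harm p (L ⬝ᵥ Pi.single k i) with hh₀
  set g := p * harm p (L ⬝ᵥ (a + p • Pi.single k i)) with hg
  have e : Q (Pi.single k (T - i)) * (Q a * (Q (Pi.single k i) * (η * P))) * (h₁ - g) -
      Q a * (Q (Pi.single k (T - i)) * Q (Pi.single k i) * P * (h₁ - h₀)) =
      Q a * Q (Pi.single k (T - i)) * Q (Pi.single k i) * P *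
        ((η - 1) * (h₁ - h₀ - (g - h₀)) - (g - h₀)) := by ring
  rw [e, norm_mul, norm_mul, norm_mul, norm_mul, hQa, one_mul]
  have hcoef : ‖Q (Pi.single k (T - i))‖ * ‖Q (Pi.single k i)‖ * ‖P‖ ≤ 1 :=
    mul_le_one₀ (mul_le_one₀ (hQ _) (norm_nonneg _) (hQ _)) (norm_nonneg _) (hP i hi)
  refine (mul_le_of_le_one_left (norm_nonneg _) hcoef).trans (norm_sub_le_of_le ?_ hharm)
  rw [norm_mul]
  have h2 : ‖h₁ - h₀ - (g - h₀)‖ ≤ 1 :=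
    norm_sub_le_of_le (norm_sub_le_of_le (hH _ hTi_mem) (hH i hi)) (hharm.trans p_inv_le_one)
  calc _ ≤ (p : ℝ)⁻¹ * 1 := mul_le_mul hη h2 (norm_nonneg _) hε.le
    _ = _ := mul_one _

end Obstruction

/-! ### Failure of integrality at large primes -/

section Necessity

variable {d q₁ q₂ : ℕ} {e : Fin q₁ → Fin d → ℕ} {f : Fin q₂ → Fin d → ℕ}

theorem not_norm_one_le {p : ℕ} [Fact p.Prime] {x : ℚ_[p]} (h1 : ‖x‖ = 1)
    (h : ‖x‖ ≤ (p : ℝ)⁻¹) : False := by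
  rw [h1] at h
  exact absurd h (not_le.2 (inv_lt_one_of_one_lt₀
    (by exact_mod_cast (Fact.out : p.Prime).one_lt)))

/-- For large `p` the mirror-type map `q_L` is not `p`-integral, when `k` is chosen by
`exists_sum_harmonic_ne_zero`. -/
theorem eventually_not_hasPadicIntCoeffs_mirrorType (hsum : ∑ i, e i = ∑ j, f j)
    (h : IsIntegralFamily e f) {x : Fin d → ℝ} (hx : ∀ k, 0 ≤ x k ∧ x k < 1)
    (h0 : landau e f x = 0) {k : Fin d}
    (hk : ∑ i, (signs q₁ q₂ i : ℚ) *
      (terms e f i k * harmonic ⌊dotReal (terms e f i) x⌋₊) ≠ 0)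
    {L : Fin d → ℕ} (hL : 1 ≤ L k) :
    ∀ᶠ p : ℕ in atTop, ∀ [Fact p.Prime], ¬ HasPadicIntCoeffs p (mirrorType L e f) := by
  have hx0 : ∀ k, 0 ≤ x k := fun k => (hx k).1
  have hcrit : ∀ (p : ℕ) [Fact p.Prime], HasPadicIntCoeffs p (mirrorType L e f) → _ := fun p _ =>
    (hasPadicIntCoeffs_iff p h (fun n => harmonic (L ⬝ᵥ n)) (by simp)).1
  by_cases htL : ⌊dotReal L x⌋₊ = 0
  · -- the coefficient at `a + p T 1_k`, with `T` minimal such that the growth factor is not `1`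
    set t : Fin q₁ ⊕ Fin q₂ → ℕ := fun i => ⌊dotReal (terms e f i) x⌋₊ with ht
    have hex := exists_growth_ne_one (t := t) hk
    classical
    have hR := obstruction_ne_zero (L := L) (k := k) hL (Nat.find_spec hex)
      fun i hi => not_not.1 (Nat.find_min hex hi)
    set T := Nat.find hex
    filter_upwards [eventually_ceilVec_mem_box hx,
      eventually_all.2 fun i => eventually_dotProduct_ceilVec_div hx0 (terms e f i),
      eventually_dotProduct_ceilVec_div hx0 L,
      eventually_norm_facQuot_ceilVec (e := e) (f := f) hx0,
      (Finset.range (T + 1)).eventually_all.2 fun i _ => eventually_norm_rat_le_one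
        (growth (terms e f) (signs q₁ q₂) t (Pi.single k i)),
      (Finset.range (T + 1)).eventually_all.2 fun i _ => eventually_norm_rat_le_one
        (harmonic (L ⬝ᵥ Pi.single k i)),
      eventually_norm_rat_eq_one hR] with p h1 h2 h3 h4 h5 h6 h7 _ hpad
    rw [htL] at h3
    rw [h0, zpow_zero] at h4
    exact not_norm_one_le (norm_dworkCoeff_single_eq_one (sum_signs_mul hsum) h2 h3 h4
      (h.norm_le p) (fun i hi => h5 i hi) (fun i hi => h6 i hi) h7) (hcrit p hpad _ h1 _)
  · -- the coefficient at `a` itself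
    have hR : harmonic ⌊dotReal L x⌋₊ ≠ 0 := (harmonic_pos htL).ne'
    filter_upwards [eventually_ceilVec_mem_box hx, eventually_dotProduct_ceilVec_div hx0 L,
      eventually_norm_facQuot_ceilVec (e := e) (f := f) hx0,
      eventually_norm_rat_eq_one hR] with p h1 h2 h3 h4 _ hpad
    rw [h0, zpow_zero] at h3
    refine not_norm_one_le ?_ (hcrit p hpad _ h1 0)
    have h5 := norm_p_mul_harm_sub_le (p := p) (L ⬝ᵥ ceilVec x p)
    rw [h2] at h5
    rw [dworkCoeff_zero (facQuot_zero _) (by simp), norm_neg, norm_mul, h3, one_mul]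
    exact norm_eq_one_of_norm_sub_le h5 h4

theorem hasPadicIntCoeffs_of_memXMulPadicInt {p : ℕ} [Fact p.Prime] {k : Fin d}
    {g : MvPowerSeries (Fin d) ℚ} (h : MemXMulPadicInt p k (MvPowerSeries.X k * g)) :
    HasPadicIntCoeffs p g := by
  obtain ⟨u, hu⟩ := h
  rw [map_mul, MvPowerSeries.map_X] at hu
  have hX : (MvPowerSeries.X k : MvPowerSeries (Fin d) ℚ_[p]) ≠ 0 := fun h0 => by
    simpa using congrArg (MvPowerSeries.coeff (Finsupp.single k 1)) h0
  exact ⟨u, mul_left_cancel₀ hX hu⟩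

/-- For large `p` the canonical coordinate `q_k` is not in `z_k ℤ_p[[z]]`: its Dieudonné–Dwork
coefficient at `⌈p x⌉` is congruent to a unit times the nonzero sum of the hypothesis. -/
theorem eventually_not_memXMulPadicInt_canonicalCoord
    (h : IsIntegralFamily e f) {x : Fin d → ℝ} (hx : ∀ k, 0 ≤ x k ∧ x k < 1)
    (h0 : landau e f x = 0) {k : Fin d}
    (hk : ∑ i, (signs q₁ q₂ i : ℚ) *
      (terms e f i k * harmonic ⌊dotReal (terms e f i) x⌋₊) ≠ 0) :
    ∀ᶠ p : ℕ in atTop, ∀ [Fact p.Prime], ¬ MemXMulPadicInt p k (canonicalCoord e f k) := by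
  have hx0 : ∀ k, 0 ≤ x k := fun k => (hx k).1
  let B : (Fin d → ℕ) → ℚ := fun n =>
    ∑ i, (e i k : ℚ) * harmonic (e i ⬝ᵥ n) - ∑ j, (f j k : ℚ) * harmonic (f j ⬝ᵥ n)
  have hB0 : B 0 = 0 := by simp [B]
  have hB : ∀ n, B n = ∑ i, (signs q₁ q₂ i : ℚ) *
      (terms e f i k * harmonic (terms e f i ⬝ᵥ n)) := fun n => by
    simp [B, signs, terms, sub_eq_add_neg]
  filter_upwards [eventually_ceilVec_mem_box hx,
    eventually_all.2 fun i => eventually_dotProduct_ceilVec_div hx0 (terms e f i),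
    eventually_norm_facQuot_ceilVec (e := e) (f := f) hx0,
    eventually_norm_rat_eq_one hk] with p h1 h2 h3 h4 _ hmem
  have hpad := (hasPadicIntCoeffs_iff p h B hB0).1 (hasPadicIntCoeffs_of_memXMulPadicInt hmem)
  rw [h0, zpow_zero] at h3
  refine not_norm_one_le ?_ (hpad _ h1 0)
  rw [dworkCoeff_zero (facQuot_zero _) (by simp [hB0]), norm_neg, norm_mul, h3, one_mul]
  refine norm_eq_one_of_norm_sub_le ?_ h4
  rw [hB]
  push_cast
  rw [Finset.mul_sum, ← Finset.sum_sub_distrib]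
  refine norm_sum_le_of_le p_inv_pos.le fun i _ => ?_
  have h5 := norm_p_mul_harm_sub_le (p := p) (terms e f i ⬝ᵥ ceilVec x p)
  rw [h2 i] at h5
  have e1 : (p : ℚ_[p]) * ((signs q₁ q₂ i : ℚ_[p]) * ((terms e f i k : ℚ_[p]) *
      ((harmonic (terms e f i ⬝ᵥ ceilVec x p) : ℚ) : ℚ_[p]))) - (signs q₁ q₂ i : ℚ_[p]) *
      ((terms e f i k : ℚ_[p]) * ((harmonic ⌊dotReal (terms e f i) x⌋₊ : ℚ) : ℚ_[p])) =
      ((signs q₁ q₂ i * (terms e f i k : ℤ) : ℤ) : ℚ_[p]) *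
        (p * harm p (terms e f i ⬝ᵥ ceilVec x p) - harm p ⌊dotReal (terms e f i) x⌋₊) := by
    unfold harm
    push_cast
    ring
  rw [e1, norm_mul]
  exact (mul_le_of_le_one_left (norm_nonneg _) (Padic.norm_int_le_one _)).trans h5

theorem finite_primes_of_eventually {P : ∀ (p : ℕ) [Fact p.Prime], Prop}
    (h : ∀ᶠ p : ℕ in atTop, ∀ [Fact p.Prime], ¬ P p) :
    {p : ℕ | ∃ _ : Fact p.Prime, P p}.Finite := by
  obtain ⟨N, hN⟩ := eventually_atTop.1 h
  refine (Set.finite_Iio N).subset ?_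
  rintro p ⟨hp, hP⟩
  exact not_le.1 fun hle => hN p hle hP

end Necessity

end MirrorMap

theorem theorem2 (d q₁ q₂ : ℕ) (e : Fin q₁ → Fin d → ℕ) (f : Fin q₂ → Fin d → ℕ)
    (he : ∀ i, e i ≠ 0) (hf : ∀ j, f j ≠ 0) (hdisj : ∀ i j, e i ≠ f j)
    (hsum : ∑ i, e i = ∑ j, f j) :
    (MirrorMap.IsIntegralFamily e f ↔
      ∀ x : Fin d → ℝ, (∀ k, 0 ≤ x k ∧ x k ≤ 1) → 0 ≤ MirrorMap.landau e f x) ∧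
    (MirrorMap.IsIntegralFamily e f →
      ((∀ x ∈ MirrorMap.domainD e f, 1 ≤ MirrorMap.landau e f x) →
        ∀ L ∈ MirrorMap.setE e f, MirrorMap.HasIntCoeffs (MirrorMap.mirrorType L e f)) ∧
      ((∃ x ∈ MirrorMap.domainD e f, MirrorMap.landau e f x = 0) →
        ∃ k : Fin d,
          (∀ L ∈ MirrorMap.setE e f, 1 ≤ L k →
            {p : ℕ | ∃ _ : Fact p.Prime,
              MirrorMap.HasPadicIntCoeffs p (MirrorMap.mirrorType L e f)}.Finite) ∧
          {p : ℕ | ∃ _ : Fact p.Prime,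
            MirrorMap.MemXMulPadicInt p k (MirrorMap.canonicalCoord e f k)}.Finite)) := by
  refine ⟨MirrorMap.isIntegralFamily_iff hsum, fun h => ⟨fun hD L hL =>
    MirrorMap.hasIntCoeffs_mirrorType hsum h hD hL, ?_⟩⟩
  rintro ⟨x, hx, h0⟩
  obtain ⟨x', hx', h0', hgen⟩ := MirrorMap.exists_generic_zero hdisj hx h0
  obtain ⟨k, hk⟩ := MirrorMap.exists_sum_harmonic_ne_zero
    ((MirrorMap.isIntegralFamily_iff hsum).1 h) hx' hgen
  exact ⟨k, fun L _ hL => MirrorMap.finite_primes_of_eventually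
      (MirrorMap.eventually_not_hasPadicIntCoeffs_mirrorType hsum h hx'.1 h0' hk hL),
    MirrorMap.finite_primes_of_eventually
      (MirrorMap.eventually_not_memXMulPadicInt_canonicalCoord h hx'.1 h0' hk)⟩
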